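/- Let $\mathbb K=\mathbb R$ or $\mathbb C$, and let $\mathfrak g$ be an IFFT-algebra (irreducible, filtered, finite-dimensional, transitive Lie algebra) in its standard realization by polynomial vector fields on $V=\mathfrak g_{-1}\cong\mathbb K^d$: a finite-dimensional Lie subalgebra of the polynomial vector fields on $V$, graded by the degree of the coefficients ($\mathfrak g_{p}$ has coefficients homogeneous of degree $p+1$), containing all constant vector fields, such that $\mathfrak g_0$ acts irreducibly on $\mathfrak g_{-1}$ and $\mathfrak g_1\neq 0$. Let $\mathfrak h_0=[\mathfrak g_0,\mathfrak g_0]$ be the semisimple part of $\mathfrak g_0$, and assume that $\widetilde{\mathfrak h_0}$ is simple, where $\widetilde{\mathfrak h_0}=\mathfrak h_0$ if $\mathbb K=\mathbb C$ and $\widetilde{\mathfrak h_0}=\mathfrak h_0\otimes_{\mathbb R}\mathbb C$ if $\mathbb K=\mathbb R$. Let $\lambda,\mu\in\mathbb R$ and $\delta=\mu-\lambda$. Sections are $C^\infty$ if $\mathbb K=\mathbb R$ and holomorphic if $\mathbb K=\mathbb C$; $\lambda$-densities on $V$ are functions $f$ with the Lie derivative $L^\lambda_Xf=X.f+\lambda\,\mathrm{tr}(DX)f$.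 Let $\mathcal D_{\lambda,\mu}=\bigcup_k\mathcal D^k_{\lambda,\mu}$ be the space of differential operators from $\lambda$-densities to $\mu$-densities, filtered by the order, with $\mathcal L_XD=L^\mu_X\circ D-D\circ L^\lambda_X$. Let $\mathcal S=\bigoplus_k\mathcal S^k$ be the space of symbols, $\mathcal S^k$ being the space of sections of $\bigvee^kV$ with values in $\delta$-densities, i.e. of functions of $(x,\xi)$ which are homogeneous polynomials of degree $k$ in $\xi\in V^*$, with the Lie derivative $$L^t_XP=\sum_iX^i\partial_iP-\sum_{i,j}(\partial_jX^i)\,\xi_i\,\frac{\partial P}{\partial\xi_j}+\delta\sum_i(\partial_iX^i)P .$$ The principal symbol of $D=\sum_{|\alpha|\le k}c_\alpha D^\alpha\in\mathcal D^k_{\lambda,\mu}$ is $\sum_{|\alpha|=k}c_\alpha\xi^\alpha$. Through the bijection $\sum c_\alpha D^\alpha\mapsto\sum c_\alpha\xi^\alpha$, view $\mathcal L_X$ as acting on $\mathcal S$, and put $\gamma(X)=\mathcal L_X-L^t_X$. Let $C$ be the Casimir operator of $(\mathcal S,L^t)$ with respect to $\mathfrak g$ and its Killing form. For every $k$, fix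 a decomposition $\bigvee^k\mathfrak g_{-1}=\bigoplus_pI_{k,p}$ into irreducible $\mathfrak h_0$-submodules. Let $E_{k,p}\subset\mathcal S^k$ be the space of sections of $I_{k,p}$ and $\alpha_{k,p}$ the eigenvalue of $C$ on $E_{k,p}$. Put $\mathcal T^0(E_{k,p})=E_{k,p}$ and let $\mathcal T^{l+1}(E_{k,p})=\gamma(\mathfrak g_1)(\mathcal T^l(E_{k,p}))$ be the span of the images of $\mathcal T^l(E_{k,p})$ under the operators $\gamma(X)$, $X\in\mathfrak g_1$. The pair $(\lambda,\mu)$ is called critical if, for some $k,p$, the number $\alpha_{k,p}$ is an eigenvalue of the restriction of $C$ to $\bigoplus_{l>0}\mathcal T^l(E_{k,p})$. **Theorem.** If $(\lambda,\mu)$ is not critical, then there exists a $\mathfrak g$-equivariant quantization, that is, a linear bijection $Q:\mathcal S\to\mathcal D_{\lambda,\mu}$ such that $Q\circ L^t_X=\mathcal L_X\circ Q$ for all $X\in\mathfrak g$ and such that, for every $k$ and every $D\in\mathcal D^k_{\lambda,\mu}$, the difference between $Q^{-1}(D)$ and the principal symbol of $D$ belongs to $\bigoplus_{l<k}\mathcal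 S^l$. -/

import Mathlib

open scoped ContDiff TensorProduct

noncomputable section

namespace IFFTQuant

/-! ### Smooth functions on `𝕂 ^ d`, for `𝕂 = ℝ` or `ℂ` -/

/-- The algebra of sections of the trivial line bundle over `V = 𝕂 ^ d`: the `C^∞` functions if
`𝕂 = ℝ`, the holomorphic functions if `𝕂 = ℂ` (smoothness being with respect to `𝕂`). -/
def smoothSubalgebra (𝕂 : Type*) [RCLike 𝕂] (d : ℕ) : Subalgebra 𝕂 ((Fin d → 𝕂) → 𝕂) where
  carrier := {f | ContDiff 𝕂 ∞ f}
  mul_mem' := fun {f g} (hf : ContDiff 𝕂 ∞ f) (hg : ContDiff 𝕂 ∞ g) => hf.mul hg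
  add_mem' := fun {f g} (hf : ContDiff 𝕂 ∞ f) (hg : ContDiff 𝕂 ∞ g) => hf.add hg
  algebraMap_mem' := fun c => (contDiff_const : ContDiff 𝕂 ∞ fun _ : Fin d → 𝕂 => c)

/-- The elements of `smoothSubalgebra 𝕂 d`. -/
def Smooth (𝕂 : Type*) [RCLike 𝕂] (d : ℕ) : Type _ := smoothSubalgebra 𝕂 d

variable {𝕂 : Type*} [RCLike 𝕂] {d : ℕ}

instance : CommRing (Smooth 𝕂 d) := inferInstanceAs (CommRing (smoothSubalgebra 𝕂 d))

instance : Algebra 𝕂 (Smooth 𝕂 d) := inferInstanceAs (Algebra 𝕂 (smoothSubalgebra 𝕂 d))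

instance : CoeFun (Smooth 𝕂 d) (fun _ => (Fin d → 𝕂) → 𝕂) := ⟨fun f => f.1⟩

lemma Smooth.ext' {f g : Smooth 𝕂 d} (h : ∀ x, f x = g x) : f = g := Subtype.ext (funext h)

lemma Smooth.add_apply (f g : Smooth 𝕂 d) (x : Fin d → 𝕂) : (f + g) x = f x + g x := rfl

lemma Smooth.mul_apply (f g : Smooth 𝕂 d) (x : Fin d → 𝕂) : (f * g) x = f x * g x := rfl

lemma Smooth.smul_apply (c : 𝕂) (f : Smooth 𝕂 d) (x : Fin d → 𝕂) : (c • f) x = c * f x := rfl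


lemma Smooth.contDiff (f : Smooth 𝕂 d) : ContDiff 𝕂 ∞ f.1 := f.2

lemma Smooth.differentiable (f : Smooth 𝕂 d) : Differentiable 𝕂 f.1 :=
  f.contDiff.differentiable (by simp)

/-- The partial derivative `∂ᵢ`. -/
def pd (i : Fin d) : Module.End 𝕂 (Smooth 𝕂 d) where
  toFun f := ⟨fun x => fderiv 𝕂 f.1 x (Pi.single i 1),
    (f.contDiff.fderiv_right (m := ∞) (by simp)).clm_apply contDiff_const⟩
  map_add' f g := Smooth.ext' fun x => by
    change fderiv 𝕂 (f.1 + g.1) x _ = fderiv 𝕂 f.1 x _ + fderiv 𝕂 g.1 x _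
    rw [fderiv_add (f.differentiable x) (g.differentiable x)]
    rfl
  map_smul' c f := Smooth.ext' fun x => by
    change fderiv 𝕂 (c • f.1) x _ = c * fderiv 𝕂 f.1 x _
    rw [fderiv_const_smul (f.differentiable x) c]
    rfl

lemma pd_apply (i : Fin d) (f : Smooth 𝕂 d) (x : Fin d → 𝕂) :
    (pd i f) x = fderiv 𝕂 f.1 x (Pi.single i 1) := rfl

lemma pd_mul (i : Fin d) (f g : Smooth 𝕂 d) : pd i (f * g) = f * pd i g + pd i f * g :=
  Smooth.ext' fun x => by
    change fderiv 𝕂 (f.1 * g.1) x _ = f.1 x * fderiv 𝕂 g.1 x _ + fderiv 𝕂 f.1 x _ * g.1 x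
    rw [fderiv_mul (f.differentiable x) (g.differentiable x)]
    simp [mul_comm]

lemma pd_comm (i j : Fin d) : Commute (pd i : Module.End 𝕂 (Smooth 𝕂 d)) (pd j) := by
  have key : ∀ (i j : Fin d) (f : Smooth 𝕂 d) (x : Fin d → 𝕂),
      (pd i (pd j f)) x
        = fderiv 𝕂 (fderiv 𝕂 f.1) x (Pi.single i 1) (Pi.single j 1) := by
    intro i j f x
    have hd : DifferentiableAt 𝕂 (fderiv 𝕂 f.1) x :=
      ((f.contDiff.fderiv_right (m := ∞) (by simp)).differentiable (by simp)) x
    rw [pd_apply]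
    change fderiv 𝕂 (fun y => fderiv 𝕂 f.1 y (Pi.single j 1)) x _ = _
    rw [fderiv_clm_apply hd (differentiableAt_const _)]
    simp
  refine LinearMap.ext fun f => Smooth.ext' fun x => ?_
  rw [Module.End.mul_apply, Module.End.mul_apply, key, key]
  have hs : IsSymmSndFDerivAt 𝕂 f.1 x :=
    (f.contDiff.contDiffAt).isSymmSndFDerivAt (by
      rw [minSmoothness_of_isRCLikeNormedField]
      exact WithTop.coe_le_coe.2 le_top)
  exact hs _ _

lemma pd_pow_pairwise (α : Fin d →₀ ℕ) (s : Set (Fin d)) :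
    s.Pairwise (Function.onFun Commute
      fun i => (pd i : Module.End 𝕂 (Smooth 𝕂 d)) ^ α i) :=
  fun i _ j _ _ => (pd_comm i j).pow_pow (α i) (α j)

/-- The operator `D^α = ∂₁^α₁ ⋯ ∂_d^α_d`. -/
def dPow (α : Fin d →₀ ℕ) : Module.End 𝕂 (Smooth 𝕂 d) :=
  Finset.univ.noncommProd (fun i => pd i ^ α i) (pd_pow_pairwise α _)

/-- The operator of multiplication by a smooth function. -/
abbrev mulOp (c : Smooth 𝕂 d) : Module.End 𝕂 (Smooth 𝕂 d) := LinearMap.mulLeft 𝕂 c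

/-- The coordinate function `xᵢ`. -/
def coord (i : Fin d) : Smooth 𝕂 d := ⟨fun x => x i, (contDiff_apply 𝕂 𝕂 i : ContDiff 𝕂 ∞ _)⟩

/-! ### Symbols and differential operators -/

/-- The space `𝒮` of symbols: polynomials in `ξ₁, …, ξ_d` with smooth coefficients. The space
`𝒮 ^ k` consists of those which are homogeneous of degree `k` in `ξ`; the line of
`δ`-densities is trivialised by the standard volume of `𝕂 ^ d`. -/
abbrev Symb (𝕂 : Type*) [RCLike 𝕂] (d : ℕ) : Type _ := MvPolynomial (Fin d) (Smooth 𝕂 d)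

/-- A symbol as the finitely supported family of its coefficients. -/
abbrev symbCoeffs : Symb 𝕂 d ≃ₗ[𝕂] ((Fin d →₀ ℕ) →₀ Smooth 𝕂 d) :=
  AddMonoidAlgebra.coeffLinearEquiv 𝕂

/-- The partial derivative `∂ᵢ` acting on the coefficients of a symbol. -/
def coeffDeriv (i : Fin d) : Module.End 𝕂 (Symb 𝕂 d) :=
  symbCoeffs.symm.toLinearMap ∘ₗ Finsupp.mapRange.linearMap (pd i) ∘ₗ symbCoeffs.toLinearMap

/-- Normal ordering: the symbol `∑ c_α ξ^α` is sent to the operator `f ↦ ∑ c_α D^α f`. -/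
def normalOrder : Symb 𝕂 d →ₗ[𝕂] Module.End 𝕂 (Smooth 𝕂 d) :=
  (Finsupp.lsum 𝕂 fun α =>
    (LinearMap.mulRight 𝕂 (dPow α)).comp (LinearMap.mul 𝕂 (Smooth 𝕂 d))) ∘ₗ
    symbCoeffs.toLinearMap

lemma coeffDeriv_monomial (i : Fin d) (α : Fin d →₀ ℕ) (c : Smooth 𝕂 d) :
    coeffDeriv i (MvPolynomial.monomial α c) = MvPolynomial.monomial α (pd i c) := by
  apply symbCoeffs.injective
  change symbCoeffs (symbCoeffs.symm _) = _
  rw [LinearEquiv.apply_symm_apply]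
  exact Finsupp.mapRange_single (hf := map_zero (pd i))

lemma normalOrder_monomial (α : Fin d →₀ ℕ) (c : Smooth 𝕂 d) :
    normalOrder (MvPolynomial.monomial α c) = mulOp c * dPow α := by
  change Finsupp.lsum 𝕂 _ (Finsupp.single α c) = _
  rw [Finsupp.lsum_single]
  rfl

lemma dPow_zero : (dPow 0 : Module.End 𝕂 (Smooth 𝕂 d)) = 1 := by
  rw [dPow, Finset.noncommProd_eq_pow_card _ _ _ 1 (by simp)]
  simp

lemma dPow_single (i : Fin d) : (dPow (Finsupp.single i 1) : Module.End 𝕂 (Smooth 𝕂 d)) = pd i := by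
  rw [dPow, ← Finset.noncommProd_erase_mul (a := i) Finset.univ (Finset.mem_univ i)]
  have h := Finset.noncommProd_eq_pow_card (Finset.univ.erase i)
    (fun j => (pd j : Module.End 𝕂 (Smooth 𝕂 d)) ^ Finsupp.single i 1 j)
    (pd_pow_pairwise _ _) 1 (fun j hj => by
      have : j ≠ i := Finset.ne_of_mem_erase hj
      simp [Finsupp.single_apply, this.symm])
  refine (congrArg₂ (· * ·) h rfl).trans ?_
  simp

lemma dPow_add (α β : Fin d →₀ ℕ) :
    (dPow (α + β) : Module.End 𝕂 (Smooth 𝕂 d)) = dPow α * dPow β := by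
  unfold dPow
  rw [← Finset.noncommProd_mul_distrib]
  · refine Finset.noncommProd_congr rfl (fun i _ => ?_) _
    simp [pow_add]
  · exact fun i _ j _ _ => (pd_comm i j).pow_pow _ _

lemma pd_mul_mulOp (i : Fin d) (f : Smooth 𝕂 d) :
    pd i * mulOp f = mulOp f * pd i + mulOp (pd i f) := by
  refine LinearMap.ext fun g => ?_
  simp [Module.End.mul_apply, pd_mul]

lemma normalOrder_C_mul (c : Smooth 𝕂 d) (P : Symb 𝕂 d) :
    normalOrder (MvPolynomial.C c * P) = mulOp c * normalOrder P := by
  induction P using MvPolynomial.induction_on' with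
  | monomial α b =>
    rw [MvPolynomial.C_mul_monomial, normalOrder_monomial, normalOrder_monomial, ← mul_assoc]
    congr 1
    exact LinearMap.ext fun g => by simp [Module.End.mul_apply]
  | add p q hp hq => rw [mul_add, map_add, hp, hq, map_add, mul_add]

lemma normalOrder_mul_X (i : Fin d) (P : Symb 𝕂 d) :
    normalOrder (P * MvPolynomial.X i) = normalOrder P * pd i := by
  induction P using MvPolynomial.induction_on' with
  | monomial α b =>
    rw [MvPolynomial.X, MvPolynomial.monomial_mul, mul_one, normalOrder_monomial,
      normalOrder_monomial, dPow_add, dPow_single, mul_assoc]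
  | add p q hp hq => rw [add_mul, map_add, hp, hq, map_add, add_mul]

lemma pd_mul_normalOrder (i : Fin d) (P : Symb 𝕂 d) :
    pd i * normalOrder P = normalOrder (P * MvPolynomial.X i + coeffDeriv i P) := by
  induction P using MvPolynomial.induction_on' with
  | monomial α b =>
    rw [map_add, normalOrder_mul_X, coeffDeriv_monomial, normalOrder_monomial,
      normalOrder_monomial, ← mul_assoc, pd_mul_mulOp, add_mul, mul_assoc, mul_assoc,
      ← dPow_single, ← dPow_add, ← dPow_add, add_comm α]
  | add p q hp hq =>
    rw [map_add, mul_add, hp, hq, ← map_add]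
    congr 1
    rw [add_mul, map_add]
    abel

lemma pd_coord (i j : Fin d) :
    pd i (coord j : Smooth 𝕂 d) = if i = j then 1 else 0 := Smooth.ext' fun x => by
  have : fderiv 𝕂 (fun x : Fin d → 𝕂 => x j) x = ContinuousLinearMap.proj j :=
    (ContinuousLinearMap.proj (R := 𝕂) (φ := fun _ : Fin d => 𝕂) j).fderiv
  rw [pd_apply]
  change fderiv 𝕂 (fun x : Fin d → 𝕂 => x j) x _ = _
  rw [this]
  by_cases h : i = j
  · subst h
    rw [if_pos rfl]
    exact Pi.single_eq_same i 1
  · rw [if_neg h]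
    exact Pi.single_eq_of_ne (Ne.symm h) 1

lemma normalOrder_mul_coord (i : Fin d) (P : Symb 𝕂 d) :
    normalOrder P * mulOp (coord i)
      = mulOp (coord i) * normalOrder P + normalOrder (MvPolynomial.pderiv i P) := by
  induction P using MvPolynomial.induction_on with
  | C c =>
    have h : normalOrder (MvPolynomial.C c : Symb 𝕂 d) = mulOp c := by
      rw [MvPolynomial.C_apply, normalOrder_monomial, dPow_zero, mul_one]
    rw [h, MvPolynomial.pderiv_C, map_zero, add_zero]
    exact LinearMap.ext fun g => by simp [Module.End.mul_apply, mul_left_comm]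
  | add p q hp hq => rw [map_add, add_mul, hp, hq, map_add, map_add, mul_add]; abel
  | mul_X p j hp =>
    rw [normalOrder_mul_X, mul_assoc, pd_mul_mulOp, mul_add, ← mul_assoc, hp,
      MvPolynomial.pderiv_mul, map_add, normalOrder_mul_X, add_mul, mul_assoc, add_assoc]
    congr 2
    rw [pd_coord, MvPolynomial.pderiv_X, Pi.single_apply]
    by_cases h : j = i
    · subst h
      have h1 : mulOp (1 : Smooth 𝕂 d) = 1 := LinearMap.ext fun g => by simp
      simp [h1]
    · have h0 : mulOp (0 : Smooth 𝕂 d) = 0 := LinearMap.ext fun g => by simp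
      simp [h, h0]

lemma normalOrder_one (P : Symb 𝕂 d) : normalOrder P 1 = MvPolynomial.coeff 0 P := by
  induction P using MvPolynomial.induction_on with
  | C c => rw [MvPolynomial.C_apply, normalOrder_monomial, dPow_zero]; simp
  | add p q hp hq => rw [map_add, LinearMap.add_apply, hp, hq, MvPolynomial.coeff_add]
  | mul_X p i hp =>
    have h : pd i (1 : Smooth 𝕂 d) = 0 := by
      have := pd_mul i (1 : Smooth 𝕂 d) 1
      simpa using this
    rw [normalOrder_mul_X, Module.End.mul_apply, h, map_zero,
      MvPolynomial.coeff_mul_X']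
    simp

lemma normalOrder_injective :
    Function.Injective (normalOrder : Symb 𝕂 d →ₗ[𝕂] Module.End 𝕂 (Smooth 𝕂 d)) := by
  rw [injective_iff_map_eq_zero]
  intro P hP
  ext1 α
  rw [MvPolynomial.coeff_zero]
  obtain ⟨n, hn⟩ : ∃ n, α.degree = n := ⟨_, rfl⟩
  induction n generalizing P α with
  | zero =>
    rw [Finsupp.degree_eq_zero_iff] at hn
    rw [hn, ← normalOrder_one, hP, LinearMap.zero_apply]
  | succ n ih =>
    obtain ⟨i, hi⟩ : ∃ i, α i ≠ 0 := by
      by_contra! h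
      have : α = 0 := Finsupp.ext h
      simp [this] at hn
    have hα : α - Finsupp.single i 1 + Finsupp.single i 1 = α :=
      tsub_add_cancel_of_le (by simpa [Nat.one_le_iff_ne_zero] using hi)
    have h0 : normalOrder (MvPolynomial.pderiv i P) = 0 := by
      have h := normalOrder_mul_coord i P
      simpa [hP] using h.symm
    have hdeg : (α - Finsupp.single i 1).degree = n := by
      have := congrArg Finsupp.degree hα
      rw [map_add, hn, Finsupp.degree_single] at this
      omega
    have h1 := ih _ h0 _ hdeg
    rw [MvPolynomial.coeff_pderiv, hα] at h1
    have h2 : (((α - Finsupp.single i 1 : Fin d →₀ ℕ) i : ℕ) : 𝕂) + 1 ≠ 0 :=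
      Nat.cast_add_one_ne_zero _
    have h3 : ((((α - Finsupp.single i 1 : Fin d →₀ ℕ) i : ℕ) : 𝕂) + 1) • MvPolynomial.coeff α P
        = 0 := by
      rw [Algebra.smul_def, mul_comm, ← h1]
      simp
    exact (smul_eq_zero.1 h3).resolve_left h2

/-- The space `𝒟` of linear differential operators on `𝕂 ^ d`. -/
def DiffOp (𝕂 : Type*) [RCLike 𝕂] (d : ℕ) : Submodule 𝕂 (Module.End 𝕂 (Smooth 𝕂 d)) :=
  LinearMap.range normalOrder

/-- The total symbol map `∑ c_α D^α ↦ ∑ c_α ξ^α`, the inverse of normal ordering. -/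
def totalSymbol : DiffOp 𝕂 d ≃ₗ[𝕂] Symb 𝕂 d :=
  (LinearEquiv.ofInjective normalOrder normalOrder_injective).symm

/-- `D` belongs to the space `𝒟 ^ k` of differential operators of order at most `k`. -/
def HasOrderLE (k : ℕ) (D : DiffOp 𝕂 d) : Prop := (totalSymbol D).totalDegree ≤ k

/-- The principal symbol of `D`, as an operator of order at most `k`. -/
def principalSymbol (k : ℕ) (D : DiffOp 𝕂 d) : Symb 𝕂 d :=
  MvPolynomial.homogeneousComponent k (totalSymbol D)

/-! ### Polynomial vector fields and Lie derivatives -/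

/-- The Lie algebra of polynomial vector fields `X = ∑ Xⁱ ∂ᵢ` on `𝕂 ^ d`, viewed as derivations
of the polynomial algebra; the component `Xⁱ` is the value of `X` on the coordinate `xᵢ`. -/
abbrev PolyField (𝕂 : Type*) [RCLike 𝕂] (d : ℕ) : Type _ :=
  Derivation 𝕂 (MvPolynomial (Fin d) 𝕂) (MvPolynomial (Fin d) 𝕂)

/-- The `i`-th component of a polynomial vector field, as a polynomial function on `𝕂 ^ d`. -/
def component (X : PolyField 𝕂 d) (i : Fin d) : Smooth 𝕂 d :=
  MvPolynomial.aeval coord (X (MvPolynomial.X i))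

lemma component_add (X Y : PolyField 𝕂 d) (i : Fin d) :
    component (X + Y) i = component X i + component Y i := by simp [component]

lemma component_smul (c : 𝕂) (X : PolyField 𝕂 d) (i : Fin d) :
    component (c • X) i = c • component X i := by simp [component]

/-- The divergence `∑ ∂ᵢ Xⁱ`, the trace of the Jacobian matrix. -/
def divergence (X : PolyField 𝕂 d) : Smooth 𝕂 d := ∑ i, pd i (component X i)

/-- The Lie derivative of densities of weight `w`: `L_X f = ∑ Xⁱ ∂ᵢ f + w tr(DX) f`. -/
def lieDensity (w : 𝕂) (X : PolyField 𝕂 d) : Module.End 𝕂 (Smooth 𝕂 d) :=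
  (∑ i, mulOp (component X i) * pd i) + mulOp (w • divergence X)

lemma mulOp_mul_mem (f : Smooth 𝕂 d) {D : Module.End 𝕂 (Smooth 𝕂 d)} (hD : D ∈ DiffOp 𝕂 d) :
    mulOp f * D ∈ DiffOp 𝕂 d := by
  obtain ⟨P, rfl⟩ := hD
  exact ⟨_, normalOrder_C_mul f P⟩

lemma pd_mul_mem (i : Fin d) {D : Module.End 𝕂 (Smooth 𝕂 d)} (hD : D ∈ DiffOp 𝕂 d) :
    pd i * D ∈ DiffOp 𝕂 d := by
  obtain ⟨P, rfl⟩ := hD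
  exact ⟨_, (pd_mul_normalOrder i P).symm⟩

lemma mul_pd_mem (i : Fin d) {D : Module.End 𝕂 (Smooth 𝕂 d)} (hD : D ∈ DiffOp 𝕂 d) :
    D * pd i ∈ DiffOp 𝕂 d := by
  obtain ⟨P, rfl⟩ := hD
  exact ⟨_, normalOrder_mul_X i P⟩

lemma mul_mulOp_mem (f : Smooth 𝕂 d) {D : Module.End 𝕂 (Smooth 𝕂 d)} (hD : D ∈ DiffOp 𝕂 d) :
    D * mulOp f ∈ DiffOp 𝕂 d := by
  obtain ⟨P, rfl⟩ := hD
  induction P using MvPolynomial.induction_on generalizing f with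
  | C c =>
    refine ⟨MvPolynomial.C (c * f), ?_⟩
    rw [MvPolynomial.C_apply, MvPolynomial.C_apply, normalOrder_monomial, normalOrder_monomial,
      dPow_zero, mul_one, mul_one]
    exact LinearMap.ext fun g => by simp [Module.End.mul_apply, mul_assoc]
  | add p q hp hq => rw [map_add, add_mul]; exact add_mem (hp f) (hq f)
  | mul_X p i hp =>
    rw [normalOrder_mul_X, mul_assoc, pd_mul_mulOp, mul_add, ← mul_assoc]
    exact add_mem (mul_pd_mem i (hp f)) (hp _)

lemma lieDensity_mul_mem (w : 𝕂) (X : PolyField 𝕂 d) {D : Module.End 𝕂 (Smooth 𝕂 d)}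
    (hD : D ∈ DiffOp 𝕂 d) : lieDensity w X * D ∈ DiffOp 𝕂 d := by
  rw [lieDensity, add_mul, Finset.sum_mul]
  refine add_mem (sum_mem fun i _ => ?_) (mulOp_mul_mem _ hD)
  rw [mul_assoc]
  exact mulOp_mul_mem _ (pd_mul_mem i hD)

lemma mul_lieDensity_mem (w : 𝕂) (X : PolyField 𝕂 d) {D : Module.End 𝕂 (Smooth 𝕂 d)}
    (hD : D ∈ DiffOp 𝕂 d) : D * lieDensity w X ∈ DiffOp 𝕂 d := by
  rw [lieDensity, mul_add, Finset.mul_sum]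
  refine add_mem (sum_mem fun i _ => ?_) (mul_mulOp_mem _ hD)
  rw [← mul_assoc]
  exact mul_pd_mem i (mul_mulOp_mem _ hD)

/-- The Lie derivative on `𝒟_{λ,μ}`: `D ↦ L^μ_X ∘ D - D ∘ L^λ_X`. -/
def lieOp (lam mu : 𝕂) (X : PolyField 𝕂 d) : Module.End 𝕂 (DiffOp 𝕂 d) :=
  (LinearMap.mulLeft 𝕂 (lieDensity mu X) - LinearMap.mulRight 𝕂 (lieDensity lam X)).restrict
    fun _ hD => sub_mem (lieDensity_mul_mem mu X hD) (mul_lieDensity_mem lam X hD)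

/-- The module structure of `𝒟_{λ,μ}` transported to `𝒮` by the total symbol map. -/
def lieOpSymb (lam mu : 𝕂) (X : PolyField 𝕂 d) : Module.End 𝕂 (Symb 𝕂 d) :=
  totalSymbol.conj (lieOp lam mu X)

/-- The Lie derivative of symbols with values in `δ`-densities:
`L_X P = ∑ Xⁱ ∂ᵢ P - ∑ (∂ⱼ Xⁱ) ξᵢ ∂P/∂ξⱼ + δ (∑ ∂ᵢ Xⁱ) P`. -/
def lieSymb (del : 𝕂) (X : PolyField 𝕂 d) : Module.End 𝕂 (Symb 𝕂 d) where
  toFun P := ∑ i, MvPolynomial.C (component X i) * coeffDeriv i P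
    - ∑ i, ∑ j, MvPolynomial.C (pd j (component X i)) * MvPolynomial.X i * MvPolynomial.pderiv j P
    + MvPolynomial.C (del • divergence X) * P
  map_add' P Q := by
    simp only [map_add, mul_add, Finset.sum_add_distrib]
    abel
  map_smul' c P := by
    have h : ∀ j, MvPolynomial.pderiv j (c • P) = c • MvPolynomial.pderiv j P := fun j => by
      rw [← algebraMap_smul (Smooth 𝕂 d) c P, Derivation.map_smul, algebraMap_smul]
    simp only [map_smul, h, mul_smul_comm, ← Finset.smul_sum, ← smul_sub, ← smul_add,
      RingHom.id_apply]

/-- The cocycle `γ(X)`, the difference of the two actions of `X` on `𝒮`. -/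
def cocycle (lam mu : 𝕂) (X : PolyField 𝕂 d) : Module.End 𝕂 (Symb 𝕂 d) :=
  lieOpSymb lam mu X - lieSymb (mu - lam) X

/-! ### IFFT algebras of polynomial vector fields -/

/-- Vector fields all of whose components are homogeneous polynomials of degree `n`: the constant
(`n = 0`), linear (`n = 1`), quadratic (`n = 2`), … vector fields. -/
def homogeneousFields (𝕂 : Type*) [RCLike 𝕂] (d n : ℕ) : Submodule 𝕂 (PolyField 𝕂 d) where
  carrier := {X | ∀ i, (X (MvPolynomial.X i)).IsHomogeneous n}
  add_mem' hX hY i := (hX i).add (hY i)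
  zero_mem' _ := MvPolynomial.isHomogeneous_zero _ _ _
  smul_mem' c X hX i := by
    rw [Derivation.smul_apply, MvPolynomial.smul_eq_C_mul]
    simpa using (MvPolynomial.isHomogeneous_C (Fin d) c).mul (hX i)

lemma apply_isHomogeneous {X : PolyField 𝕂 d} (hX : X ∈ homogeneousFields 𝕂 d 1)
    {p : MvPolynomial (Fin d) 𝕂} (hp : p.IsHomogeneous 1) : (X p).IsHomogeneous 1 := by
  have dsum : ∀ (D : Fin d → PolyField 𝕂 d) (q : MvPolynomial (Fin d) 𝕂),
      (∑ i, D i) q = ∑ i, D i q := fun D q => by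
    change Derivation.coeFnAddMonoidHom (∑ i, D i) q = _
    rw [map_sum, Finset.sum_apply]
    rfl
  have h : X p = ∑ i, MvPolynomial.pderiv i p * X (MvPolynomial.X i) := by
    have : X = ∑ i, X (MvPolynomial.X i) • MvPolynomial.pderiv i := by
      refine MvPolynomial.derivation_ext fun j => ?_
      simp [dsum, MvPolynomial.pderiv_X, Pi.single_apply]
    conv_lhs => rw [this]
    simp [dsum, mul_comm]
  rw [h]
  refine MvPolynomial.IsHomogeneous.sum _ _ _ fun i _ => ?_
  simpa using (hp.pderiv (i := i)).mul (hX i)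

/-- The subalgebra `𝔤₀` of the linear vector fields of `𝔤`. -/
def linearPart (g : LieSubalgebra 𝕂 (PolyField 𝕂 d)) : LieSubalgebra 𝕂 (PolyField 𝕂 d) where
  toSubmodule := g.toSubmodule ⊓ homogeneousFields 𝕂 d 1
  lie_mem' := by
    intro X Y hX hY
    refine ⟨g.lie_mem hX.1 hY.1, fun i => ?_⟩
    rw [Derivation.commutator_apply]
    exact (apply_isHomogeneous hX.2 (hY.2 i)).sub (apply_isHomogeneous hY.2 (hX.2 i))

/-- The semisimple part `𝔥₀ = [𝔤₀, 𝔤₀]` of the reductive Lie algebra `𝔤₀`. -/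
abbrev semisimplePart (g : LieSubalgebra 𝕂 (PolyField 𝕂 d)) : LieIdeal 𝕂 (linearPart g) :=
  LieAlgebra.derivedSeries 𝕂 (linearPart g) 1

/-- `𝔤` is an irreducible, filtered, finite-dimensional, transitive Lie algebra in its standard
realisation by polynomial vector fields on `𝔤₋₁ = 𝕂 ^ d`. It is graded by the degree of the
coefficients, the component `𝔤_p` consisting of fields with coefficients of degree `p + 1`. -/
structure IsIFFT (g : LieSubalgebra 𝕂 (PolyField 𝕂 d)) [FiniteDimensional 𝕂 g] : Prop where
  graded : ∀ X ∈ g, X ∈ ⨆ n, g.toSubmodule ⊓ homogeneousFields 𝕂 d n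
  transitive : homogeneousFields 𝕂 d 0 ≤ g.toSubmodule
  irreducible : ∀ W ≤ homogeneousFields 𝕂 d 0,
    (∀ X ∈ linearPart g, ∀ Y ∈ W, ⁅X, Y⁆ ∈ W) → W = ⊥ ∨ W = homogeneousFields 𝕂 d 0
  quadratic_ne_bot : g.toSubmodule ⊓ homogeneousFields 𝕂 d 2 ≠ ⊥

/-- The complexification of `𝔥₀` (which is `𝔥₀` itself if `𝕂 = ℂ`) is a simple Lie algebra.
For `𝕂 = ℝ` or `ℂ` the algebraic closure of `𝕂` is the field of complex numbers. -/
def ComplexifiedIsSimple (g : LieSubalgebra 𝕂 (PolyField 𝕂 d)) : Prop :=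
  LieAlgebra.IsSimple (AlgebraicClosure 𝕂) (AlgebraicClosure 𝕂 ⊗[𝕂] semisimplePart g)

/-! ### Casimir operators -/

/-- The dual basis of `b` with respect to the Killing form `β`, namely
`b*ⱼ = ∑ᵢ (G⁻¹)ᵢⱼ bᵢ` where `G` is the Gram matrix of `β`. -/
def killingDual {L ι : Type*} [LieRing L] [LieAlgebra 𝕂 L] [Fintype ι] [DecidableEq ι]
    (b : Module.Basis ι 𝕂 L) (j : ι) : L :=
  ∑ i, (Matrix.of fun k l => killingForm 𝕂 L (b k) (b l))⁻¹ i j • b i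

/-- The Casimir operator `∑ᵢ ρ(eᵢ) ρ(eᵢ*)` of `𝔤` with respect to its Killing form, for an action
`ρ` of the vector fields on `M`. -/
def casimir {M : Type*} [AddCommGroup M] [Module 𝕂 M] (g : LieSubalgebra 𝕂 (PolyField 𝕂 d))
    (ρ : PolyField 𝕂 d → Module.End 𝕂 M) [FiniteDimensional 𝕂 g] : Module.End 𝕂 M :=
  ∑ i, ρ (Module.finBasis 𝕂 g i : g) * ρ (killingDual (Module.finBasis 𝕂 g) i : g)

/-! ### Tensors, tree-like subspaces and critical parameters -/

/-- The representation of linear vector fields on the symmetric tensors `⋁ 𝔤₋₁`, identified with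
the polynomials in `ξ`: the opposite of the Jacobian matrix acts as a derivation,
`T ↦ - ∑ (∂ⱼ Xⁱ) ξᵢ ∂T/∂ξⱼ`. -/
def tensorAction (X : PolyField 𝕂 d) (T : MvPolynomial (Fin d) 𝕂) : MvPolynomial (Fin d) 𝕂 :=
  -∑ i, ∑ j, MvPolynomial.C (MvPolynomial.coeff (Finsupp.single j 1) (X (MvPolynomial.X i)))
    * MvPolynomial.X i * MvPolynomial.pderiv j T

/-- `F` is stable under the action of `𝔥₀`. -/
def IsStable (g : LieSubalgebra 𝕂 (PolyField 𝕂 d))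
    (F : Submodule 𝕂 (MvPolynomial (Fin d) 𝕂)) : Prop :=
  ∀ X : semisimplePart g, ∀ T ∈ F, tensorAction ((X : linearPart g) : PolyField 𝕂 d) T ∈ F

/-- A decomposition `⋁^k 𝔤₋₁ = ⨁ₚ I_{k,p}` into irreducible `𝔥₀`-submodules, for every `k`. -/
structure TensorDecomposition (g : LieSubalgebra 𝕂 (PolyField 𝕂 d)) where
  num : ℕ → ℕ
  I : ∀ k, Fin (num k) → Submodule 𝕂 (MvPolynomial (Fin d) 𝕂)
  stable : ∀ k p, IsStable g (I k p)
  ne_bot : ∀ k p, I k p ≠ ⊥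
  irreducible : ∀ k p, ∀ F ≤ I k p, IsStable g F → F = ⊥ ∨ F = I k p
  independent : ∀ k, iSupIndep (I k)
  iSup_eq : ∀ k, ⨆ p, I k p = MvPolynomial.homogeneousSubmodule (Fin d) 𝕂 k

/-- Evaluation of a smooth function at a point. -/
def evalAt (x : Fin d → 𝕂) : Smooth 𝕂 d →+* 𝕂 :=
  (Pi.evalRingHom (fun _ : Fin d → 𝕂 => 𝕂) x).comp (smoothSubalgebra 𝕂 d).val.toRingHom

/-- The sections of `F`: the symbols whose value at each point of `𝕂 ^ d` belongs to `F`. -/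
def sections (F : Submodule 𝕂 (MvPolynomial (Fin d) 𝕂)) : Submodule 𝕂 (Symb 𝕂 d) where
  carrier := {P | ∀ x, MvPolynomial.map (evalAt x) P ∈ F}
  add_mem' hP hQ x := by
    rw [map_add]
    exact F.add_mem (hP x) (hQ x)
  zero_mem' x := by simp
  smul_mem' c P hP x := by
    have h : MvPolynomial.map (evalAt x) (c • P) = c • MvPolynomial.map (evalAt x) P := by
      ext m
      simp only [MvPolynomial.coeff_map, MvPolynomial.coeff_smul]
      rfl
    rw [h]
    exact F.smul_mem c (hP x)

/-- The spaces `𝒯^l(E)`: `𝒯^0(E) = E` and `𝒯^(l+1)(E) = γ(𝔤₁)(𝒯^l(E))`. -/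
def tree (g : LieSubalgebra 𝕂 (PolyField 𝕂 d)) (lam mu : 𝕂) (E : Submodule 𝕂 (Symb 𝕂 d)) :
    ℕ → Submodule 𝕂 (Symb 𝕂 d)
  | 0 => E
  | l + 1 => ⨆ X ∈ g.toSubmodule ⊓ homogeneousFields 𝕂 d 2,
      (tree g lam mu E l).map (cocycle lam mu X)

/-- `(λ, μ)` is critical: for some `k`, `p`, the eigenvalue `α_{k,p}` of the Casimir operator of
the symbols on `E_{k,p} = Γ(I_{k,p})` is an eigenvalue of its restriction to
`⨁_{l > 0} 𝒯^l(E_{k,p})`. -/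
def IsCritical (g : LieSubalgebra 𝕂 (PolyField 𝕂 d)) [FiniteDimensional 𝕂 g]
    (𝓘 : TensorDecomposition g) (lam mu : 𝕂) : Prop :=
  ∃ (k : ℕ) (p : Fin (𝓘.num k)) (α : 𝕂),
    (∀ P ∈ sections (𝓘.I k p), casimir g (lieSymb (mu - lam)) P = α • P) ∧
    ∃ R ∈ ⨆ l, tree g lam mu (sections (𝓘.I k p)) (l + 1),
      R ≠ 0 ∧ casimir g (lieSymb (mu - lam)) R = α • R

/-! ### Equivariant quantizations -/

/-- `Q : 𝒮 → 𝒟_{λ,μ}` is a `𝔤`-equivariant quantization: it intertwines the actions of `𝔤`, and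
its inverse maps `D ∈ 𝒟^k` to its principal symbol modulo `⨁_{l < k} 𝒮^l`. -/
structure IsEquivariantQuantization (g : LieSubalgebra 𝕂 (PolyField 𝕂 d)) (lam mu : 𝕂)
    (Q : Symb 𝕂 d ≃ₗ[𝕂] DiffOp 𝕂 d) : Prop where
  equivariant : ∀ X ∈ g, ∀ P, Q (lieSymb (mu - lam) X P) = lieOp lam mu X (Q P)
  principal : ∀ k D, HasOrderLE k D → Q.symm D - principalSymbol k D ∈
    ⨆ l : Fin k, MvPolynomial.homogeneousSubmodule (Fin d) (Smooth 𝕂 d) l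

end IFFTQuant

end

/-! Two Casimir operators act on the symbols: `C`, built from the Lie derivative `L^t`, and `𝒞`,
built from the action `𝓛 = L^t + γ` transported from the differential operators. Each commutes with
its own action. On `E = E_{k,p}` the operator `C` is a scalar `α`. An equivariant map whose value at
`P ∈ E` starts with `P` must therefore send `P` to an `α`-eigenvector of `𝒞`.

Such an eigenvector is found by a triangular argument. The difference `𝒞 - C` maps `𝒯^l(E)` into
`𝒯^(l+1)(E)` (`casimir_sub_mem_treeAt`), and `𝒯^l(E)` vanishes for `l > k` since `γ` lowers the
degree (`tree_isHomogeneous`). Non-criticality says that `C - α` is injective on the trees with `l >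
0`. As `C` satisfies a polynomial equation on each `𝒮^n` (`exists_aeval_casimir`), it is also
surjective there, although these spaces have infinite dimension (`exists_sub_smul_eq`). Hence each
`P ∈ E` is the leading term of exactly one eigenvector of `𝒞` in `P + ⨁_{l>0} 𝒯^l(E)`. Uniqueness
makes the assignment linear and equivariant, because `𝓛_X` of the eigenvector of `P` is an
eigenvector with leading term `L^t_X P` (`exists_quantization_sections`). Gluing over all `k, p`
gives a unipotent, hence bijective, map.

The remaining work is to show that `C` is a scalar on `E` (`exists_casimir_sections`). First, `C` is
linear over the smooth functions (`casimir_C_mul`), so constant tensors suffice. Second, `𝔤` is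
semisimple and equals `𝔤₋₁ ⊕ 𝔤₀ ⊕ 𝔤₁`, it contains the Euler field `E`, and `𝔤₀ = 𝕂E + 𝔥₀`
(`mem_ssFields_sup`). In an adapted basis `C` is then a number depending on `k` plus the Casimir
operator of `𝔥₀`. Third, the latter is a scalar of `𝕂` on an irreducible module. If `𝕂 = ℝ` such a
module may split after complexification, so Schur's lemma alone does not suffice; a trace
computation shows that the eigenvalues are rational, because Dynkin indices are
(`exists_hasEigenvalue_casimir`). -/

noncomputable section

/-! ### Rationality of trace forms and of Casimir eigenvalues -/

namespace LieAlgebra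

open LieModule Module

section AlgClosed

variable {A L : Type*} [Field A] [IsAlgClosed A] [LieRing L] [LieAlgebra A L]
  [FiniteDimensional A L]

/-- An endomorphism of the adjoint representation of a simple Lie algebra over an algebraically
closed field is a scalar. -/
lemma exists_eq_smul_of_commute_ad [IsSimple A L] (T : Module.End A L)
    (hT : ∀ x y : L, T ⁅x, y⁆ = ⁅x, T y⁆) : ∃ z : A, ∀ x, T x = z • x := by
  have : Nontrivial L := by
    by_contra h
    rw [not_nontrivial_iff_subsingleton] at h
    exact IsSimple.non_abelian A (L := L) ⟨fun x y => Subsingleton.elim _ _⟩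
  obtain ⟨z, hz⟩ := Module.End.exists_eigenvalue T
  let I : LieIdeal A L :=
    { Module.End.eigenspace T z with
      lie_mem := by
        intro x m hm
        have hm' : T m = z • m := Module.End.mem_eigenspace_iff.1 hm
        exact Module.End.mem_eigenspace_iff.2 (by rw [hT, hm', lie_smul]) }
  have hI : I = ⊤ := by
    refine (IsSimple.eq_bot_or_eq_top I).resolve_left fun h => hz ?_
    have := congrArg LieSubmodule.toSubmodule h
    simpa [I] using this
  refine ⟨z, fun x => ?_⟩
  have : x ∈ I := hI ▸ LieSubmodule.mem_top x
  exact Module.End.mem_eigenspace_iff.1 this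

variable [CharZero A]

/-- The weights of a module are rational on the coroots. -/
lemma exists_rat_weight_coroot [IsKilling A L] {H : LieSubalgebra A L} [H.IsCartanSubalgebra]
    {α : Weight A H L} (hα : α.IsNonZero) (M : Type*) [AddCommGroup M] [Module A M]
    [LieRingModule L M] [LieModule A L M] [FiniteDimensional A M] (χ : Weight A H M) :
    ∃ q : ℚ, χ (IsKilling.coroot α) = q := by
  -- The `α`-string through `χ` gives integers with `aα + bχ = 0` on the coroot space and `b > 0`;
  -- since `α` takes the value 2 on its coroot, `χ` takes the value `-2a/b`.
  obtain ⟨a, b, hb, h⟩ := exists_forall_mem_corootSpace_smul_add_eq_zero M (α : H → A) χ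
    (fun h => hα h) χ.genWeightSpace_ne_bot
  have h1 := h _ (IsKilling.coroot_mem_corootSpace α)
  rw [Pi.add_apply, Pi.smul_apply, Pi.smul_apply, IsKilling.root_apply_coroot hα] at h1
  refine ⟨-(2 * a) / b, ?_⟩
  have hb' : (b : A) ≠ 0 := by exact_mod_cast hb.ne'
  push_cast
  rw [eq_div_iff hb']
  simp only [zsmul_eq_mul] at h1
  linear_combination h1

/-- The coroot contributes `dim · χ(coroot)²` on each weight space, and each `χ(coroot)` is
rational. -/
lemma exists_rat_traceForm_coroot [IsKilling A L] {H : LieSubalgebra A L} [H.IsCartanSubalgebra]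
    {α : Weight A H L} (hα : α.IsNonZero) (M : Type*) [AddCommGroup M] [Module A M]
    [LieRingModule L M] [LieModule A L M] [FiniteDimensional A M] :
    ∃ q : ℚ, traceForm A L M (IsKilling.coroot α : H) (IsKilling.coroot α : H) = q := by
  choose q hq using exists_rat_weight_coroot hα M
  have h : traceForm A L M (IsKilling.coroot α : H) (IsKilling.coroot α : H)
      = traceForm A H M (IsKilling.coroot α : H) (IsKilling.coroot α : H) := rfl
  rw [h, traceForm_eq_sum_finrank_nsmul_mul]
  refine ⟨∑ χ : Weight A H M, finrank A (genWeightSpace M χ) • (q χ * q χ), ?_⟩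
  push_cast
  exact Finset.sum_congr rfl fun χ _ => by simp [hq]

/-- The value is a sum of squares of rationals, so positivity makes sense although the field is not
ordered; the root `α` itself contributes a positive multiple of `2²`. -/
lemma killingForm_coroot_ne_zero [IsKilling A L] {H : LieSubalgebra A L} [H.IsCartanSubalgebra]
    {α : Weight A H L} (hα : α.IsNonZero) :
    killingForm A L (IsKilling.coroot α : H) (IsKilling.coroot α : H) ≠ 0 := by
  choose q hq using exists_rat_weight_coroot hα L
  have h : killingForm A L (IsKilling.coroot α : H) (IsKilling.coroot α : H)
      = traceForm A H L (IsKilling.coroot α : H) (IsKilling.coroot α : H) := rfl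
  rw [h, traceForm_eq_sum_finrank_nsmul_mul]
  have h2 : (∑ χ : Weight A H L, finrank A (genWeightSpace L χ) •
      (χ (IsKilling.coroot α) * χ (IsKilling.coroot α)))
      = ((∑ χ : Weight A H L, finrank A (genWeightSpace L χ) • (q χ * q χ) : ℚ) : A) := by
    push_cast
    exact Finset.sum_congr rfl fun χ _ => by simp [hq]
  rw [h2]
  have h3 : 0 < ∑ χ : Weight A H L, finrank A (genWeightSpace L χ) • (q χ * q χ) := by
    refine Finset.sum_pos' (fun χ _ => nsmul_nonneg (mul_self_nonneg _) _)
      ⟨α, Finset.mem_univ _, ?_⟩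
    have h4 : q α = 2 := by
      have := hq α
      rw [IsKilling.root_apply_coroot hα] at this
      exact_mod_cast this.symm
    have h5 : 0 < finrank A (genWeightSpace L α) := by
      have : Nontrivial (genWeightSpace L α) :=
        (LieSubmodule.nontrivial_iff_ne_bot A H L).2 α.genWeightSpace_ne_bot
      exact finrank_pos
    rw [h4]
    exact nsmul_pos (by norm_num) h5.ne'
  exact_mod_cast h3.ne'

/-- The roots span the dual of `H`, which is nonzero because `L` is. -/
lemma exists_weight_isNonZero [IsKilling A L] [Nontrivial L] (H : LieSubalgebra A L)
    [H.IsCartanSubalgebra] : ∃ α : Weight A H L, α.IsNonZero := by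
  by_contra! h
  have h1 := IsKilling.span_weight_eq_top (K := A) (L := L) (H := H)
  have h2 : Submodule.span A (Set.range (Weight.toLinear A H L)) = ⊥ := by
    rw [Submodule.span_eq_bot]
    rintro _ ⟨α, rfl⟩
    exact (Weight.coe_toLinear_eq_zero_iff).2 (h α)
  rw [h2] at h1
  have : Subsingleton (Module.Dual A H) := by
    rw [← Submodule.subsingleton_iff A]
    exact subsingleton_of_bot_eq_top h1
  exact not_nontrivial _ (inferInstance : Nontrivial (Module.Dual A H))

/-- The Dynkin index of a module is rational. -/
lemma exists_rat_traceForm_eq [IsSimple A L] (M : Type*) [AddCommGroup M] [Module A M]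
    [LieRingModule L M] [LieModule A L M] [FiniteDimensional A M] :
    ∃ s : ℚ, ∀ x y, traceForm A L M x y = s * killingForm A L x y := by
  have : Nontrivial L := by
    by_contra h
    rw [not_nontrivial_iff_subsingleton] at h
    exact IsSimple.non_abelian A (L := L) ⟨fun x y => Subsingleton.elim _ _⟩
  have hK : LinearMap.BilinForm.Nondegenerate (killingForm A L) := IsKilling.killingForm_nondegenerate A L
  let e := LinearMap.BilinForm.toDual (killingForm A L) hK
  -- The operator that represents the trace form through the Killing form. Invariance of both forms
  -- makes it commute with `ad`, so Schur's lemma turns it into a scalar `z`.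
  let T : Module.End A L := e.symm.toLinearMap ∘ₗ traceForm A L M
  have hT : ∀ x y, killingForm A L (T x) y = traceForm A L M x y := fun x y => by
    change LinearMap.BilinForm.toDual (killingForm A L) hK (e.symm (traceForm A L M x)) y = _
    rw [LinearEquiv.apply_symm_apply]
  have hT' : ∀ x y : L, T ⁅x, y⁆ = ⁅x, T y⁆ := by
    intro x y
    apply e.injective
    ext w
    change killingForm A L (T ⁅x, y⁆) w = killingForm A L ⁅x, T y⁆ w
    rw [hT, traceForm_apply_lie_apply', traceForm_apply_lie_apply', hT]
  obtain ⟨z, hz⟩ := exists_eq_smul_of_commute_ad T hT'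
  have hz' : ∀ x y, traceForm A L M x y = z * killingForm A L x y := fun x y => by
    rw [← hT, hz, map_smul, LinearMap.smul_apply, smul_eq_mul]
  obtain ⟨x, hx⟩ := LieAlgebra.exists_isCartanSubalgebra_engel A L
  let H := LieSubalgebra.engel A x
  obtain ⟨α, hα⟩ := exists_weight_isNonZero H
  -- Evaluated on one coroot, `z` becomes a quotient of two rationals.
  obtain ⟨q, hq⟩ := exists_rat_traceForm_coroot hα M
  obtain ⟨r, hr⟩ := exists_rat_traceForm_coroot hα L
  have h0 := killingForm_coroot_ne_zero hα
  have hr' : killingForm A L (IsKilling.coroot α : H) (IsKilling.coroot α : H) = r := hr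
  rw [hr'] at h0
  rw [hz', hr'] at hq
  have : z = ((q / r : ℚ) : A) := by
    push_cast
    rw [eq_div_iff h0, hq]
  exact ⟨q / r, fun x y => by rw [hz', this]⟩

end AlgClosed

/-- If `A ⊗ L` is a simple Lie algebra over an algebraically closed extension `A` of `K`, a Casimir operator of
`L` defined by a trace form has an eigenvalue in `K` on every module. -/
lemma exists_hasEigenvalue_casimir {K L G M ι : Type*} (A : Type*) [Field K] [CharZero K] [Field A]
    [IsAlgClosed A] [Algebra K A] [LieRing L]
    [LieAlgebra K L] [FiniteDimensional K L]
    [IsSimple A (A ⊗[K] L)]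
    [AddCommGroup G] [Module K G] [LieRingModule L G] [LieModule K L G] [FiniteDimensional K G]
    [AddCommGroup M] [Module K M] [LieRingModule L M] [LieModule K L M] [FiniteDimensional K M]
    [Nontrivial M] [Fintype ι] [Nonempty ι] (b b' : ι → L)
    (hb : ∀ i, traceForm K L G (b i) (b' i) = 1)
    (hc : ∀ x : L, Commute (toEnd K L M x) (∑ i, toEnd K L M (b i) * toEnd K L M (b' i))) :
    ∃ z, Module.End.HasEigenvalue (∑ i, toEnd K L M (b i) * toEnd K L M (b' i)) z := by
  have : CharZero A := charZero_of_injective_algebraMap (algebraMap K A).injective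
  set c := ∑ i, toEnd K L M (b i) * toEnd K L M (b' i) with hcdef
  let cA : Module.End A (A ⊗[K] M) := c.baseChange A
  have hcA : ∀ m, cA m = ∑ i, ⁅(1 : A) ⊗ₜ[K] b i, ⁅(1 : A) ⊗ₜ[K] b' i, m⁆⁆ := by
    intro m
    induction m using TensorProduct.induction_on with
    | zero => simp
    | tmul a m =>
      simp only [ExtendScalars.bracket_tmul, one_mul, cA, LinearMap.baseChange_tmul, hcdef,
        LinearMap.sum_apply, Module.End.mul_apply, toEnd_apply_apply, TensorProduct.tmul_sum]
    | add m n hm hn => simp only [map_add, hm, hn, lie_add, Finset.sum_add_distrib]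
  have hcomm : ∀ (x : A ⊗[K] L) (m : A ⊗[K] M),
      cA (toEnd A (A ⊗[K] L) (A ⊗[K] M) x m) = toEnd A (A ⊗[K] L) (A ⊗[K] M) x (cA m) := by
    intro x m
    induction x using TensorProduct.induction_on with
    | zero => simp only [map_zero, LinearMap.zero_apply]
    | add x y hx hy => simp only [map_add, LinearMap.add_apply, hx, hy]
    | tmul a x =>
      induction m using TensorProduct.induction_on with
      | zero => simp only [map_zero]
      | add m n hm hn => simp only [map_add, hm, hn]
      | tmul a' m =>
        have h := LinearMap.congr_fun (hc x).eq m
        change (a * a') ⊗ₜ[K] c ⁅x, m⁆ = (a * a') ⊗ₜ[K] ⁅x, c m⁆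
        exact congrArg _ h.symm
  have : Nontrivial (A ⊗[K] M) := by
    rw [← Module.finrank_pos_iff_of_free A, Module.finrank_baseChange]
    exact finrank_pos
  obtain ⟨z, hz⟩ := Module.End.exists_eigenvalue cA
  -- The eigenspace is a submodule, and the trace of the Casimir operator on it will determine `z`.
  let N : LieSubmodule A (A ⊗[K] L) (A ⊗[K] M) :=
    { Module.End.eigenspace cA z with
      lie_mem := by
        intro x m hm
        have hm' : cA m = z • m := Module.End.mem_eigenspace_iff.1 hm
        exact Module.End.mem_eigenspace_iff.2 ((hcomm x m).trans (by rw [hm', map_smul]; rfl)) }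
  have hN : ∀ n : N, cA n = z • (n : A ⊗[K] M) := fun n => Module.End.mem_eigenspace_iff.1 n.2
  have hNnt : Nontrivial N := by
    rw [LieSubmodule.nontrivial_iff_ne_bot]
    intro h
    refine hz ?_
    simpa [N] using congrArg LieSubmodule.toSubmodule h
  obtain ⟨s, hs⟩ := exists_rat_traceForm_eq (A := A) (L := A ⊗[K] L) N
  obtain ⟨t, ht⟩ := exists_rat_traceForm_eq (A := A) (L := A ⊗[K] L) (A ⊗[K] G)
  -- The normalisation of the dual families is with respect to the trace form of `G`; the index `t`
  -- converts it to the Killing form of `A ⊗ L`.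
  have ht1 : ∀ i, (t : A) * killingForm A (A ⊗[K] L) (1 ⊗ₜ b i) (1 ⊗ₜ b' i) = 1 := fun i => by
    rw [← ht, traceForm_baseChange]
    simp [LinearMap.BilinForm.baseChange_tmul, hb]
  have ht0 : (t : A) ≠ 0 := fun h => by
    have := ht1 (Classical.arbitrary ι)
    rw [h, zero_mul] at this
    exact zero_ne_one this
  -- The trace of the Casimir operator on `N`, where it is multiplication by `z`.
  have h1 : ∑ i, traceForm A (A ⊗[K] L) N (1 ⊗ₜ b i) (1 ⊗ₜ b' i) = z * finrank A N := by
    have h2 : ∑ i, (toEnd A (A ⊗[K] L) N (1 ⊗ₜ b i) ∘ₗ toEnd A (A ⊗[K] L) N (1 ⊗ₜ b' i))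
        = z • LinearMap.id := by
      ext1 n
      apply Subtype.ext
      have := hN n
      rw [hcA] at this
      simpa [LinearMap.sum_apply] using this
    simp only [traceForm_apply_apply]
    rw [← map_sum, h2, map_smul, LinearMap.trace_id, smul_eq_mul]
  have hk : ∀ i, killingForm A (A ⊗[K] L) (1 ⊗ₜ b i) (1 ⊗ₜ b' i) = (t : A)⁻¹ := fun i =>
    eq_inv_of_mul_eq_one_right (ht1 i)
  have hdim : (finrank A N : A) ≠ 0 := by exact_mod_cast (finrank_pos (R := A) (M := N)).ne'
  have hzq : z = algebraMap K A (Fintype.card ι * (s * (t : K)⁻¹) / finrank A N) := by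
    simp only [hs, hk, Finset.sum_const, Finset.card_univ, nsmul_eq_mul] at h1
    simp only [map_div₀, map_mul, map_natCast, map_inv₀, map_ratCast]
    rw [eq_div_iff hdim, h1]
  -- The value found for `z` lies in `K`. If `c - z` were injective over `K`, flatness would keep it
  -- injective after extension of scalars, where `z` is an eigenvalue.
  refine ⟨Fintype.card ι * (s * (t : K)⁻¹) / finrank A N, fun h => hz ?_⟩
  change Module.End.eigenspace _ _ = ⊥ at h
  change Module.End.eigenspace _ _ = ⊥
  rw [Module.End.eigenspace_def, LinearMap.ker_eq_bot] at h
  rw [Module.End.eigenspace_def, LinearMap.ker_eq_bot]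
  have h3 := Module.Flat.lTensor_preserves_injective_linearMap (M := A) _ h
  convert h3 using 1
  ext x
  induction x using TensorProduct.induction_on with
  | zero => simp
  | add x y hx hy => rw [map_add, map_add, hx, hy]
  | tmul a m =>
    rw [hzq]
    change a ⊗ₜ[K] c m - algebraMap K A _ • a ⊗ₜ[K] m = a ⊗ₜ[K] (c m - (_ : K) • m)
    rw [algebraMap_smul, TensorProduct.tmul_sub, TensorProduct.tmul_smul]
end LieAlgebra

end

noncomputable section

namespace IFFTQuant

open Module

/-! ### Dual families -/

/-- The families `b` and `b'` are dual to each other for the bilinear form `B`. -/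
structure IsDualPair {K L ι : Type*} [Field K] [AddCommGroup L] [Module K L] [Fintype ι]
    (B : LinearMap.BilinForm K L) (b b' : ι → L) : Prop where
  left : ∀ y, ∑ j, B y (b' j) • b j = y
  right : ∀ y, ∑ j, B (b j) y • b' j = y

namespace IsDualPair

variable {K L N ι κ : Type*} [Field K] [AddCommGroup L] [Module K L] [Fintype ι] [Fintype κ]
  [AddCommGroup N] [Module K N] {B : LinearMap.BilinForm K L} {b b' : ι → L}

lemma symm (h : IsDualPair B b b') (hB : ∀ x y, B x y = B y x) : IsDualPair B b' b :=
  ⟨fun y => by simpa only [hB y] using h.right y, fun y => by simpa only [hB _ y] using h.left y⟩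

lemma of_basis (b : Basis ι K L) (b' : ι → L)
    (hnd : ∀ x, (∀ y, B y x = 0) → x = 0) (h : ∀ i, B (b i) (b' i) = 1)
    (h' : ∀ i j, i ≠ j → B (b i) (b' j) = 0) : IsDualPair B b b' := by
  classical
  have hδ : ∀ i j, B (b i) (b' j) = if i = j then 1 else 0 := fun i j => by
    by_cases hij : i = j
    · subst hij; rw [h, if_pos rfl]
    · rw [h' i j hij, if_neg hij]
  refine ⟨fun y => ?_, fun y => ?_⟩
  · conv_rhs => rw [← b.sum_repr y]
    refine Finset.sum_congr rfl fun j _ => congrArg (· • b j) ?_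
    conv_lhs => rw [← b.sum_repr y]
    simp only [map_sum, map_smul, LinearMap.sum_apply, LinearMap.smul_apply, hδ, smul_eq_mul,
      mul_ite, mul_one, mul_zero, Finset.sum_ite_eq', Finset.mem_univ, if_true]
  · rw [← sub_eq_zero]
    refine hnd _ fun z => ?_
    have : LinearMap.flip B (∑ j, B (b j) y • b' j - y) = 0 := b.ext fun i => by
      simp only [map_sub, map_sum, map_smul, LinearMap.sub_apply, LinearMap.sum_apply,
        LinearMap.smul_apply, LinearMap.flip_apply, hδ, smul_eq_mul,
        mul_ite, mul_one, mul_zero, Finset.sum_ite_eq, Finset.mem_univ, if_true, sub_self,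
        LinearMap.zero_apply]
    exact LinearMap.congr_fun this z

/-- Both sums equal the double sum of `B (b i) (c' j) • Φ (c j) (b' i)`: the tensor `∑ bᵢ ⊗ b'ᵢ`
depends only on `B`. -/
lemma sum_eq (h : IsDualPair B b b') {c c' : κ → L} (hc : IsDualPair B c c')
    (Φ : L →ₗ[K] L →ₗ[K] N) : ∑ i, Φ (b i) (b' i) = ∑ j, Φ (c j) (c' j) := by
  have h1 : ∀ i, Φ (b i) (b' i) = ∑ j, B (b i) (c' j) • Φ (c j) (b' i) := fun i => by
    conv_lhs => rw [← hc.left (b i)]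
    simp only [map_sum, map_smul, LinearMap.sum_apply, LinearMap.smul_apply]
  have h2 : ∀ j, Φ (c j) (c' j) = ∑ i, B (b i) (c' j) • Φ (c j) (b' i) := fun j => by
    conv_lhs => rw [← h.right (c' j)]
    simp only [map_sum, map_smul]
  simp only [h1, h2]
  exact Finset.sum_comm

/-- The tensor `∑ bᵢ ⊗ b'ᵢ` is invariant under every skew operator. With `T = ad x` this is the
source of all commutation properties of Casimir operators below. -/
lemma sum_skew (h : IsDualPair B b b') {T : L →ₗ[K] L} (hT : ∀ x y, B (T x) y = -B x (T y))
    (Φ : L →ₗ[K] L →ₗ[K] N) : ∑ i, Φ (T (b i)) (b' i) + ∑ i, Φ (b i) (T (b' i)) = 0 := by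
  have h1 : ∀ i, Φ (T (b i)) (b' i) = ∑ j, B (T (b i)) (b' j) • Φ (b j) (b' i) := fun i => by
    conv_lhs => rw [← h.left (T (b i))]
    simp only [map_sum, map_smul, LinearMap.sum_apply, LinearMap.smul_apply]
  have h2 : ∀ j, Φ (b j) (T (b' j)) = ∑ i, -(B (T (b i)) (b' j) • Φ (b j) (b' i)) := fun j => by
    conv_lhs => rw [← h.right (T (b' j))]
    simp only [map_sum, map_smul, hT, neg_smul, neg_neg]
  simp only [h1, h2, Finset.sum_neg_distrib]
  rw [Finset.sum_comm, add_neg_cancel]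

end IsDualPair

/-- Nondegeneracy makes the Gram matrix invertible, so that `⁻¹` in `killingDual` is a true inverse
and not the default value. -/
lemma isDualPair_killingDual {K L ι : Type*} [RCLike K] [LieRing L] [LieAlgebra K L]
    [FiniteDimensional K L] [LieAlgebra.IsKilling K L] [Fintype ι] [DecidableEq ι]
    (b : Basis ι K L) : IsDualPair (killingForm K L) b (killingDual b) := by
  have hnd := LieAlgebra.IsKilling.killingForm_nondegenerate K L
  have hu : IsUnit (Matrix.of fun k l => killingForm K L (b k) (b l)).det := by
    rw [isUnit_iff_ne_zero]
    convert (LinearMap.BilinForm.nondegenerate_iff_det_ne_zero b).1 hnd using 2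
    ext k l
    simp [LinearMap.BilinForm.toMatrix_apply]
  have hδ : ∀ i j, killingForm K L (b i) (killingDual b j) = (1 : Matrix ι ι K) i j := fun i j => by
    rw [← Matrix.mul_nonsing_inv _ hu, Matrix.mul_apply, killingDual, map_sum]
    exact Finset.sum_congr rfl fun k _ => by
      rw [map_smul, smul_eq_mul, mul_comm, Matrix.of_apply]
  refine .of_basis b _ (fun x hx => ?_) (fun i => ?_)
    (fun i j hij => ?_)
  · exact hnd.2 x hx
  · rw [hδ, Matrix.one_apply_eq]
  · rw [hδ, Matrix.one_apply_ne hij]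

end IFFTQuant

end

noncomputable section

namespace IFFTQuant

variable {𝕂 : Type*} [RCLike 𝕂] {d : ℕ}

open MvPolynomial (pderiv)

/-! ### Polynomial vector fields -/

namespace PolyField

lemma ext {X Y : PolyField 𝕂 d} (h : ∀ i, X (.X i) = Y (.X i)) : X = Y :=
  MvPolynomial.derivation_ext h

lemma sum_apply {ι : Type*} (s : Finset ι) (D : ι → PolyField 𝕂 d) (q : MvPolynomial (Fin d) 𝕂) :
    (∑ i ∈ s, D i) q = ∑ i ∈ s, D i q := by
  change Derivation.coeFnAddMonoidHom (∑ i ∈ s, D i) q = _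
  rw [map_sum, Finset.sum_apply]
  rfl

lemma apply_eq (X : PolyField 𝕂 d) (p : MvPolynomial (Fin d) 𝕂) :
    X p = ∑ i, X (.X i) * pderiv i p := by
  have : X = ∑ i, X (.X i) • pderiv i := by
    refine ext fun j => ?_
    simp [sum_apply, MvPolynomial.pderiv_X, Pi.single_apply]
  conv_lhs => rw [this]
  simp [sum_apply]

lemma pderiv_lie_apply (i j : Fin d) (X : PolyField 𝕂 d) :
    ⁅(pderiv i : PolyField 𝕂 d), X⁆ (.X j) = pderiv i (X (.X j)) := by
  rw [Derivation.commutator_apply, MvPolynomial.pderiv_X, Pi.single_apply]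
  split_ifs <;> simp

lemma lie_add (X Y Z : PolyField 𝕂 d) : ⁅X, Y + Z⁆ = ⁅X, Y⁆ + ⁅X, Z⁆ := _root_.lie_add X Y Z

lemma add_lie (X Y Z : PolyField 𝕂 d) : ⁅X + Y, Z⁆ = ⁅X, Z⁆ + ⁅Y, Z⁆ := _root_.add_lie X Y Z

lemma lie_sub (X Y Z : PolyField 𝕂 d) : ⁅X, Y - Z⁆ = ⁅X, Y⁆ - ⁅X, Z⁆ := _root_.lie_sub X Y Z

lemma lie_smul (c : 𝕂) (X Y : PolyField 𝕂 d) : ⁅X, c • Y⁆ = c • ⁅X, Y⁆ := _root_.lie_smul c X Y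

lemma smul_lie (c : 𝕂) (X Y : PolyField 𝕂 d) : ⁅c • X, Y⁆ = c • ⁅X, Y⁆ := _root_.smul_lie c X Y

lemma lie_sum {ι : Type*} (s : Finset ι) (X : PolyField 𝕂 d) (Y : ι → PolyField 𝕂 d) :
    ⁅X, ∑ i ∈ s, Y i⁆ = ∑ i ∈ s, ⁅X, Y i⁆ := _root_.lie_sum s Y X

lemma lie_skew (X Y : PolyField 𝕂 d) : ⁅X, Y⁆ = -⁅Y, X⁆ := (_root_.lie_skew X Y).symm

lemma leibniz_lie (X Y Z : PolyField 𝕂 d) : ⁅X, ⁅Y, Z⁆⁆ = ⁅⁅X, Y⁆, Z⁆ + ⁅Y, ⁅X, Z⁆⁆ :=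
  ext fun i => by
    simp only [Derivation.commutator_apply, Derivation.add_apply, map_sub]
    ring

end PolyField

open PolyField

lemma pderiv_mem (i : Fin d) : (pderiv i : PolyField 𝕂 d) ∈ homogeneousFields 𝕂 d 0 := fun j => by
  rw [MvPolynomial.pderiv_X, Pi.single_apply]
  split_ifs
  · exact MvPolynomial.isHomogeneous_one _ _
  · exact MvPolynomial.isHomogeneous_zero _ _ _

lemma eq_C_of_pderiv_eq_zero {p : MvPolynomial (Fin d) 𝕂} (h : ∀ i, pderiv i p = 0) :
    p = MvPolynomial.C (p.coeff 0) := by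
  ext α
  rw [MvPolynomial.coeff_C]
  split_ifs with h0
  · rw [h0]
  · obtain ⟨i, hi⟩ : ∃ i, α i ≠ 0 := by
      by_contra! h1
      exact h0 (Finsupp.ext h1).symm
    have hα : α - Finsupp.single i 1 + Finsupp.single i 1 = α :=
      tsub_add_cancel_of_le (by simpa [Nat.one_le_iff_ne_zero] using hi)
    have h1 := congrArg (MvPolynomial.coeff (α - Finsupp.single i 1)) (h i)
    rw [MvPolynomial.coeff_pderiv, hα, MvPolynomial.coeff_zero] at h1
    exact (mul_eq_zero.1 h1).resolve_right (Nat.cast_add_one_ne_zero _)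

/-- A field that commutes with all translations has constant coefficients. Together with
`homogeneousFields_eq_zero` this is how transitivity is used throughout. -/
lemma mem_homogeneousFields_zero {X : PolyField 𝕂 d}
    (h : ∀ i, ⁅(pderiv i : PolyField 𝕂 d), X⁆ = 0) : X ∈ homogeneousFields 𝕂 d 0 := fun j => by
  rw [eq_C_of_pderiv_eq_zero (p := X (.X j)) fun i => by
    rw [← pderiv_lie_apply, h, Derivation.zero_apply]]
  exact MvPolynomial.isHomogeneous_C _ _

lemma homogeneousFields_eq_zero {m n : ℕ} (hmn : m ≠ n) {X : PolyField 𝕂 d}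
    (hm : X ∈ homogeneousFields 𝕂 d m) (hn : X ∈ homogeneousFields 𝕂 d n) : X = 0 :=
  PolyField.ext fun i => by
    by_contra h
    exact hmn ((hm i).inj_right (hn i) h)

lemma apply_isHomogeneous' {X : PolyField 𝕂 d} {m n k : ℕ} (hX : X ∈ homogeneousFields 𝕂 d n)
    {p : MvPolynomial (Fin d) 𝕂} (hp : p.IsHomogeneous m) (hk : m + n = k + 1) :
    (X p).IsHomogeneous k := by
  rw [apply_eq]
  refine MvPolynomial.IsHomogeneous.sum _ _ _ fun i _ => ?_
  -- Constants are separated because `m - 1` truncates at `m = 0`; their derivatives vanish anyway.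
  rcases Nat.eq_zero_or_pos m with rfl | hm
  · obtain ⟨c, rfl⟩ : ∃ c, p = MvPolynomial.C c :=
      ⟨_, MvPolynomial.totalDegree_eq_zero_iff_eq_C.1 (hp.totalDegree_le.antisymm (Nat.zero_le _))⟩
    rw [MvPolynomial.pderiv_C, mul_zero]
    exact MvPolynomial.isHomogeneous_zero _ _ _
  · have h := (hX i).mul (hp.pderiv (i := i))
    rwa [show n + (m - 1) = k by omega] at h

lemma apply_const {X : PolyField 𝕂 d} {p : MvPolynomial (Fin d) 𝕂} (hp : p.IsHomogeneous 0) :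
    X p = 0 := by
  rw [MvPolynomial.totalDegree_eq_zero_iff_eq_C.1 (hp.totalDegree_le.antisymm (Nat.zero_le _))]
  simp

lemma lie_mem_homogeneousFields {X Y : PolyField 𝕂 d} {m n k : ℕ}
    (hX : X ∈ homogeneousFields 𝕂 d m) (hY : Y ∈ homogeneousFields 𝕂 d n) (hk : m + n = k + 1) :
    ⁅X, Y⁆ ∈ homogeneousFields 𝕂 d k := fun i => by
  rw [Derivation.commutator_apply]
  exact (apply_isHomogeneous' hX (hY i) (by omega)).sub (apply_isHomogeneous' hY (hX i) (by omega))

lemma lie_eq_zero_of_const {X Y : PolyField 𝕂 d} (hX : X ∈ homogeneousFields 𝕂 d 0)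
    (hY : Y ∈ homogeneousFields 𝕂 d 0) : ⁅X, Y⁆ = 0 := PolyField.ext fun i => by
  rw [Derivation.commutator_apply, apply_const (hY i), apply_const (hX i)]
  simp

/-- The homogeneous component of degree `n` of a polynomial vector field. -/
def homPart (n : ℕ) : PolyField 𝕂 d →ₗ[𝕂] PolyField 𝕂 d where
  toFun X := MvPolynomial.mkDerivation 𝕂 fun i => MvPolynomial.homogeneousComponent n (X (.X i))
  map_add' X Y := PolyField.ext fun i => by simp
  map_smul' c X := PolyField.ext fun i => by simp

lemma homPart_apply (n : ℕ) (X : PolyField 𝕂 d) (i : Fin d) :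
    homPart n X (.X i) = MvPolynomial.homogeneousComponent n (X (.X i)) := by
  simp [homPart]

lemma homPart_mem (n : ℕ) (X : PolyField 𝕂 d) : homPart n X ∈ homogeneousFields 𝕂 d n :=
  fun i => by
    rw [homPart_apply]
    exact MvPolynomial.homogeneousComponent_isHomogeneous _ _

lemma homPart_of_mem {m n : ℕ} {X : PolyField 𝕂 d} (hX : X ∈ homogeneousFields 𝕂 d n) :
    homPart m X = if m = n then X else 0 := PolyField.ext fun i => by
  rw [homPart_apply, MvPolynomial.homogeneousComponent_of_mem (hX i)]
  split_ifs <;> rfl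

lemma exists_sum_homPart (X : PolyField 𝕂 d) : ∃ N, X = ∑ n ∈ Finset.range N, homPart n X := by
  refine ⟨(Finset.univ.sup fun i => (X (.X i)).totalDegree) + 1, PolyField.ext fun i => ?_⟩
  simp only [PolyField.sum_apply, homPart_apply]
  conv_lhs => rw [← MvPolynomial.sum_homogeneousComponent (X (.X i))]
  refine Finset.sum_subset (fun n hn => ?_) fun n _ hn => ?_
  · have h : (X (.X i)).totalDegree ≤ Finset.univ.sup fun i => (X (.X i)).totalDegree :=
      Finset.le_sup (f := fun i => (X (.X i)).totalDegree) (Finset.mem_univ i)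
    rw [Finset.mem_range] at *
    omega
  · refine MvPolynomial.homogeneousComponent_eq_zero _ _ ?_
    rw [Finset.mem_range] at hn
    omega

/-- The Euler vector field `∑ xᵢ ∂ᵢ`. -/
def euler : PolyField 𝕂 d := MvPolynomial.mkDerivation 𝕂 MvPolynomial.X

lemma euler_X (i : Fin d) : (euler : PolyField 𝕂 d) (.X i) = .X i := by simp [euler]

lemma euler_mem : (euler : PolyField 𝕂 d) ∈ homogeneousFields 𝕂 d 1 := fun i => by
  rw [euler_X]
  exact MvPolynomial.isHomogeneous_X _ _

lemma euler_apply {p : MvPolynomial (Fin d) 𝕂} {n : ℕ} (hp : p.IsHomogeneous n) :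
    (euler : PolyField 𝕂 d) p = (n : 𝕂) • p := by
  rw [apply_eq]
  simp only [euler_X]
  rw [hp.sum_X_mul_pderiv, Nat.cast_smul_eq_nsmul]

/-- `ad E` is the grading operator: coefficients of degree `n` have weight `n - 1`. -/
lemma euler_lie {X : PolyField 𝕂 d} {n : ℕ} (hX : X ∈ homogeneousFields 𝕂 d n) :
    ⁅(euler : PolyField 𝕂 d), X⁆ = ((n : 𝕂) - 1) • X := PolyField.ext fun i => by
  rw [Derivation.commutator_apply, euler_X, euler_apply (hX i), Derivation.smul_apply, sub_smul,
    one_smul]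

lemma eq_sum_smul_pderiv {X : PolyField 𝕂 d} (hX : X ∈ homogeneousFields 𝕂 d 0) :
    X = ∑ i, MvPolynomial.coeff 0 (X (.X i)) • (pderiv i : PolyField 𝕂 d) :=
  PolyField.ext fun j => by
    have h := MvPolynomial.totalDegree_eq_zero_iff_eq_C.1
      ((hX j).totalDegree_le.antisymm (Nat.zero_le _))
    rw [PolyField.sum_apply]
    simp only [Derivation.smul_apply, MvPolynomial.pderiv_X, Pi.single_apply]
    simp only [smul_ite, smul_zero, Finset.sum_ite_eq, Finset.mem_univ, if_true]
    rw [MvPolynomial.smul_eq_C_mul, mul_one]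
    exact h

/-- A field of degree `n ≠ 1` in terms of its derivatives, by Euler's identity. -/
lemma sum_X_mul_lie {X : PolyField 𝕂 d} {n : ℕ} (hX : X ∈ homogeneousFields 𝕂 d n)
    (p : MvPolynomial (Fin d) 𝕂) :
    ∑ v, MvPolynomial.X v * ⁅(pderiv v : PolyField 𝕂 d), X⁆ p = (n : 𝕂) • X p := by
  simp only [apply_eq ⁅_, X⁆ p, apply_eq X p, pderiv_lie_apply, Finset.mul_sum, Finset.smul_sum]
  rw [Finset.sum_comm]
  refine Finset.sum_congr rfl fun j _ => ?_
  simp only [← mul_assoc]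
  rw [← Finset.sum_mul, (hX j).sum_X_mul_pderiv, ← smul_mul_assoc, Nat.cast_smul_eq_nsmul]

end IFFTQuant

end

noncomputable section

namespace IFFTQuant

variable {𝕂 : Type*} [RCLike 𝕂] {d : ℕ}

open MvPolynomial (pderiv)
open PolyField

/-! ### The structure of IFFT algebras -/

namespace IsIFFT

variable {g : LieSubalgebra 𝕂 (PolyField 𝕂 d)}

lemma killingForm_comm (X Y : g) : killingForm 𝕂 g X Y = killingForm 𝕂 g Y X :=
  LieModule.traceForm_comm 𝕂 g g X Y

variable [FiniteDimensional 𝕂 g]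

lemma homPart_mem (hg : IsIFFT g) (n : ℕ) {X : PolyField 𝕂 d} (hX : X ∈ g) :
    homPart n X ∈ g := by
  refine Submodule.iSup_induction (fun n => g.toSubmodule ⊓ homogeneousFields 𝕂 d n)
    (motive := fun X => homPart n X ∈ g) (hg.graded X hX) (fun m Y hY => ?_) ?_ ?_
  · rw [homPart_of_mem hY.2]
    split_ifs
    · exact hY.1
    · exact g.zero_mem
  · rw [map_zero]
    exact g.zero_mem
  · intro Y Z hY hZ
    rw [map_add]
    exact g.add_mem hY hZ

lemma const_mem (hg : IsIFFT g) {X : PolyField 𝕂 d} (hX : X ∈ homogeneousFields 𝕂 d 0) : X ∈ g :=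
  hg.transitive hX

lemma pderiv_mem (hg : IsIFFT g) (i : Fin d) : (pderiv i : PolyField 𝕂 d) ∈ g :=
  hg.const_mem (IFFTQuant.pderiv_mem i)

/-- A nonzero ideal contains a nonzero constant field. -/
lemma exists_const_mem_ideal (hg : IsIFFT g) (I : LieIdeal 𝕂 g) (n : ℕ) (X : g) (hX : X ∈ I)
    (h0 : X ≠ 0) (hn : ∀ j (α : Fin d →₀ ℕ), n ≤ α.degree →
      MvPolynomial.coeff α ((X : PolyField 𝕂 d) (.X j)) = 0) :
    ∃ Y ∈ I, Y ≠ 0 ∧ (Y : PolyField 𝕂 d) ∈ homogeneousFields 𝕂 d 0 := by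
  induction n generalizing X with
  | zero =>
    refine absurd (Subtype.ext (PolyField.ext fun j => ?_)) h0
    ext α
    rw [hn j α (Nat.zero_le _)]
    simp
  | succ n ih =>
    -- Bracketing with a `∂ᵢ` that does not commute with `X` stays in the ideal, is nonzero and
    -- lowers the degree of the coefficients.
    by_cases hc : ∀ i, ⁅(pderiv i : PolyField 𝕂 d), (X : PolyField 𝕂 d)⁆ = 0
    · exact ⟨X, hX, h0, mem_homogeneousFields_zero hc⟩
    · push Not at hc
      obtain ⟨i, hi⟩ := hc
      refine ih ⁅(⟨pderiv i, hg.pderiv_mem i⟩ : g), X⁆ (I.lie_mem hX)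
        (fun h => hi (congrArg Subtype.val h)) fun j α hα => ?_
      change MvPolynomial.coeff α (⁅(pderiv i : PolyField 𝕂 d), (X : PolyField 𝕂 d)⁆ (.X j)) = 0
      rw [pderiv_lie_apply, MvPolynomial.coeff_pderiv, hn, zero_mul]
      rw [map_add, Finsupp.degree_single]
      omega

/-- The constant fields of `I` form a nonzero `𝔤₀`-stable space, hence all of `𝔤₋₁` by
irreducibility. -/
lemma const_mem_ideal (hg : IsIFFT g) {I : LieIdeal 𝕂 g} (hI : I ≠ ⊥) {Y : g}
    (hY : (Y : PolyField 𝕂 d) ∈ homogeneousFields 𝕂 d 0) : Y ∈ I := by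
  obtain ⟨X, hX, h0⟩ := (Submodule.ne_bot_iff I.toSubmodule).1
    fun h => hI ((LieSubmodule.toSubmodule_eq_bot I).1 h)
  obtain ⟨Z, hZ, hZ0, hZc⟩ := hg.exists_const_mem_ideal I
    ((Finset.univ.sup fun i => ((X : PolyField 𝕂 d) (.X i)).totalDegree) + 1) X hX h0
    fun j α hα => by
      have h : ((X : PolyField 𝕂 d) (.X j)).totalDegree
          ≤ Finset.univ.sup fun i => ((X : PolyField 𝕂 d) (.X i)).totalDegree :=
        Finset.le_sup (f := fun i => ((X : PolyField 𝕂 d) (.X i)).totalDegree) (Finset.mem_univ j)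
      by_contra hc
      have := MvPolynomial.le_totalDegree (MvPolynomial.mem_support_iff.2 hc)
      rw [Finsupp.degree_eq_sum] at hα
      rw [Finsupp.sum_fintype _ _ (fun _ => rfl)] at this
      omega
  let W : Submodule 𝕂 (PolyField 𝕂 d) :=
    (I.toSubmodule.map g.toSubmodule.subtype) ⊓ homogeneousFields 𝕂 d 0
  have hW : W = homogeneousFields 𝕂 d 0 := by
    refine (hg.irreducible W inf_le_right ?_).resolve_left fun h => hZ0 ?_
    · rintro D ⟨hD, hD1⟩ _ ⟨⟨w, hw, rfl⟩, hw0⟩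
      exact ⟨⟨⁅(⟨D, hD⟩ : g), w⁆, I.lie_mem hw, rfl⟩, lie_mem_homogeneousFields hD1 hw0 rfl⟩
    · have : (Z : PolyField 𝕂 d) ∈ W := ⟨⟨Z, hZ, rfl⟩, hZc⟩
      rw [h] at this
      exact Subtype.ext ((Submodule.mem_bot 𝕂).1 this)
  have hYW : (Y : PolyField 𝕂 d) ∈ W := hW ▸ hY
  obtain ⟨w, hw, hwY⟩ := hYW.1
  rwa [← Subtype.ext hwY]

/-- A nonzero abelian ideal contains `𝔤₋₁` and commutes with it, so it consists of constant fields.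
For `Q ∈ 𝔤₁` the bracket `[Q, ∂ᵢ]` is then both constant and linear, hence zero for all `i`, which
forces `Q = 0` and contradicts `𝔤₁ ≠ 0`. -/
lemma hasTrivialRadical (hg : IsIFFT g) : LieAlgebra.HasTrivialRadical 𝕂 g := by
  rw [LieAlgebra.hasTrivialRadical_iff_no_abelian_ideals]
  intro I hI
  by_contra h0
  have hIc : ∀ X ∈ I, (X : PolyField 𝕂 d) ∈ homogeneousFields 𝕂 d 0 := fun X hX =>
    mem_homogeneousFields_zero fun i => by
      have h := hI.trivial ⟨⟨pderiv i, hg.pderiv_mem i⟩,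
        hg.const_mem_ideal h0 (IFFTQuant.pderiv_mem i)⟩ ⟨X, hX⟩
      exact congrArg Subtype.val (congrArg Subtype.val h)
  obtain ⟨Q, hQ, hQ0⟩ := (Submodule.ne_bot_iff _).1 hg.quadratic_ne_bot
  refine hQ0 (homogeneousFields_eq_zero (m := 0) (n := 2) (by norm_num)
    (mem_homogeneousFields_zero fun i => ?_) hQ.2)
  have h1 := hIc _ (lie_mem_left 𝕂 g I _ (⟨Q, hQ.1⟩ : g)
    (hg.const_mem_ideal h0 (Y := ⟨pderiv i, hg.pderiv_mem i⟩) (IFFTQuant.pderiv_mem i)))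
  exact homogeneousFields_eq_zero (m := 0) (n := 1) (by norm_num) h1
    (lie_mem_homogeneousFields (IFFTQuant.pderiv_mem i) hQ.2 rfl)

lemma isKilling (hg : IsIFFT g) : LieAlgebra.IsKilling 𝕂 g :=
  have := hg.hasTrivialRadical
  inferInstance

lemma euler_lie_mem (hg : IsIFFT g) {X : PolyField 𝕂 d} (hX : X ∈ g) :
    ⁅(euler : PolyField 𝕂 d), X⁆ ∈ g := by
  obtain ⟨N, hN⟩ := exists_sum_homPart X
  rw [hN, PolyField.lie_sum]
  refine g.toSubmodule.sum_mem fun n _ => ?_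
  rw [euler_lie (IFFTQuant.homPart_mem n X)]
  exact g.smul_mem _ (hg.homPart_mem n hX)

/-- `ad E` is a derivation of the semisimple algebra `𝔤`, hence equals `ad x` for some `x ∈ 𝔤`. The
field `x - E` commutes with every `∂ᵢ`, so it is constant and lies in `𝔤`. -/
lemma euler_mem (hg : IsIFFT g) : (euler : PolyField 𝕂 d) ∈ g := by
  have := hg.isKilling
  let D : LieDerivation 𝕂 g g :=
    { toFun := fun X => ⟨⁅(euler : PolyField 𝕂 d), (X : PolyField 𝕂 d)⁆, hg.euler_lie_mem X.2⟩
      map_add' := fun X Y => Subtype.ext (PolyField.lie_add _ _ _)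
      map_smul' := fun c X => Subtype.ext (PolyField.lie_smul _ _ _)
      leibniz' := fun X Y => Subtype.ext <| by
        change ⁅(euler : PolyField 𝕂 d), ⁅(X : PolyField 𝕂 d), (Y : PolyField 𝕂 d)⁆⁆
          = ⁅(X : PolyField 𝕂 d), ⁅(euler : PolyField 𝕂 d), (Y : PolyField 𝕂 d)⁆⁆
            - ⁅(Y : PolyField 𝕂 d), ⁅(euler : PolyField 𝕂 d), (X : PolyField 𝕂 d)⁆⁆
        rw [PolyField.leibniz_lie, add_comm, PolyField.lie_skew (Y : PolyField 𝕂 d), sub_neg_eq_add] }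
  have hD : D ∈ (LieDerivation.ad 𝕂 g).range := by
    rw [LieDerivation.IsKilling.range_ad_eq_top]
    exact LieSubalgebra.mem_top D
  obtain ⟨x, hx⟩ := (LieHom.mem_range _ _).1 hD
  have h1 : ∀ y : g, ⁅(x : PolyField 𝕂 d), (y : PolyField 𝕂 d)⁆
      = ⁅(euler : PolyField 𝕂 d), (y : PolyField 𝕂 d)⁆ := fun y => by
    have h2 : ⁅x, y⁆ = D y := by rw [← hx, LieDerivation.ad_apply_apply]
    exact congrArg Subtype.val h2
  have h : (x : PolyField 𝕂 d) - euler ∈ homogeneousFields 𝕂 d 0 :=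
    mem_homogeneousFields_zero fun i => by
      rw [PolyField.lie_sub, PolyField.lie_skew, PolyField.lie_skew _ euler,
        h1 ⟨pderiv i, hg.pderiv_mem i⟩, sub_self]
  have h3 : (euler : PolyField 𝕂 d) = (x : PolyField 𝕂 d) - ((x : PolyField 𝕂 d) - euler) :=
    (sub_sub_cancel _ _).symm
  exact (congrArg (· ∈ g) h3).mpr (g.sub_mem x.2 (hg.const_mem h))

/-- Invariance under `ad E` forces the weights `m - 1` and `n - 1` to be opposite. -/
lemma killingForm_eq_zero (hg : IsIFFT g) {X Y : g} {m n : ℕ}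
    (hX : (X : PolyField 𝕂 d) ∈ homogeneousFields 𝕂 d m)
    (hY : (Y : PolyField 𝕂 d) ∈ homogeneousFields 𝕂 d n) (hmn : m + n ≠ 2) :
    killingForm 𝕂 g X Y = 0 := by
  let E : g := ⟨euler, hg.euler_mem⟩
  have h1 : ⁅E, X⁆ = ((m : 𝕂) - 1) • X := Subtype.ext (euler_lie hX)
  have h2 : ⁅E, Y⁆ = ((n : 𝕂) - 1) • Y := Subtype.ext (euler_lie hY)
  have h := LieModule.traceForm_apply_lie_apply' 𝕂 g g E X Y
  rw [h1, h2, map_smul, map_smul, LinearMap.smul_apply, smul_eq_mul, smul_eq_mul] at h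
  have h3 : ((m : 𝕂) + n - 2) * killingForm 𝕂 g X Y = 0 := by linear_combination h
  refine (mul_eq_zero.1 h3).resolve_left fun h4 => hmn ?_
  have h5 : ((m + n : ℕ) : 𝕂) = (2 : ℕ) := by push_cast; linear_combination h4
  exact_mod_cast h5

/-- The homogeneous component of degree `n`, as an element of `g`. -/
def part (hg : IsIFFT g) (n : ℕ) (X : g) : g := ⟨homPart n (X : PolyField 𝕂 d), hg.homPart_mem n X.2⟩

lemma part_mem (hg : IsIFFT g) (n : ℕ) (X : g) :
    (hg.part n X : PolyField 𝕂 d) ∈ homogeneousFields 𝕂 d n := IFFTQuant.homPart_mem n _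

lemma exists_sum_part (hg : IsIFFT g) (X : g) : ∃ N, X = ∑ n ∈ Finset.range N, hg.part n X := by
  obtain ⟨N, hN⟩ := exists_sum_homPart (X : PolyField 𝕂 d)
  refine ⟨N, Subtype.ext (hN.trans ?_)⟩
  change _ = g.toSubmodule.subtype _
  rw [map_sum]
  rfl

lemma eq_zero_of_killingForm (hg : IsIFFT g) {X : g} (h : ∀ Y, killingForm 𝕂 g X Y = 0) :
    X = 0 := by
  have := hg.isKilling
  exact (LieAlgebra.IsKilling.killingForm_nondegenerate 𝕂 g).1 X h

/-- The Killing form pairs the component of degree `m` with that of degree `2 - m`. -/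
lemma eq_zero_of_killingForm_part (hg : IsIFFT g) {X : g} {m : ℕ}
    (hX : (X : PolyField 𝕂 d) ∈ homogeneousFields 𝕂 d m)
    (h : ∀ Y : g, ∀ n, m + n = 2 → (Y : PolyField 𝕂 d) ∈ homogeneousFields 𝕂 d n →
      killingForm 𝕂 g X Y = 0) : X = 0 :=
  hg.eq_zero_of_killingForm fun Y => by
    obtain ⟨N, hN⟩ := hg.exists_sum_part Y
    rw [hN, map_sum]
    refine Finset.sum_eq_zero fun n _ => ?_
    by_cases hmn : m + n = 2
    · exact h _ n hmn (hg.part_mem n Y)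
    · exact hg.killingForm_eq_zero hX (hg.part_mem n Y) hmn

/-- A component of degree at least 3 has no partner degree `2 - n`, so it is orthogonal to
everything. Hence `𝔤 = 𝔤₋₁ ⊕ 𝔤₀ ⊕ 𝔤₁`. -/
lemma part_eq_zero (hg : IsIFFT g) (X : g) {n : ℕ} (hn : 3 ≤ n) : hg.part n X = 0 :=
  hg.eq_zero_of_killingForm_part (hg.part_mem n X) fun Y m hm => by omega

lemma eq_add_part (hg : IsIFFT g) (X : g) : X = hg.part 0 X + hg.part 1 X + hg.part 2 X := by
  obtain ⟨N, hN⟩ := hg.exists_sum_part X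
  -- The range is enlarged by 3 so that the degrees 0, 1, 2 occur whatever `N` is; the new terms
  -- vanish.
  have h : ∑ n ∈ Finset.range N, hg.part n X = ∑ n ∈ Finset.range (N + 3), hg.part n X := by
    refine Finset.sum_subset (Finset.range_mono (by omega)) fun n hn hnN => ?_
    rw [Finset.mem_range] at *
    rcases Nat.lt_or_ge n 3 with h3 | h3
    · obtain ⟨M, hM⟩ := exists_sum_homPart (X : PolyField 𝕂 d)
      refine Subtype.ext ?_
      have h1 : homPart n (X : PolyField 𝕂 d) = homPart n (∑ k ∈ Finset.range N, hg.part k X : g) :=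
        congrArg (fun Y : g => homPart n (Y : PolyField 𝕂 d)) hN
      have h2 : ((∑ k ∈ Finset.range N, hg.part k X : g) : PolyField 𝕂 d)
          = ∑ k ∈ Finset.range N, homPart k (X : PolyField 𝕂 d) := by
        change g.toSubmodule.subtype _ = _
        rw [map_sum]
        rfl
      change homPart n (X : PolyField 𝕂 d) = 0
      rw [h1, h2, map_sum]
      refine Finset.sum_eq_zero fun k hk => ?_
      rw [homPart_of_mem (IFFTQuant.homPart_mem k _), if_neg]
      rw [Finset.mem_range] at hk
      omega
    · exact hg.part_eq_zero X h3
  conv_lhs => rw [hN, h]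
  rw [add_comm N, Finset.sum_range_add]
  rw [Finset.sum_eq_zero (s := Finset.range N) fun n _ => hg.part_eq_zero X (by omega)]
  simp [Finset.sum_range_succ]

/-- Induction principle: an additive property of the elements of `g` may be checked on constant,
linear and quadratic fields. -/
lemma induction_on (hg : IsIFFT g) {p : PolyField 𝕂 d → Prop}
    (h0 : ∀ X ∈ homogeneousFields 𝕂 d 0, p X) (h1 : ∀ X ∈ linearPart g, p X)
    (h2 : ∀ X ∈ g.toSubmodule ⊓ homogeneousFields 𝕂 d 2, p X)
    (hadd : ∀ X Y, p X → p Y → p (X + Y)) {X : PolyField 𝕂 d} (hX : X ∈ g) : p X := by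
  have h := congrArg Subtype.val (hg.eq_add_part ⟨X, hX⟩)
  rw [show X = _ from h]
  exact hadd _ _ (hadd _ _ (h0 _ (hg.part_mem 0 _))
    (h1 _ ⟨(hg.part 1 ⟨X, hX⟩).2, hg.part_mem 1 _⟩)) (h2 _ ⟨(hg.part 2 ⟨X, hX⟩).2, hg.part_mem 2 _⟩)

end IsIFFT

end IFFTQuant

end

/-! ### Schur's lemma over the base field, and linear fields of `𝔤` -/

noncomputable section

namespace LieAlgebra

open LieModule Module

/-- If `A ⊗ L` is a simple Lie algebra over an algebraically closed extension `A` of `K`, every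
endomorphism of the adjoint representation of `L` is a scalar. -/
lemma exists_eq_smul_of_commute_ad_of_baseChange {K L : Type*} (A : Type*) [Field K] [Field A]
    [IsAlgClosed A] [Algebra K A] [LieRing L] [LieAlgebra K L] [FiniteDimensional K L]
    [IsSimple A (A ⊗[K] L)] (T : Module.End K L) (hT : ∀ x y : L, T ⁅x, y⁆ = ⁅x, T y⁆) :
    ∃ c : K, ∀ x, T x = c • x := by
  have hTA : ∀ x y : A ⊗[K] L, T.baseChange A (toEnd A (A ⊗[K] L) (A ⊗[K] L) x y)
      = toEnd A (A ⊗[K] L) (A ⊗[K] L) x (T.baseChange A y) := by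
    intro x m
    induction x using TensorProduct.induction_on with
    | zero => simp only [map_zero, LinearMap.zero_apply]
    | add x y hx hy => simp only [map_add, LinearMap.add_apply, hx, hy]
    | tmul a x =>
      induction m using TensorProduct.induction_on with
      | zero => simp only [map_zero]
      | add m n hm hn => simp only [map_add, hm, hn]
      | tmul a' m =>
        change (a * a') ⊗ₜ[K] T ⁅x, m⁆ = (a * a') ⊗ₜ[K] ⁅x, T m⁆
        rw [hT]
  obtain ⟨z, hz⟩ := exists_eq_smul_of_commute_ad (T.baseChange A) hTA
  let b := Module.finBasis K L
  -- The scalar lies in `K`, being a diagonal entry of the matrix of `T` in a basis of `L`.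
  have hzc : ∀ i, z = algebraMap K A (b.repr (T (b i)) i) := fun i => by
    have h := congrArg (fun y => (b.baseChange A).repr y i) (hz (1 ⊗ₜ b i))
    simpa [Basis.baseChange_repr_tmul, Algebra.algebraMap_eq_smul_one] using h.symm
  rcases isEmpty_or_nonempty (Fin (finrank K L)) with he | ⟨⟨i⟩⟩
  · exact ⟨0, fun x => by
      rw [← b.sum_repr x]
      simp⟩
  · refine ⟨b.repr (T (b i)) i, fun x =>
      Module.FaithfullyFlat.tensorProduct_mk_injective (A := K) (B := A) L ?_⟩
    have h := hz (1 ⊗ₜ x)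
    rw [LinearMap.baseChange_tmul, hzc i, algebraMap_smul, ← TensorProduct.tmul_smul] at h
    exact h

end LieAlgebra

namespace IFFTQuant

variable {𝕂 : Type*} [RCLike 𝕂] {d : ℕ}

open MvPolynomial (pderiv)
open PolyField

/-! ### The structure of the linear part -/

/-- The semisimple part `𝔥₀`, as a space of polynomial vector fields. -/
def ssFields (g : LieSubalgebra 𝕂 (PolyField 𝕂 d)) : Submodule 𝕂 (PolyField 𝕂 d) :=
  Submodule.span 𝕂 {Z | ∃ X ∈ linearPart g, ∃ Y ∈ linearPart g, ⁅X, Y⁆ = Z}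

variable {g : LieSubalgebra 𝕂 (PolyField 𝕂 d)}

lemma map_semisimplePart : (semisimplePart g).toSubmodule.map (linearPart g).toSubmodule.subtype
    = ssFields g := by
  have h : (semisimplePart g).toSubmodule
      = Submodule.span 𝕂 {Z | ∃ X Y : linearPart g, ⁅X, Y⁆ = Z} := by
    rw [semisimplePart, LieAlgebra.derivedSeries_def, LieAlgebra.derivedSeriesOfIdeal_succ,
      LieAlgebra.derivedSeriesOfIdeal_zero, LieSubmodule.lieIdeal_oper_eq_linear_span']
    simp
  rw [h, Submodule.map_span, ssFields]
  congr 1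
  ext Z
  constructor
  · rintro ⟨_, ⟨X, Y, rfl⟩, rfl⟩
    exact ⟨X, X.2, Y, Y.2, rfl⟩
  · rintro ⟨X, hX, Y, hY, rfl⟩
    exact ⟨_, ⟨⟨X, hX⟩, ⟨Y, hY⟩, rfl⟩, rfl⟩

lemma coe_mem_ssFields (x : semisimplePart g) : ((x : linearPart g) : PolyField 𝕂 d) ∈ ssFields g :=
  map_semisimplePart (g := g) ▸ ⟨x, x.2, rfl⟩

lemma exists_coe_eq {X : PolyField 𝕂 d} (hX : X ∈ ssFields g) :
    ∃ x : semisimplePart g, ((x : linearPart g) : PolyField 𝕂 d) = X := by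
  rw [← map_semisimplePart] at hX
  obtain ⟨x, hx, rfl⟩ := hX
  exact ⟨⟨x, hx⟩, rfl⟩

lemma ssFields_le : ssFields g ≤ (linearPart g).toSubmodule := by
  rw [ssFields, Submodule.span_le]
  rintro _ ⟨X, hX, Y, hY, rfl⟩
  exact (linearPart g).lie_mem hX hY

lemma lie_mem_ssFields {X Y : PolyField 𝕂 d} (hX : X ∈ linearPart g) (hY : Y ∈ linearPart g) :
    ⁅X, Y⁆ ∈ ssFields g := Submodule.subset_span ⟨X, hX, Y, hY, rfl⟩

/-- The composition of linear fields: the components of `Y` are combined by the matrix of `a`. -/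
def leftMul (a : PolyField 𝕂 d) : PolyField 𝕂 d →ₗ[𝕂] PolyField 𝕂 d where
  toFun Y := MvPolynomial.mkDerivation 𝕂 fun i => Y (a (.X i))
  map_add' X Y := PolyField.ext fun i => by simp
  map_smul' c X := PolyField.ext fun i => by simp

lemma leftMul_X (a Y : PolyField 𝕂 d) (i : Fin d) : leftMul a Y (.X i) = Y (a (.X i)) := by
  simp [leftMul]

lemma eq_sum_coeff_smul_X {p : MvPolynomial (Fin d) 𝕂} (hp : p.IsHomogeneous 1) :
    p = ∑ j, MvPolynomial.coeff 0 (pderiv j p) • MvPolynomial.X j := by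
  have h := hp.sum_X_mul_pderiv
  rw [one_smul] at h
  conv_lhs => rw [← h]
  refine Finset.sum_congr rfl fun j _ => ?_
  have hj : (pderiv j p).IsHomogeneous 0 := hp.pderiv
  conv_lhs => rw [MvPolynomial.totalDegree_eq_zero_iff_eq_C.1
    (hj.totalDegree_le.antisymm (Nat.zero_le _))]
  rw [MvPolynomial.smul_eq_C_mul, mul_comm]

lemma leftMul_apply (a Y : PolyField 𝕂 d) {p : MvPolynomial (Fin d) 𝕂} (hp : p.IsHomogeneous 1) :
    leftMul a Y p = Y (a p) := by
  rw [eq_sum_coeff_smul_X hp]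
  simp only [map_sum, Derivation.map_smul, leftMul_X]

/-- A linear field `X` commuting with `a` also commutes with composition by the matrix of `a`. This
supplies an endomorphism of the adjoint representation to which Schur's lemma applies. -/
lemma leftMul_lie {a X Y : PolyField 𝕂 d} (hX : X ∈ homogeneousFields 𝕂 d 1) (h : ⁅X, a⁆ = 0) :
    leftMul a ⁅X, Y⁆ = ⁅X, leftMul a Y⁆ := PolyField.ext fun i => by
  have h1 : ∀ p, X (a p) = a (X p) := fun p => by
    have := congrArg (fun D : PolyField 𝕂 d => D p) h
    rw [Derivation.commutator_apply] at this
    exact sub_eq_zero.1 this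
  rw [Derivation.commutator_apply, leftMul_X, leftMul_X, Derivation.commutator_apply,
    leftMul_apply a Y (hX i), h1]

namespace IsIFFT

variable [FiniteDimensional 𝕂 g]

lemma killingForm_part (hg : IsIFFT g) (X : g) {Y : g} {m n : ℕ} (hmn : m + n = 2)
    (hY : (Y : PolyField 𝕂 d) ∈ homogeneousFields 𝕂 d n) :
    killingForm 𝕂 g (hg.part m X) Y = killingForm 𝕂 g X Y := by
  conv_rhs => rw [hg.eq_add_part X]
  have h : ∀ k, k ≠ m → killingForm 𝕂 g (hg.part k X) Y = 0 := fun k hk =>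
    hg.killingForm_eq_zero (hg.part_mem k X) hY (by omega)
  rw [map_add, map_add, LinearMap.add_apply, LinearMap.add_apply]
  have : m = 0 ∨ m = 1 ∨ m = 2 := by omega
  rcases this with rfl | rfl | rfl <;> simp [h]

/-- A space of linear fields whose orthogonal in `𝔤₀` is zero contains `𝔤₀`. -/
lemma mem_of_orthogonal (hg : IsIFFT g) (S : Submodule 𝕂 (PolyField 𝕂 d))
    (hS : ∀ Z : g, (Z : PolyField 𝕂 d) ∈ homogeneousFields 𝕂 d 1 →
      (∀ Y : g, (Y : PolyField 𝕂 d) ∈ homogeneousFields 𝕂 d 1 → (Y : PolyField 𝕂 d) ∈ S →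
        killingForm 𝕂 g Z Y = 0) → Z = 0)
    {D : PolyField 𝕂 d} (hD : D ∈ linearPart g) : D ∈ S := by
  have := hg.isKilling
  -- The elements whose linear part lies in `S`. Its orthogonal is zero: the constant and quadratic
  -- fields in `M` kill the parts of degree 2 and 0, and the hypothesis kills the linear part.
  -- Taking the orthogonal twice gives `M = ⊤`.
  let M : Submodule 𝕂 g := (S.comap (homPart 1)).comap g.toSubmodule.subtype
  have hM : LinearMap.BilinForm.orthogonal (killingForm 𝕂 g) M = ⊥ := by
    rw [eq_bot_iff]
    intro Z hZ
    have hZ' : ∀ Y : g, homPart 1 (Y : PolyField 𝕂 d) ∈ S → killingForm 𝕂 g Z Y = 0 := fun Y hY => by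
      rw [killingForm_comm]
      exact (LinearMap.BilinForm.mem_orthogonal_iff.1 hZ) Y hY
    have h02 : ∀ m n, m + n = 2 → n ≠ 1 → hg.part m Z = 0 := fun m n hmn hn =>
      hg.eq_zero_of_killingForm_part (hg.part_mem m Z) fun Y n' hn' hY => by
        rw [hg.killingForm_part Z hn' hY]
        refine hZ' Y ?_
        rw [homPart_of_mem hY, if_neg (by omega)]
        exact S.zero_mem
    have h1 : hg.part 1 Z = 0 := hS _ (hg.part_mem 1 Z) fun Y hY hYS => by
      rw [hg.killingForm_part Z rfl hY]
      refine hZ' Y ?_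
      rwa [homPart_of_mem hY, if_pos rfl]
    rw [Submodule.mem_bot, hg.eq_add_part Z, h02 0 2 rfl (by norm_num), h1,
      h02 2 0 rfl (by norm_num)]
    simp
  have htop : M = ⊤ := by
    have h := LinearMap.BilinForm.orthogonal_orthogonal
      (LieAlgebra.IsKilling.killingForm_nondegenerate 𝕂 g)
      (LieModule.traceForm_isSymm 𝕂 g g).isRefl M
    rw [hM] at h
    rw [← h, eq_top_iff]
    intro x _
    rw [LinearMap.BilinForm.mem_orthogonal_iff]
    rintro _ rfl
    exact LinearMap.BilinForm.zero_left _
  have h : (⟨D, hD.1⟩ : g) ∈ M := htop ▸ Submodule.mem_top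
  have h' : homPart 1 D ∈ S := h
  rwa [homPart_of_mem hD.2, if_pos rfl] at h'

/-- `𝔤₀ = [𝔤₋₁, 𝔤₁]`. -/
lemma mem_span_lie (hg : IsIFFT g) {D : PolyField 𝕂 d} (hD : D ∈ linearPart g) :
    D ∈ Submodule.span 𝕂 {Z : PolyField 𝕂 d | ∃ v, ∃ X ∈ g.toSubmodule ⊓ homogeneousFields 𝕂 d 2,
      ⁅(pderiv v : PolyField 𝕂 d), X⁆ = Z} := by
  refine hg.mem_of_orthogonal _ (fun Z hZ1 hZ => ?_) hD
  refine Subtype.ext (homogeneousFields_eq_zero (m := 0) (n := 1) (by norm_num)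
    (mem_homogeneousFields_zero fun v => ?_) hZ1)
  let P : g := ⟨pderiv v, hg.pderiv_mem v⟩
  -- For quadratic `Y`, `κ([∂ᵥ, Z], Y) = -κ(Z, [∂ᵥ, Y]) = 0`, so `[∂ᵥ, Z] = 0` for all `v` and the
  -- linear field `Z` is constant, hence zero.
  have h2 : ⁅P, Z⁆ = 0 := by
    refine hg.eq_zero_of_killingForm_part (m := 0)
      (lie_mem_homogeneousFields (IFFTQuant.pderiv_mem v) hZ1 rfl) fun Y n hn hY => ?_
    obtain rfl : n = 2 := by omega
    rw [LieModule.traceForm_apply_lie_apply', neg_eq_zero]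
    exact hZ _ (lie_mem_homogeneousFields (IFFTQuant.pderiv_mem v) hY rfl)
      (Submodule.subset_span ⟨v, Y, ⟨Y.2, hY⟩, rfl⟩)
  exact congrArg Subtype.val h2

end IsIFFT

end IFFTQuant

end

/-! ### The centre of `𝔤₀` -/

noncomputable section

namespace IFFTQuant

variable {𝕂 : Type*} [RCLike 𝕂] {d : ℕ}

open MvPolynomial (pderiv)
open PolyField

variable {g : LieSubalgebra 𝕂 (PolyField 𝕂 d)}

instance [FiniteDimensional 𝕂 g] : FiniteDimensional 𝕂 (linearPart g) :=
  have : FiniteDimensional 𝕂 g.toSubmodule := ‹_›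
  Submodule.finiteDimensional_of_le (S₁ := (linearPart g).toSubmodule) (S₂ := g.toSubmodule)
    inf_le_left

instance [FiniteDimensional 𝕂 g] : FiniteDimensional 𝕂 (semisimplePart g) :=
  inferInstanceAs (FiniteDimensional 𝕂 (semisimplePart g).toSubmodule)

lemma mem_semisimplePart {X : PolyField 𝕂 d} (hX : X ∈ ssFields g) :
    (⟨X, ssFields_le hX⟩ : linearPart g) ∈ semisimplePart g := by
  obtain ⟨x, rfl⟩ := exists_coe_eq hX
  exact x.2

/-- A linear field of `g` commuting with `𝔤₀` acts on quadratic fields by composition. -/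
lemma leftMul_quadratic {a X : PolyField 𝕂 d} (hX : X ∈ homogeneousFields 𝕂 d 2)
    (h : ∀ v, ⁅a, ⁅(pderiv v : PolyField 𝕂 d), X⁆⁆ = 0) : leftMul a X = ⁅a, X⁆ :=
  PolyField.ext fun i => by
    have h1 : ∀ v, a (⁅(pderiv v : PolyField 𝕂 d), X⁆ (.X i))
        = ⁅(pderiv v : PolyField 𝕂 d), X⁆ (a (.X i)) := fun v => by
      have := congrArg (fun D : PolyField 𝕂 d => D (.X i)) (h v)
      rw [Derivation.commutator_apply] at this
      exact sub_eq_zero.1 this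
    -- Apply `a` to Euler's identity `∑ xᵥ [∂ᵥ, X] xᵢ = 2 X xᵢ`. As `a` commutes with each `[∂ᵥ,
    -- X]`, Leibniz gives `2 X(a xᵢ) + a(X xᵢ) = 2 a(X xᵢ)`, that is `a(X xᵢ) = 2 X(a xᵢ)`.
    have h2 := congrArg a (sum_X_mul_lie hX (.X i))
    rw [map_sum, Derivation.map_smul] at h2
    simp only [Derivation.leibniz, smul_eq_mul, h1, Finset.sum_add_distrib] at h2
    rw [sum_X_mul_lie hX, Finset.sum_congr rfl fun v _ => by
      rw [pderiv_lie_apply, mul_comm], ← apply_eq, MvPolynomial.smul_eq_C_mul,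
      MvPolynomial.smul_eq_C_mul] at h2
    rw [leftMul_X, Derivation.commutator_apply]
    have h3 : (MvPolynomial.C ((2 : ℕ) : 𝕂) : MvPolynomial (Fin d) 𝕂) = 2 :=
      map_ofNat MvPolynomial.C 2
    rw [h3] at h2
    linear_combination h2

lemma leftMul_pderiv_lie {a X : PolyField 𝕂 d} (ha : a ∈ homogeneousFields 𝕂 d 1) (v : Fin d) :
    leftMul a ⁅(pderiv v : PolyField 𝕂 d), X⁆ = ⁅(pderiv v : PolyField 𝕂 d), leftMul a X⁆ :=
  PolyField.ext fun i => by
    rw [leftMul_X, pderiv_lie_apply, leftMul_X, Derivation.commutator_apply,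
      apply_const (X := X) (ha i).pderiv, sub_zero]

lemma ssFields_ne_bot (hs : ComplexifiedIsSimple g) : ssFields g ≠ ⊥ := by
  intro h
  refine hs.non_abelian ⟨fun x y => ?_⟩
  have : Subsingleton (semisimplePart g) := ⟨fun x y => by
    have h1 : ∀ x : semisimplePart g, ((x : linearPart g) : PolyField 𝕂 d) = 0 := fun x => by
      have := coe_mem_ssFields x
      rwa [h] at this
    exact Subtype.ext (Subtype.ext ((h1 x).trans (h1 y).symm))⟩
  exact Subsingleton.elim _ _

namespace IsIFFT

variable [FiniteDimensional 𝕂 g]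

lemma pderiv_lie_mem (hg : IsIFFT g) (v : Fin d) {X : PolyField 𝕂 d}
    (hX : X ∈ g.toSubmodule ⊓ homogeneousFields 𝕂 d 2) :
    ⁅(pderiv v : PolyField 𝕂 d), X⁆ ∈ linearPart g :=
  ⟨g.lie_mem (hg.pderiv_mem v) hX.1, lie_mem_homogeneousFields (IFFTQuant.pderiv_mem v) hX.2 rfl⟩

/-- Since `𝔤₀ = [𝔤₋₁, 𝔤₁]`, it suffices to treat `[∂ᵥ, X]`. Composition with `a` passes through `∂ᵥ`
and acts on the quadratic `X` as `[a, X]`, which is again in `𝔤₁`. -/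
lemma leftMul_mem_linearPart (hg : IsIFFT g) {a : PolyField 𝕂 d} (ha : a ∈ linearPart g)
    (hc : ∀ Y ∈ linearPart g, ⁅a, Y⁆ = 0) {Y : PolyField 𝕂 d} (hY : Y ∈ linearPart g) :
    leftMul a Y ∈ linearPart g := by
  have h := hg.mem_span_lie hY
  clear hY
  induction h using Submodule.span_induction with
  | mem Z hZ =>
    obtain ⟨v, X, hX, rfl⟩ := hZ
    rw [leftMul_pderiv_lie ha.2, leftMul_quadratic hX.2 fun v => hc _ (hg.pderiv_lie_mem v hX)]
    exact hg.pderiv_lie_mem v ⟨g.lie_mem ha.1 hX.1, lie_mem_homogeneousFields ha.2 hX.2 rfl⟩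
  | zero => rw [map_zero]; exact (linearPart g).zero_mem
  | add X Y _ _ hX hY => rw [map_add]; exact (linearPart g).add_mem hX hY
  | smul c X _ hX => rw [map_smul]; exact (linearPart g).smul_mem c hX

/-- `𝔥₀` has no nonzero linear invariants. -/
lemma eq_zero_of_ssFields (hg : IsIFFT g) (hs : ComplexifiedIsSimple g)
    {p : MvPolynomial (Fin d) 𝕂} (hp : p.IsHomogeneous 1) (h : ∀ Y ∈ ssFields g, Y p = 0) :
    p = 0 := by
  -- `W = [𝔥₀, 𝔤₋₁]` is `𝔤₀`-stable. If it were zero, `𝔥₀` would commute with translations and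
  -- vanish; so it is `𝔤₋₁`. Each `[Y, w]` kills the invariant `p`, because `Y p = 0` and `w p` is
  -- constant.
  let W : Submodule 𝕂 (PolyField 𝕂 d) := Submodule.span 𝕂
    {Z | ∃ Y ∈ ssFields g, ∃ w ∈ homogeneousFields 𝕂 d 0, ⁅Y, w⁆ = Z}
  have hW0 : W ≤ homogeneousFields 𝕂 d 0 := by
    rw [Submodule.span_le]
    rintro _ ⟨Y, hY, w, hw, rfl⟩
    exact lie_mem_homogeneousFields (ssFields_le hY).2 hw rfl
  have hW : W = homogeneousFields 𝕂 d 0 := by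
    refine (hg.irreducible W hW0 fun D hD Z hZ => ?_).resolve_left fun hb => ?_
    · induction hZ using Submodule.span_induction with
      | mem Z hZ =>
        obtain ⟨Y, hY, w, hw, rfl⟩ := hZ
        rw [PolyField.leibniz_lie]
        exact W.add_mem
          (Submodule.subset_span ⟨_, lie_mem_ssFields hD (ssFields_le hY), w, hw, rfl⟩)
          (Submodule.subset_span ⟨Y, hY, _, lie_mem_homogeneousFields hD.2 hw rfl, rfl⟩)
      | zero =>
        have : ⁅D, (0 : PolyField 𝕂 d)⁆ = 0 := _root_.lie_zero D
        rw [this]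
        exact W.zero_mem
      | add X Y _ _ hX hY => rw [PolyField.lie_add]; exact W.add_mem hX hY
      | smul c X _ hX => rw [PolyField.lie_smul]; exact W.smul_mem c hX
    · refine ssFields_ne_bot hs ((Submodule.eq_bot_iff _).2 fun Y hY => ?_)
      refine homogeneousFields_eq_zero (m := 0) (n := 1) (by norm_num)
        (mem_homogeneousFields_zero fun i => ?_) (ssFields_le hY).2
      have : ⁅Y, (pderiv i : PolyField 𝕂 d)⁆ ∈ W :=
        Submodule.subset_span ⟨Y, hY, _, IFFTQuant.pderiv_mem i, rfl⟩
      rw [hb, Submodule.mem_bot] at this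
      rw [PolyField.lie_skew, this, neg_zero]
  have hZ : ∀ Z ∈ W, Z p = 0 := fun Z hZ => by
    induction hZ using Submodule.span_induction with
    | mem Z hZ =>
      obtain ⟨Y, hY, w, hw, rfl⟩ := hZ
      rw [Derivation.commutator_apply, h Y hY, map_zero, sub_zero]
      exact apply_const (apply_isHomogeneous' hw hp rfl)
    | zero => rfl
    | add X Y _ _ hX hY => rw [Derivation.add_apply, hX, hY, add_zero]
    | smul c X _ hX => rw [Derivation.smul_apply, hX, smul_zero]
  rw [eq_sum_coeff_smul_X hp]
  refine Finset.sum_eq_zero fun j _ => ?_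
  rw [hZ _ (hW ▸ IFFTQuant.pderiv_mem j), MvPolynomial.coeff_zero, zero_smul]

/-- The centre of `𝔤₀` is spanned by the Euler field. -/
lemma central_eq_smul_euler (hg : IsIFFT g) (hs : ComplexifiedIsSimple g) {a : PolyField 𝕂 d}
    (ha : a ∈ linearPart g) (hc : ∀ Y ∈ linearPart g, ⁅a, Y⁆ = 0) : ∃ c : 𝕂, a = c • euler := by
  -- Composition with `a` preserves `𝔥₀` and commutes with its adjoint action, so by Schur's lemma
  -- it is a scalar `c` on `𝔥₀`.
  have hss : ∀ Y ∈ ssFields g, leftMul a Y ∈ ssFields g := fun Y hY => by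
    induction hY using Submodule.span_induction with
    | mem Z hZ =>
      obtain ⟨X, hX, Y, hY, rfl⟩ := hZ
      rw [leftMul_lie hX.2 (by rw [PolyField.lie_skew, hc X hX, neg_zero])]
      exact lie_mem_ssFields hX (hg.leftMul_mem_linearPart ha hc hY)
    | zero => rw [map_zero]; exact (ssFields g).zero_mem
    | add X Y _ _ hX hY => rw [map_add]; exact (ssFields g).add_mem hX hY
    | smul c X _ hX => rw [map_smul]; exact (ssFields g).smul_mem c hX
  let T : Module.End 𝕂 (semisimplePart g) :=
    { toFun := fun x => ⟨⟨leftMul a x.1.1, ssFields_le (hss _ (coe_mem_ssFields x))⟩,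
        mem_semisimplePart (hss _ (coe_mem_ssFields x))⟩
      map_add' := fun x y => Subtype.ext (Subtype.ext (map_add (leftMul a) _ _))
      map_smul' := fun c x => Subtype.ext (Subtype.ext (map_smul (leftMul a) _ _)) }
  have : LieAlgebra.IsSimple (AlgebraicClosure 𝕂) (AlgebraicClosure 𝕂 ⊗[𝕂] semisimplePart g) := hs
  obtain ⟨c, hTc⟩ := LieAlgebra.exists_eq_smul_of_commute_ad_of_baseChange (AlgebraicClosure 𝕂) T
    fun x y => Subtype.ext (Subtype.ext (leftMul_lie x.1.2.2
      (by rw [PolyField.lie_skew, hc _ x.1.2, neg_zero])))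
  refine ⟨c, PolyField.ext fun i => ?_⟩
  rw [Derivation.smul_apply, euler_X, ← sub_eq_zero]
  -- For `Y ∈ 𝔥₀`, `Y(a xᵢ) = c Y xᵢ`, so `a xᵢ - c xᵢ` is a linear invariant of `𝔥₀`.
  refine hg.eq_zero_of_ssFields hs ((ha.2 i).sub ?_) fun Y hY => ?_
  · rw [MvPolynomial.smul_eq_C_mul]
    simpa using (MvPolynomial.isHomogeneous_C (Fin d) c).mul (MvPolynomial.isHomogeneous_X 𝕂 i)
  · obtain ⟨y, rfl⟩ := exists_coe_eq hY
    have h1 : leftMul a y.1.1 = c • y.1.1 := congrArg (fun z => z.1.1) (hTc y)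
    rw [map_sub, Derivation.map_smul, ← leftMul_X, h1, Derivation.smul_apply, sub_self]

end IsIFFT

end IFFTQuant

end

/-! ### The splitting of `𝔤₀` and the Killing form of `𝔤` on `𝔥₀` -/

noncomputable section

namespace IFFTQuant

variable {𝕂 : Type*} [RCLike 𝕂] {d : ℕ}

open MvPolynomial (pderiv)
open PolyField Module

variable {g : LieSubalgebra 𝕂 (PolyField 𝕂 d)}

lemma homPart_lie {D : PolyField 𝕂 d} (hD : D ∈ homogeneousFields 𝕂 d 1) (n : ℕ)
    (X : PolyField 𝕂 d) : homPart n ⁅D, X⁆ = ⁅D, homPart n X⁆ := by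
  obtain ⟨N, hN⟩ := exists_sum_homPart X
  conv_lhs => rw [hN]
  conv_rhs => rw [hN]
  rw [PolyField.lie_sum, map_sum, map_sum, PolyField.lie_sum]
  refine Finset.sum_congr rfl fun k _ => ?_
  rw [homPart_of_mem (lie_mem_homogeneousFields hD (homPart_mem k X) (k := k) (by omega)),
    homPart_of_mem (homPart_mem k X)]
  split_ifs
  · rfl
  · exact (_root_.lie_zero D).symm

/-- The inclusion of `𝔥₀` in `g`. -/
def ssIncl (g : LieSubalgebra 𝕂 (PolyField 𝕂 d)) : semisimplePart g →ₗ⁅𝕂⁆ g where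
  toFun x := ⟨x.1.1, x.1.2.1⟩
  map_add' _ _ := rfl
  map_smul' _ _ := rfl
  map_lie' := rfl

/-- The restriction to `𝔥₀` of the Killing form of `g`. -/
def ssForm (g : LieSubalgebra 𝕂 (PolyField 𝕂 d)) : LinearMap.BilinForm 𝕂 (semisimplePart g) :=
  (killingForm 𝕂 g).compl₁₂ (ssIncl g) (ssIncl g)

lemma ssForm_comm (x y : semisimplePart g) : ssForm g x y = ssForm g y x :=
  IsIFFT.killingForm_comm _ _

namespace IsIFFT

variable [FiniteDimensional 𝕂 g]

/-- The Euler field, as an element of `g`. -/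
def eulerElt (hg : IsIFFT g) : g := ⟨euler, hg.euler_mem⟩

/-- The weights of `ad E` are -1, 0, 1, so `(ad E)²` is idempotent. In characteristic zero an
idempotent of trace zero vanishes, but this one is the identity on `𝔤₁ ≠ 0`. -/
lemma killingForm_euler_ne_zero (hg : IsIFFT g) :
    killingForm 𝕂 g hg.eulerElt hg.eulerElt ≠ 0 := by
  intro h
  have h1 : ∀ X : g, ∀ n, (X : PolyField 𝕂 d) ∈ homogeneousFields 𝕂 d n →
      ⁅hg.eulerElt, X⁆ = ((n : 𝕂) - 1) • X := fun X n hX => Subtype.ext (euler_lie hX)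
  let f : Module.End 𝕂 g := LieAlgebra.ad 𝕂 g hg.eulerElt ∘ₗ LieAlgebra.ad 𝕂 g hg.eulerElt
  have hf' : ∀ X, f X = ⁅hg.eulerElt, ⁅hg.eulerElt, X⁆⁆ := fun X => rfl
  have hf : ∀ X : g, ∀ n, (X : PolyField 𝕂 d) ∈ homogeneousFields 𝕂 d n →
      f X = ((n : 𝕂) - 1) ^ 2 • X := fun X n hX => by
    rw [hf', h1 X n hX, _root_.lie_smul, h1 X n hX, smul_smul, sq]
  have hid : IsIdempotentElem f := LinearMap.ext fun X => by
    rw [Module.End.mul_apply, hg.eq_add_part X]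
    have h0 := hf _ 0 (hg.part_mem 0 X)
    have h1 := hf _ 1 (hg.part_mem 1 X)
    have h2 := hf _ 2 (hg.part_mem 2 X)
    norm_num at h0 h1 h2
    simp only [map_add, h0, h1, h2, map_zero]
  have h0 : f = 0 := (LinearMap.IsIdempotentElem.trace_eq_zero_iff hid).1 h
  obtain ⟨Q, hQ, hQ0⟩ := (Submodule.ne_bot_iff _).1 hg.quadratic_ne_bot
  have h2 := hf ⟨Q, hQ.1⟩ 2 hQ.2
  norm_num at h2
  rw [h0, LinearMap.zero_apply] at h2
  exact hQ0 (congrArg Subtype.val h2.symm)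

lemma killingForm_euler_lie (hg : IsIFFT g) {X Y : g}
    (hX : (X : PolyField 𝕂 d) ∈ homogeneousFields 𝕂 d 1) :
    killingForm 𝕂 g hg.eulerElt ⁅X, Y⁆ = 0 := by
  rw [← LieModule.traceForm_apply_lie_apply]
  have : ⁅hg.eulerElt, X⁆ = 0 := Subtype.ext ((euler_lie hX).trans (by simp))
  rw [this, map_zero, LinearMap.zero_apply]

lemma killingForm_euler_ss (hg : IsIFFT g) (x : semisimplePart g) :
    killingForm 𝕂 g hg.eulerElt (ssIncl g x) = 0 := by
  have h : ssFields g ≤ (LinearMap.ker (killingForm 𝕂 g hg.eulerElt)).map g.toSubmodule.subtype := by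
    rw [ssFields, Submodule.span_le]
    rintro _ ⟨X, hX, Y, hY, rfl⟩
    exact ⟨⁅(⟨X, hX.1⟩ : g), ⟨Y, hY.1⟩⁆, hg.killingForm_euler_lie hX.2, rfl⟩
  obtain ⟨w, hw, hwx⟩ := h (coe_mem_ssFields x)
  have hwx' : w = ssIncl g x := Subtype.ext hwx
  rw [← hwx']
  exact hw

/-- `𝔤₀ = 𝕂 E + 𝔥₀`. -/
lemma mem_ssFields_sup (hg : IsIFFT g) (hs : ComplexifiedIsSimple g) {D : PolyField 𝕂 d}
    (hD : D ∈ linearPart g) : ∃ (c : 𝕂) (y : semisimplePart g), D = c • euler + y.1.1 := by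
  have h : D ∈ Submodule.span 𝕂 {euler} ⊔ ssFields g := by
    refine hg.mem_of_orthogonal _ (fun Z hZ1 hZ => ?_) hD
    have hE : killingForm 𝕂 g Z hg.eulerElt = 0 := hZ hg.eulerElt IFFTQuant.euler_mem
      (Submodule.mem_sup_left (Submodule.mem_span_singleton_self _))
    -- By invariance, a linear field orthogonal to `[𝔤₀, 𝔤₀]` is central in `𝔤₀`, hence a multiple
    -- of `E`; orthogonality to `E` then makes it zero.
    obtain ⟨c, hc⟩ := hg.central_eq_smul_euler hs (a := Z) ⟨Z.2, hZ1⟩ fun Y hY => by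
      have : ⁅Z, (⟨Y, hY.1⟩ : g)⁆ = 0 :=
        hg.eq_zero_of_killingForm_part (m := 1) (lie_mem_homogeneousFields hZ1 hY.2 rfl)
          fun W n hn hW => by
            obtain rfl : n = 1 := by omega
            rw [LieModule.traceForm_apply_lie_apply]
            exact hZ _ (lie_mem_homogeneousFields hY.2 hW rfl)
              (Submodule.mem_sup_right (lie_mem_ssFields hY ⟨W.2, hW⟩))
      exact congrArg Subtype.val this
    have hc' : Z = c • hg.eulerElt := Subtype.ext hc
    rw [hc', map_smul, LinearMap.smul_apply, smul_eq_mul] at hE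
    rw [hc', (mul_eq_zero.1 hE).resolve_right hg.killingForm_euler_ne_zero, zero_smul]
  obtain ⟨u, hu, w, hw, rfl⟩ := Submodule.mem_sup.1 h
  obtain ⟨c, rfl⟩ := Submodule.mem_span_singleton.1 hu
  obtain ⟨y, rfl⟩ := exists_coe_eq hw
  exact ⟨c, y, rfl⟩

/-- `𝔥₀` is orthogonal to `E` and `𝔤₀ = 𝕂E + 𝔥₀`, so an element of `𝔥₀` orthogonal to `𝔥₀` is
orthogonal to `𝔤₀`, with which the Killing form pairs it faithfully. -/
lemma ssForm_nondegenerate (hg : IsIFFT g) (hs : ComplexifiedIsSimple g) {x : semisimplePart g}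
    (hx : ∀ y, ssForm g y x = 0) : x = 0 := by
  have h : ssIncl g x = 0 := hg.eq_zero_of_killingForm_part (m := 1) x.1.2.2 fun Y n hn hY => by
    obtain rfl : n = 1 := by omega
    obtain ⟨c, y, hcy⟩ := hg.mem_ssFields_sup hs (D := Y) ⟨Y.2, hY⟩
    have : Y = c • hg.eulerElt + ssIncl g y := Subtype.ext hcy
    rw [killingForm_comm, this, map_add, map_smul, LinearMap.add_apply, LinearMap.smul_apply,
      hg.killingForm_euler_ss, smul_zero, zero_add]
    exact hx y
  exact Subtype.ext (Subtype.ext (congrArg (fun z : g => (z : PolyField 𝕂 d)) h))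

end IsIFFT

end IFFTQuant

end

/-! ### Dual bases of `𝔤` adapted to the grading -/

noncomputable section

namespace IFFTQuant

variable {𝕂 : Type*} [RCLike 𝕂] {d : ℕ}

open MvPolynomial (pderiv)
open PolyField Module

variable {g : LieSubalgebra 𝕂 (PolyField 𝕂 d)} [FiniteDimensional 𝕂 g]

namespace IsIFFT

/-- The constant field `∂ᵢ`, as an element of `g`. -/
def constElt (hg : IsIFFT g) (i : Fin d) : g := ⟨pderiv i, hg.pderiv_mem i⟩

lemma constElt_mem (hg : IsIFFT g) (i : Fin d) :
    (hg.constElt i : PolyField 𝕂 d) ∈ homogeneousFields 𝕂 d 0 := IFFTQuant.pderiv_mem i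

/-- The quadratic field which is dual to `∂ᵢ` for the Killing form. -/
def quadElt (hg : IsIFFT g) (i : Fin d) : g :=
  have := hg.isKilling
  (LinearMap.BilinForm.toDual (killingForm 𝕂 g)
    (LieAlgebra.IsKilling.killingForm_nondegenerate 𝕂 g)).symm
    { toFun := fun X => MvPolynomial.coeff 0 ((X : PolyField 𝕂 d) (.X i))
      map_add' := fun X Y => by simp
      map_smul' := fun c X => by simp }

lemma killingForm_quadElt (hg : IsIFFT g) (i : Fin d) (X : g) :
    killingForm 𝕂 g (hg.quadElt i) X = MvPolynomial.coeff 0 ((X : PolyField 𝕂 d) (.X i)) := by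
  have := hg.isKilling
  change LinearMap.BilinForm.toDual (killingForm 𝕂 g)
    (LieAlgebra.IsKilling.killingForm_nondegenerate 𝕂 g) (hg.quadElt i) X = _
  rw [quadElt, LinearEquiv.apply_symm_apply]
  rfl

/-- The functional it represents, the constant term of the `i`-th component, vanishes on fields of
positive degree; only the part dual to degree 0 survives. -/
lemma quadElt_mem (hg : IsIFFT g) (i : Fin d) :
    (hg.quadElt i : PolyField 𝕂 d) ∈ homogeneousFields 𝕂 d 2 := by
  have h : ∀ m n, m + n = 2 → n ≠ 0 → hg.part m (hg.quadElt i) = 0 := fun m n hmn hn =>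
    hg.eq_zero_of_killingForm_part (hg.part_mem m _) fun Y n' hn' hY => by
      rw [hg.killingForm_part _ hn' hY, hg.killingForm_quadElt]
      exact (hY i).coeff_eq_zero (by simpa using by omega)
  rw [hg.eq_add_part (hg.quadElt i), h 0 2 rfl (by norm_num), h 1 1 rfl (by norm_num), zero_add,
    zero_add]
  exact hg.part_mem 2 _

lemma part_zero_eq (hg : IsIFFT g) (X : g) :
    hg.part 0 X = ∑ i, MvPolynomial.coeff 0 ((X : PolyField 𝕂 d) (.X i)) • hg.constElt i := by
  refine Subtype.ext ((eq_sum_smul_pderiv (hg.part_mem 0 X)).trans ?_)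
  change _ = g.toSubmodule.subtype _
  rw [map_sum]
  refine Finset.sum_congr rfl fun i _ => ?_
  have : MvPolynomial.coeff 0 ((hg.part 0 X : PolyField 𝕂 d) (.X i))
      = MvPolynomial.coeff 0 ((X : PolyField 𝕂 d) (.X i)) := by
    change MvPolynomial.coeff 0 (homPart 0 (X : PolyField 𝕂 d) (.X i)) = _
    rw [homPart_apply, MvPolynomial.coeff_homogeneousComponent, if_pos (by simp)]
  rw [this]
  rfl

lemma part_two_eq (hg : IsIFFT g) (X : g) :
    hg.part 2 X = ∑ i, killingForm 𝕂 g (hg.constElt i) X • hg.quadElt i := by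
  rw [← sub_eq_zero]
  refine hg.eq_zero_of_killingForm_part (m := 2) ?_ fun Y n hn hY => ?_
  · refine (homogeneousFields 𝕂 d 2).sub_mem (hg.part_mem 2 X) ?_
    change g.toSubmodule.subtype _ ∈ _
    rw [map_sum]
    exact Submodule.sum_mem _ fun i _ => Submodule.smul_mem _ _ (hg.quadElt_mem i)
  · obtain rfl : n = 0 := by omega
    have hY0 : Y = ∑ i, MvPolynomial.coeff 0 ((Y : PolyField 𝕂 d) (.X i)) • hg.constElt i := by
      rw [← hg.part_zero_eq]
      refine Subtype.ext ?_
      change _ = homPart 0 (Y : PolyField 𝕂 d)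
      rw [homPart_of_mem hY, if_pos rfl]
    rw [map_sub, LinearMap.sub_apply, hg.killingForm_part X rfl hY, map_sum, LinearMap.sum_apply]
    simp only [map_smul, LinearMap.smul_apply, hg.killingForm_quadElt]
    conv_lhs => enter [1]; rw [hY0]
    simp only [map_sum, map_smul, smul_eq_mul]
    rw [sub_eq_zero]
    refine Finset.sum_congr rfl fun i _ => ?_
    rw [killingForm_comm, mul_comm]

variable (hg : IsIFFT g) (hs : ComplexifiedIsSimple g)

/-- A basis of `𝔥₀`. -/
abbrev ssBasis (g : LieSubalgebra 𝕂 (PolyField 𝕂 d)) [FiniteDimensional 𝕂 g] :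
    Basis (Fin (finrank 𝕂 (semisimplePart g))) 𝕂 (semisimplePart g) := finBasis 𝕂 _

/-- The diagonal values are recorded separately because `exists_hasEigenvalue_casimir` takes its
normalisation from them. -/
lemma exists_ssDual (hg : IsIFFT g) (hs : ComplexifiedIsSimple g) :
    ∃ h' : Fin (finrank 𝕂 (semisimplePart g)) → semisimplePart g,
      (∀ i, ssForm g (ssBasis g i) (h' i) = 1) ∧ IsDualPair (ssForm g) (ssBasis g) h' := by
  have hsymm : (ssForm g).IsSymm := ⟨ssForm_comm⟩
  have hnd : (ssForm g).Nondegenerate :=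
    ⟨fun x hx => hg.ssForm_nondegenerate hs fun y => by rw [ssForm_comm]; exact hx y,
      fun x hx => hg.ssForm_nondegenerate hs hx⟩
  have h1 : ∀ i, ssForm g (ssBasis g i) ((ssForm g).dualBasis hnd (ssBasis g) i) = 1 := fun i => by
    rw [LinearMap.BilinForm.apply_dualBasis_right hnd hsymm, if_pos rfl]
  refine ⟨(ssForm g).dualBasis hnd (ssBasis g), h1,
    .of_basis _ _ (fun x hx => hg.ssForm_nondegenerate hs hx) h1 fun i j hij => ?_⟩
  rw [LinearMap.BilinForm.apply_dualBasis_right hnd hsymm, if_neg hij]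

/-- The basis of `𝔥₀` which is dual to `ssBasis` for the Killing form of `g`. -/
def ssDual (hg : IsIFFT g) (hs : ComplexifiedIsSimple g) :
    Fin (finrank 𝕂 (semisimplePart g)) → semisimplePart g := (hg.exists_ssDual hs).choose

lemma ssForm_ssDual (i) : ssForm g (ssBasis g i) (hg.ssDual hs i) = 1 :=
  (hg.exists_ssDual hs).choose_spec.1 i

lemma isDualPair_ssDual : IsDualPair (ssForm g) (ssBasis g) (hg.ssDual hs) :=
  (hg.exists_ssDual hs).choose_spec.2

/-- A basis of `g` adapted to its grading. -/
def adapted : Fin d ⊕ Fin d ⊕ Unit ⊕ Fin (finrank 𝕂 (semisimplePart g)) → g :=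
  Sum.elim hg.constElt (Sum.elim hg.quadElt
    (Sum.elim (fun _ => hg.eulerElt) fun i => ssIncl g (ssBasis g i)))

/-- The basis of `g` which is dual to `adapted`. -/
def adaptedDual : Fin d ⊕ Fin d ⊕ Unit ⊕ Fin (finrank 𝕂 (semisimplePart g)) → g :=
  Sum.elim hg.quadElt (Sum.elim hg.constElt
    (Sum.elim (fun _ => (killingForm 𝕂 g hg.eulerElt hg.eulerElt)⁻¹ • hg.eulerElt)
      fun i => ssIncl g (hg.ssDual hs i)))

lemma sum_adapted {N : Type*} [AddCommGroup N] (Φ : g → g → N) :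
    ∑ j, Φ (hg.adapted j) (hg.adaptedDual hs j)
      = ∑ i, Φ (hg.constElt i) (hg.quadElt i) + (∑ i, Φ (hg.quadElt i) (hg.constElt i)
        + (Φ hg.eulerElt ((killingForm 𝕂 g hg.eulerElt hg.eulerElt)⁻¹ • hg.eulerElt)
          + ∑ i, Φ (ssIncl g (ssBasis g i)) (ssIncl g (hg.ssDual hs i)))) := by
  simp only [Fintype.sum_sum_type, adapted, adaptedDual, Sum.elim_inl, Sum.elim_inr,
    Finset.univ_unique, Finset.sum_singleton]

lemma part_one_eq (hg : IsIFFT g) (hs : ComplexifiedIsSimple g) (X : g) :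
    ∃ (c : 𝕂) (y : semisimplePart g), hg.part 1 X = c • hg.eulerElt + ssIncl g y ∧
      killingForm 𝕂 g hg.eulerElt X = c * killingForm 𝕂 g hg.eulerElt hg.eulerElt ∧
      ∀ x, killingForm 𝕂 g (ssIncl g x) X = ssForm g x y := by
  obtain ⟨c, y, hcy⟩ := hg.mem_ssFields_sup hs (D := hg.part 1 X) ⟨(hg.part 1 X).2, hg.part_mem 1 X⟩
  have h : hg.part 1 X = c • hg.eulerElt + ssIncl g y := Subtype.ext hcy
  refine ⟨c, y, h, ?_, fun x => ?_⟩
  · rw [killingForm_comm, ← hg.killingForm_part X (m := 1) rfl IFFTQuant.euler_mem, h, killingForm_comm,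
      map_add, map_smul, hg.killingForm_euler_ss, add_zero, smul_eq_mul]
  · rw [killingForm_comm, ← hg.killingForm_part X (m := 1) rfl (x.1.2.2 : (ssIncl g x : PolyField 𝕂 d) ∈ _),
      h, map_add, map_smul, LinearMap.add_apply, LinearMap.smul_apply, hg.killingForm_euler_ss,
      smul_zero, zero_add, ssForm_comm]
    rfl

/-- The pairing `𝔤₋₁ × 𝔤₁` and the orthogonal splitting of `𝔤₀` give the expansion degree by degree.
In every pair at least one member is constant or linear, which matters because `γ` vanishes on such
fields. -/
lemma isDualPair_adapted : IsDualPair (killingForm 𝕂 g) hg.adapted (hg.adaptedDual hs) := by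
  have hE := hg.killingForm_euler_ne_zero
  refine ⟨fun X => ?_, fun X => ?_⟩
  · obtain ⟨c, y, h1, h2, h3⟩ := hg.part_one_eq hs X
    rw [hg.sum_adapted hs fun u v => killingForm 𝕂 g X v • u]
    conv_rhs => rw [hg.eq_add_part X, hg.part_zero_eq, hg.part_two_eq, h1,
      ← (hg.isDualPair_ssDual hs).left y, map_sum]
    simp only [map_smul, LinearMap.smul_apply, smul_eq_mul, killingForm_comm X, h2, h3, hg.killingForm_quadElt,
      ssForm_comm y]
    rw [mul_comm c, inv_mul_cancel_left₀ hE]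
    abel
  · obtain ⟨c, y, h1, h2, h3⟩ := hg.part_one_eq hs X
    rw [hg.sum_adapted hs fun u v => killingForm 𝕂 g u X • v]
    conv_rhs => rw [hg.eq_add_part X, hg.part_zero_eq, hg.part_two_eq, h1,
      ← (hg.isDualPair_ssDual hs).right y, map_sum]
    simp only [map_smul, h2, h3, hg.killingForm_quadElt, smul_smul]
    rw [mul_inv_cancel_right₀ hE]
    abel

/-- The truncated bracket `Φ` is `𝔤₀`-equivariant and picks out the constant-quadratic terms of the
invariant tensor. The sum therefore commutes with `𝔤₀`, whose centre is spanned by `E`. -/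
lemma sum_const_quad (hg : IsIFFT g) (hs : ComplexifiedIsSimple g) :
    ∃ z : 𝕂, ∑ i, ⁅hg.constElt i, hg.quadElt i⁆ = z • hg.eulerElt := by
  let Φ : g →ₗ[𝕂] g →ₗ[𝕂] PolyField 𝕂 d := LinearMap.mk₂ 𝕂
    (fun X Y => ⁅homPart 0 (X : PolyField 𝕂 d), homPart 2 (Y : PolyField 𝕂 d)⁆)
    (fun X X' Y => by
      change ⁅homPart 0 ((X : PolyField 𝕂 d) + (X' : PolyField 𝕂 d)), _⁆ = _
      rw [map_add, PolyField.add_lie])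
    (fun c X Y => by
      change ⁅homPart 0 (c • (X : PolyField 𝕂 d)), _⁆ = _
      rw [map_smul, PolyField.smul_lie])
    (fun X Y Y' => by
      change ⁅_, homPart 2 ((Y : PolyField 𝕂 d) + (Y' : PolyField 𝕂 d))⁆ = _
      rw [map_add, PolyField.lie_add])
    (fun c X Y => by
      change ⁅_, homPart 2 (c • (Y : PolyField 𝕂 d))⁆ = _
      rw [map_smul, PolyField.lie_smul])
  have hΦ : ∀ X Y : g, Φ X Y = ⁅homPart 0 (X : PolyField 𝕂 d), homPart 2 (Y : PolyField 𝕂 d)⁆ :=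
    fun X Y => rfl
  have hΦ0 : ∀ (X Y : g) n, n ≠ 0 → (X : PolyField 𝕂 d) ∈ homogeneousFields 𝕂 d n → Φ X Y = 0 :=
    fun X Y n hn hX => by
      rw [hΦ, homPart_of_mem hX, if_neg (Ne.symm hn)]
      exact _root_.zero_lie (homPart 2 (Y : PolyField 𝕂 d))
  have hsum : ∑ j, Φ (hg.adapted j) (hg.adaptedDual hs j)
      = ((∑ i, ⁅hg.constElt i, hg.quadElt i⁆ : g) : PolyField 𝕂 d) := by
    rw [hg.sum_adapted hs fun X Y => Φ X Y]
    rw [hΦ0 _ _ 1 one_ne_zero IFFTQuant.euler_mem,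
      Finset.sum_eq_zero fun i _ => hΦ0 _ _ 1 one_ne_zero (ssBasis g i).1.2.2,
      Finset.sum_eq_zero fun i _ => hΦ0 (hg.quadElt i) _ 2 two_ne_zero (hg.quadElt_mem i),
      add_zero, add_zero, add_zero]
    change _ = g.toSubmodule.subtype _
    rw [map_sum]
    refine Finset.sum_congr rfl fun i _ => ?_
    rw [hΦ, homPart_of_mem (hg.constElt_mem i),
      homPart_of_mem (hg.quadElt_mem i), if_pos rfl, if_pos rfl]
    rfl
  have hmem : (∑ i, ⁅hg.constElt i, hg.quadElt i⁆ : g).1 ∈ homogeneousFields 𝕂 d 1 := by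
    change g.toSubmodule.subtype _ ∈ _
    rw [map_sum]
    exact Submodule.sum_mem _ fun i _ =>
      lie_mem_homogeneousFields (IFFTQuant.pderiv_mem i) (hg.quadElt_mem i) rfl
  obtain ⟨z, hz⟩ := hg.central_eq_smul_euler hs
    (a := (∑ i, ⁅hg.constElt i, hg.quadElt i⁆ : g)) ⟨Subtype.prop _, hmem⟩ fun D hD => by
      have h := (hg.isDualPair_adapted hs).sum_skew (T := LieAlgebra.ad 𝕂 g ⟨D, hD.1⟩)
        (fun x y => LieModule.traceForm_apply_lie_apply' 𝕂 g g _ x y) Φ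
      have hD' : ∀ X Y : g, Φ (LieAlgebra.ad 𝕂 g ⟨D, hD.1⟩ X) Y
          + Φ X (LieAlgebra.ad 𝕂 g ⟨D, hD.1⟩ Y) = ⁅D, Φ X Y⁆ := fun X Y => by
        rw [hΦ, hΦ, hΦ, PolyField.leibniz_lie, ← homPart_lie hD.2, ← homPart_lie hD.2]
        rfl
      rw [← Finset.sum_add_distrib, Finset.sum_congr rfl fun j _ => hD' _ _,
        ← PolyField.lie_sum, hsum] at h
      rw [PolyField.lie_skew, h, neg_zero]
  exact ⟨z, Subtype.ext hz⟩

end IsIFFT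

/-- The Casimir operator may be computed with any pair of dual families. -/
lemma casimir_eq_sum [LieAlgebra.IsKilling 𝕂 g] {M ι : Type*} [AddCommGroup M] [Module 𝕂 M]
    [Fintype ι] {ρ : PolyField 𝕂 d → Module.End 𝕂 M} (hadd : ∀ X Y, ρ (X + Y) = ρ X + ρ Y)
    (hsmul : ∀ (c : 𝕂) X, ρ (c • X) = c • ρ X) {b b' : ι → g}
    (h : IsDualPair (killingForm 𝕂 g) b b') :
    casimir g ρ = ∑ i, ρ (b i) * ρ (b' i) := by
  let Φ : g →ₗ[𝕂] g →ₗ[𝕂] Module.End 𝕂 M := LinearMap.mk₂ 𝕂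
    (fun X Y => ρ X * ρ Y)
    (fun X X' Y => by rw [← add_mul, ← hadd]; rfl)
    (fun c X Y => by rw [← smul_mul_assoc, ← hsmul]; rfl)
    (fun X Y Y' => by rw [← mul_add, ← hadd]; rfl)
    (fun c X Y => by rw [← mul_smul_comm, ← hsmul]; rfl)
  exact (isDualPair_killingDual (finBasis 𝕂 g)).sum_eq h Φ

end IFFTQuant

end

noncomputable section

namespace IFFTQuant

variable {𝕂 : Type*} [RCLike 𝕂] {d : ℕ}

open MvPolynomial (pderiv)

/-! ### Lie derivatives of functions and densities -/

/-- The polynomial functions. -/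
abbrev polyFun : MvPolynomial (Fin d) 𝕂 →ₐ[𝕂] Smooth 𝕂 d := MvPolynomial.aeval coord

lemma component_eq (X : PolyField 𝕂 d) (i : Fin d) : component X i = polyFun (X (.X i)) := rfl

lemma pd_algebraMap (i : Fin d) (c : 𝕂) : pd i (algebraMap 𝕂 (Smooth 𝕂 d) c) = 0 := by
  have h : pd i (1 : Smooth 𝕂 d) = 0 := by simpa using pd_mul i (1 : Smooth 𝕂 d) 1
  rw [Algebra.algebraMap_eq_smul_one, map_smul, h, smul_zero]

lemma pd_polyFun (i : Fin d) (p : MvPolynomial (Fin d) 𝕂) :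
    pd i (polyFun p) = polyFun (pderiv i p) := by
  induction p using MvPolynomial.induction_on with
  | C c => rw [MvPolynomial.pderiv_C, map_zero, MvPolynomial.aeval_C, pd_algebraMap]
  | add p q hp hq => rw [map_add, map_add, hp, hq, map_add, map_add]
  | mul_X p j hp =>
    rw [map_mul, pd_mul, hp, MvPolynomial.pderiv_mul, map_add, map_mul, map_mul,
      MvPolynomial.aeval_X, pd_coord, MvPolynomial.pderiv_X, Pi.single_apply, add_comm]
    congr 2
    by_cases h : i = j
    · subst h; simp
    · rw [if_neg h, if_neg (Ne.symm h), map_zero]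

/-- The action of a polynomial vector field on functions. -/
def vecOp (X : PolyField 𝕂 d) : Module.End 𝕂 (Smooth 𝕂 d) := ∑ i, mulOp (component X i) * pd i

lemma vecOp_apply (X : PolyField 𝕂 d) (f : Smooth 𝕂 d) :
    vecOp X f = ∑ i, component X i * pd i f := by
  simp [vecOp, LinearMap.sum_apply, Module.End.mul_apply]

lemma vecOp_mul (X : PolyField 𝕂 d) (f g : Smooth 𝕂 d) :
    vecOp X (f * g) = f * vecOp X g + vecOp X f * g := by
  simp only [vecOp_apply, pd_mul, Finset.mul_sum, Finset.sum_mul, ← Finset.sum_add_distrib]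
  exact Finset.sum_congr rfl fun i _ => by ring

lemma vecOp_polyFun (X : PolyField 𝕂 d) (p : MvPolynomial (Fin d) 𝕂) :
    vecOp X (polyFun p) = polyFun (X p) := by
  rw [vecOp_apply, PolyField.apply_eq X p, map_sum]
  exact Finset.sum_congr rfl fun i _ => by rw [map_mul, pd_polyFun, component_eq]

lemma component_lie (X Y : PolyField 𝕂 d) (i : Fin d) :
    component ⁅X, Y⁆ i = vecOp X (component Y i) - vecOp Y (component X i) := by
  rw [component_eq, component_eq, component_eq, vecOp_polyFun, vecOp_polyFun, ← map_sub,
    Derivation.commutator_apply]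

lemma pd_vecOp (j : Fin d) (X : PolyField 𝕂 d) (f : Smooth 𝕂 d) :
    pd j (vecOp X f) = vecOp X (pd j f) + ∑ i, pd j (component X i) * pd i f := by
  simp only [vecOp_apply, map_sum, pd_mul, Finset.sum_add_distrib]
  congr 1
  exact Finset.sum_congr rfl fun i _ => by
    rw [show pd j (pd i f) = pd i (pd j f) from LinearMap.congr_fun (pd_comm j i).eq f]

lemma vecOp_lie (X Y : PolyField 𝕂 d) (f : Smooth 𝕂 d) :
    vecOp ⁅X, Y⁆ f = vecOp X (vecOp Y f) - vecOp Y (vecOp X f) := by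
  have h : ∀ X Y : PolyField 𝕂 d, vecOp X (vecOp Y f)
      = ∑ i, vecOp X (component Y i) * pd i f
        + ∑ i, ∑ j, component Y i * component X j * pd j (pd i f) := fun X Y => by
    rw [vecOp_apply Y, map_sum, ← Finset.sum_add_distrib]
    refine Finset.sum_congr rfl fun i _ => ?_
    rw [vecOp_mul, add_comm, vecOp_apply X (pd i f), Finset.mul_sum]
    simp only [mul_assoc]
  rw [h X Y, h Y X, vecOp_apply]
  -- The second-order terms are symmetric in `X` and `Y` and cancel in the commutator.
  have h2 : ∑ i, ∑ j, component Y i * component X j * pd j (pd i f)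
      = ∑ i, ∑ j, component X i * component Y j * pd j (pd i f) := by
    rw [Finset.sum_comm]
    refine Finset.sum_congr rfl fun i _ => Finset.sum_congr rfl fun j _ => ?_
    rw [show pd i (pd j f) = pd j (pd i f) from LinearMap.congr_fun (pd_comm i j).eq f,
      mul_comm (component Y j)]
  rw [h2, add_sub_add_right_eq_sub, ← Finset.sum_sub_distrib]
  exact Finset.sum_congr rfl fun i _ => by rw [component_lie, sub_mul]

lemma divergence_lie (X Y : PolyField 𝕂 d) :
    divergence ⁅X, Y⁆ = vecOp X (divergence Y) - vecOp Y (divergence X) := by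
  simp only [divergence, component_lie, map_sub, pd_vecOp, map_sum, Finset.sum_sub_distrib,
    Finset.sum_add_distrib]
  -- The trace of the product of the two Jacobian matrices is symmetric in `X` and `Y`.
  have : ∑ i, ∑ j, pd i (component X j) * pd j (component Y i)
      = ∑ i, ∑ j, pd i (component Y j) * pd j (component X i) := by
    rw [Finset.sum_comm]
    exact Finset.sum_congr rfl fun i _ => Finset.sum_congr rfl fun j _ => mul_comm _ _
  rw [this]
  abel

lemma divergence_add (X Y : PolyField 𝕂 d) :
    divergence (X + Y) = divergence X + divergence Y := by
  simp [divergence, component_add, Finset.sum_add_distrib]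

lemma divergence_smul (c : 𝕂) (X : PolyField 𝕂 d) : divergence (c • X) = c • divergence X := by
  simp [divergence, component_smul, Finset.smul_sum]

lemma lieDensity_apply (w : 𝕂) (X : PolyField 𝕂 d) (f : Smooth 𝕂 d) :
    lieDensity w X f = vecOp X f + w • divergence X * f := by
  rw [lieDensity, ← vecOp]
  rfl

lemma lieDensity_add (w : 𝕂) (X Y : PolyField 𝕂 d) :
    lieDensity w (X + Y) = lieDensity w X + lieDensity w Y := LinearMap.ext fun f => by
  simp only [lieDensity_apply, LinearMap.add_apply, vecOp_apply, component_add, divergence_add,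
    add_mul, smul_add, Finset.sum_add_distrib]
  abel

lemma lieDensity_smul (w c : 𝕂) (X : PolyField 𝕂 d) :
    lieDensity w (c • X) = c • lieDensity w X := LinearMap.ext fun f => by
  simp only [lieDensity_apply, LinearMap.smul_apply, vecOp_apply, component_smul, divergence_smul,
    smul_mul_assoc, smul_add, Finset.smul_sum]
  rw [smul_comm]

lemma lieDensity_lie (w : 𝕂) (X Y : PolyField 𝕂 d) :
    lieDensity w ⁅X, Y⁆ = lieDensity w X * lieDensity w Y - lieDensity w Y * lieDensity w X :=
  LinearMap.ext fun f => by
    simp only [LinearMap.sub_apply, Module.End.mul_apply, lieDensity_apply, vecOp_lie,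
      divergence_lie, map_add, vecOp_mul, map_smul, smul_sub]
    ring

lemma lieDensity_mul_mulOp (w : 𝕂) (X : PolyField 𝕂 d) (f : Smooth 𝕂 d) :
    lieDensity w X * mulOp f = mulOp f * lieDensity w X + mulOp (vecOp X f) :=
  LinearMap.ext fun g => by
    simp only [Module.End.mul_apply, LinearMap.add_apply, lieDensity_apply,
      LinearMap.mulLeft_apply, vecOp_mul]
    ring

lemma component_pderiv (i j : Fin d) :
    component (pderiv i : PolyField 𝕂 d) j = if i = j then 1 else 0 := by
  rw [component_eq, MvPolynomial.pderiv_X, Pi.single_apply]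
  by_cases h : i = j
  · subst h; simp
  · rw [if_neg h, if_neg (Ne.symm h), map_zero]

lemma vecOp_pderiv (i : Fin d) : vecOp (pderiv i : PolyField 𝕂 d) = pd i :=
  LinearMap.ext fun f => by simp [vecOp_apply, component_pderiv]

lemma divergence_pderiv (i : Fin d) : divergence (pderiv i : PolyField 𝕂 d) = 0 := by
  refine Finset.sum_eq_zero fun j _ => ?_
  rw [component_pderiv]
  split_ifs
  · simpa using pd_algebraMap j (1 : 𝕂)
  · exact map_zero _

lemma lieDensity_pderiv (w : 𝕂) (i : Fin d) : lieDensity w (pderiv i) = pd i :=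
  LinearMap.ext fun f => by
    rw [lieDensity_apply, vecOp_pderiv, divergence_pderiv, smul_zero, zero_mul, add_zero]

lemma component_pderiv_lie (i j : Fin d) (X : PolyField 𝕂 d) :
    component ⁅(pderiv j : PolyField 𝕂 d), X⁆ i = pd j (component X i) := by
  rw [component_eq, PolyField.pderiv_lie_apply, component_eq, pd_polyFun]

/-! ### Lie derivatives of differential operators -/

lemma normalOrder_lieOpSymb (lam mu : 𝕂) (X : PolyField 𝕂 d) (P : Symb 𝕂 d) :
    normalOrder (lieOpSymb lam mu X P)
      = lieDensity mu X * normalOrder P - normalOrder P * lieDensity lam X := by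
  have h : ∀ D : DiffOp 𝕂 d, normalOrder (totalSymbol D) = D.1 := fun D =>
    congrArg Subtype.val
      ((LinearEquiv.ofInjective normalOrder normalOrder_injective).apply_symm_apply D)
  have h2 : lieOpSymb lam mu X P = totalSymbol (lieOp lam mu X (totalSymbol.symm P)) := rfl
  rw [h2, h]
  rfl

lemma lieOpSymb_add (lam mu : 𝕂) (X Y : PolyField 𝕂 d) :
    lieOpSymb lam mu (X + Y) = lieOpSymb lam mu X + lieOpSymb lam mu Y :=
  LinearMap.ext fun P => normalOrder_injective <| by
    simp only [LinearMap.add_apply, map_add, normalOrder_lieOpSymb, lieDensity_add, add_mul,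
      mul_add]
    abel

lemma lieOpSymb_smul (lam mu c : 𝕂) (X : PolyField 𝕂 d) :
    lieOpSymb lam mu (c • X) = c • lieOpSymb lam mu X :=
  LinearMap.ext fun P => normalOrder_injective <| by
    simp only [LinearMap.smul_apply, map_smul, normalOrder_lieOpSymb, lieDensity_smul,
      smul_mul_assoc, mul_smul_comm, smul_sub]

lemma lieOpSymb_lie (lam mu : 𝕂) (X Y : PolyField 𝕂 d) :
    lieOpSymb lam mu ⁅X, Y⁆
      = lieOpSymb lam mu X * lieOpSymb lam mu Y - lieOpSymb lam mu Y * lieOpSymb lam mu X :=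
  LinearMap.ext fun P => normalOrder_injective <| by
    simp only [LinearMap.sub_apply, Module.End.mul_apply, map_sub, normalOrder_lieOpSymb,
      lieDensity_lie, sub_mul, mul_sub, mul_assoc]
    abel

/-- This is the same Leibniz rule as for `lieSymb`, so the difference `γ` will be linear over the
smooth functions. -/
lemma lieOpSymb_C_mul (lam mu : 𝕂) (X : PolyField 𝕂 d) (f : Smooth 𝕂 d) (P : Symb 𝕂 d) :
    lieOpSymb lam mu X (MvPolynomial.C f * P)
      = MvPolynomial.C f * lieOpSymb lam mu X P + MvPolynomial.C (vecOp X f) * P :=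
  normalOrder_injective <| by
    simp only [map_add, normalOrder_lieOpSymb, normalOrder_C_mul, mul_sub]
    rw [← mul_assoc, lieDensity_mul_mulOp, add_mul, mul_assoc, mul_assoc]
    abel

/-- As `∂ⱼ` is its own Lie derivative on densities, moving it past `L^λ_X` costs `L^λ` of `[∂ⱼ, X]`.
This gives a recursion on the degree in `ξ`. -/
lemma normalOrder_lieOpSymb_mul_X (lam mu : 𝕂) (X : PolyField 𝕂 d) (P : Symb 𝕂 d) (j : Fin d) :
    normalOrder (lieOpSymb lam mu X (P * MvPolynomial.X j))
      = normalOrder (lieOpSymb lam mu X P * MvPolynomial.X j)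
        - normalOrder P * lieDensity lam ⁅(pderiv j : PolyField 𝕂 d), X⁆ := by
  rw [normalOrder_lieOpSymb, normalOrder_mul_X, normalOrder_mul_X, normalOrder_lieOpSymb,
    lieDensity_lie, lieDensity_pderiv]
  simp only [sub_mul, mul_sub, mul_assoc]
  abel

end IFFTQuant

end

noncomputable section

namespace IFFTQuant

variable {𝕂 : Type*} [RCLike 𝕂] {d : ℕ}

open MvPolynomial (pderiv)

/-! ### Lie derivatives of symbols -/

lemma coeffDeriv_mul (i : Fin d) (P Q : Symb 𝕂 d) :
    coeffDeriv i (P * Q) = P * coeffDeriv i Q + coeffDeriv i P * Q := by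
  induction P using MvPolynomial.induction_on' with
  | monomial α a =>
    induction Q using MvPolynomial.induction_on' with
    | monomial β b =>
      simp only [MvPolynomial.monomial_mul, coeffDeriv_monomial, pd_mul, map_add]
    | add p q hp hq => simp only [mul_add, map_add, hp, hq]; ring
  | add p q hp hq => simp only [add_mul, map_add, hp, hq]; ring

lemma coeffDeriv_C (i : Fin d) (f : Smooth 𝕂 d) :
    coeffDeriv i (.C f : Symb 𝕂 d) = .C (pd i f) := coeffDeriv_monomial i 0 f

lemma coeffDeriv_X (i j : Fin d) : coeffDeriv i (.X j : Symb 𝕂 d) = 0 := by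
  have h : pd i (1 : Smooth 𝕂 d) = 0 := by simpa using pd_mul i (1 : Smooth 𝕂 d) 1
  rw [MvPolynomial.X, coeffDeriv_monomial, h, map_zero]

lemma lieSymb_apply (del : 𝕂) (X : PolyField 𝕂 d) (P : Symb 𝕂 d) :
    lieSymb del X P = ∑ i, .C (component X i) * coeffDeriv i P
      - ∑ i, ∑ j, .C (pd j (component X i)) * .X i * pderiv j P
      + .C (del • divergence X) * P := rfl

/-- The Lie derivative of symbols of weight `0`, a derivation. -/
def symDer (X : PolyField 𝕂 d) : Derivation 𝕂 (Symb 𝕂 d) (Symb 𝕂 d) :=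
  Derivation.mk' (lieSymb 0 X) fun P Q => by
    simp only [lieSymb_apply, coeffDeriv_mul, MvPolynomial.pderiv_mul, mul_add, smul_eq_mul,
      Finset.sum_add_distrib, zero_smul, map_zero, zero_mul, add_zero, mul_sub, Finset.mul_sum]
    rw [← sub_eq_zero]
    have h1 : ∀ P Q : Symb 𝕂 d, ∑ i, P * (.C (component X i) * coeffDeriv i Q)
        = ∑ i, .C (component X i) * (P * coeffDeriv i Q) :=
      fun P Q => Finset.sum_congr rfl fun i _ => by ring
    have h2 : ∀ P Q : Symb 𝕂 d,
        ∑ i, ∑ j, P * (.C (pd j (component X i)) * .X i * pderiv j Q)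
          = ∑ i, ∑ j, .C (pd j (component X i)) * .X i * (P * pderiv j Q) :=
      fun P Q => Finset.sum_congr rfl fun i _ => Finset.sum_congr rfl fun j _ => by ring
    rw [h1, h1, h2, h2]
    simp only [mul_comm (coeffDeriv _ P), mul_comm (pderiv _ P)]
    ring

lemma lieSymb_eq (del : 𝕂) (X : PolyField 𝕂 d) (P : Symb 𝕂 d) :
    lieSymb del X P = symDer X P + .C (del • divergence X) * P := by
  change _ = lieSymb 0 X P + _
  simp [lieSymb_apply]

lemma symDer_C (X : PolyField 𝕂 d) (f : Smooth 𝕂 d) : symDer X (.C f) = .C (vecOp X f) := by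
  change lieSymb 0 X (.C f) = _
  simp [lieSymb_apply, coeffDeriv_C, vecOp_apply]

lemma symDer_X (X : PolyField 𝕂 d) (j : Fin d) :
    symDer X (.X j) = -∑ i, .C (pd j (component X i)) * .X i := by
  change lieSymb 0 X (.X j) = _
  simp [lieSymb_apply, coeffDeriv_X, MvPolynomial.pderiv_X, Pi.single_apply]

lemma symDer_C_mul (X : PolyField 𝕂 d) (f : Smooth 𝕂 d) (P : Symb 𝕂 d) :
    symDer X (.C f * P) = .C f * symDer X P + .C (vecOp X f) * P := by
  rw [Derivation.leibniz, symDer_C, smul_eq_mul, smul_eq_mul, mul_comm P]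

lemma lieSymb_C_mul (del : 𝕂) (X : PolyField 𝕂 d) (f : Smooth 𝕂 d) (P : Symb 𝕂 d) :
    lieSymb del X (.C f * P) = .C f * lieSymb del X P + .C (vecOp X f) * P := by
  rw [lieSymb_eq, lieSymb_eq, symDer_C_mul]
  ring

lemma lieSymb_add (del : 𝕂) (X Y : PolyField 𝕂 d) :
    lieSymb del (X + Y) = lieSymb del X + lieSymb del Y := LinearMap.ext fun P => by
  simp only [lieSymb_apply, LinearMap.add_apply, component_add, divergence_add, map_add, add_mul,
    smul_add, Finset.sum_add_distrib]
  ring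

lemma C_smul (c : 𝕂) (f : Smooth 𝕂 d) : (.C (c • f) : Symb 𝕂 d) = c • .C f := by
  rw [Algebra.smul_def, map_mul, Algebra.smul_def]
  rfl

lemma lieSymb_smul (del c : 𝕂) (X : PolyField 𝕂 d) :
    lieSymb del (c • X) = c • lieSymb del X := LinearMap.ext fun P => by
  simp only [lieSymb_apply, LinearMap.smul_apply, component_smul, divergence_smul, map_smul,
    smul_comm del c, C_smul, smul_mul_assoc, smul_sub, smul_add, Finset.smul_sum]

lemma symDer_symDer_X (X Y : PolyField 𝕂 d) (j : Fin d) :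
    symDer X (symDer Y (.X j : Symb 𝕂 d))
      = ∑ i, .C ((∑ k, pd j (component Y k) * pd k (component X i))
        - vecOp X (pd j (component Y i))) * .X i := by
  rw [symDer_X, map_neg, map_sum]
  simp only [symDer_C_mul, symDer_X, Finset.sum_add_distrib, mul_neg, Finset.mul_sum,
    Finset.sum_neg_distrib, map_sub, map_sum, sub_mul, Finset.sum_sub_distrib, Finset.sum_mul]
  rw [neg_add, neg_neg, ← sub_eq_add_neg]
  congr 1
  rw [Finset.sum_comm]
  simp only [map_mul, mul_assoc]

lemma symDer_lie_X (X Y : PolyField 𝕂 d) (j : Fin d) :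
    symDer ⁅X, Y⁆ (.X j : Symb 𝕂 d)
      = symDer X (symDer Y (.X j)) - symDer Y (symDer X (.X j)) := by
  rw [symDer_symDer_X, symDer_symDer_X, symDer_X, ← Finset.sum_sub_distrib,
    ← Finset.sum_neg_distrib]
  refine Finset.sum_congr rfl fun i _ => ?_
  rw [component_lie, LinearMap.map_sub, pd_vecOp, pd_vecOp, ← sub_mul, ← neg_mul, ← map_sub,
    ← map_neg]
  congr 2
  ring

lemma symDer_lie (X Y : PolyField 𝕂 d) (P : Symb 𝕂 d) :
    symDer ⁅X, Y⁆ P = symDer X (symDer Y P) - symDer Y (symDer X P) := by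
  induction P using MvPolynomial.induction_on with
  | C f => rw [symDer_C, symDer_C, symDer_C, symDer_C, symDer_C, vecOp_lie, map_sub]
  | add p q hp hq =>
    rw [map_add, hp, hq, map_add, map_add, map_add, map_add]
    abel
  | mul_X p j hp =>
    rw [Derivation.leibniz, symDer_lie_X, hp, Derivation.leibniz, Derivation.leibniz]
    simp only [smul_eq_mul]
    rw [map_add, map_add, Derivation.leibniz, Derivation.leibniz, Derivation.leibniz,
      Derivation.leibniz]
    simp only [smul_eq_mul]
    ring

lemma lieSymb_lie (del : 𝕂) (X Y : PolyField 𝕂 d) :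
    lieSymb del ⁅X, Y⁆ = lieSymb del X * lieSymb del Y - lieSymb del Y * lieSymb del X :=
  LinearMap.ext fun P => by
    rw [LinearMap.sub_apply, Module.End.mul_apply, Module.End.mul_apply, lieSymb_eq, lieSymb_eq,
      lieSymb_eq, lieSymb_eq, lieSymb_eq, symDer_lie, map_add, map_add, symDer_C_mul,
      symDer_C_mul, divergence_lie, smul_sub, map_sub,
      (vecOp X).map_smul, (vecOp Y).map_smul]
    ring

lemma lieSymb_pderiv (del : 𝕂) (i : Fin d) : lieSymb del (pderiv i) = coeffDeriv i :=
  LinearMap.ext fun P => by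
    have h : ∀ c : 𝕂, ∀ j, pd j (algebraMap 𝕂 (Smooth 𝕂 d) c) = 0 := fun c j => pd_algebraMap j c
    have h1 : ∀ k j : Fin d, pd k (component (pderiv i : PolyField 𝕂 d) j) = 0 := fun k j => by
      rw [component_pderiv]
      split_ifs
      · simpa using h 1 k
      · exact map_zero _
    simp only [lieSymb_apply, divergence_pderiv, h1]
    simp [component_pderiv]

/-! ### The cocycle -/

lemma cocycle_add (lam mu : 𝕂) (X Y : PolyField 𝕂 d) :
    cocycle lam mu (X + Y) = cocycle lam mu X + cocycle lam mu Y := by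
  simp only [cocycle, lieOpSymb_add, lieSymb_add]
  abel

lemma lieOpSymb_eq (lam mu : 𝕂) (X : PolyField 𝕂 d) :
    lieOpSymb lam mu X = lieSymb (mu - lam) X + cocycle lam mu X := by
  rw [cocycle, add_sub_cancel]

/-- The cocycle identity of `γ`; where `γ(X) = 0` it describes how `L^t_X` commutes with `γ(Y)`. -/
lemma cocycle_lie (lam mu : 𝕂) (X Y : PolyField 𝕂 d) (hX : cocycle lam mu X = 0) :
    cocycle lam mu ⁅X, Y⁆ = lieSymb (mu - lam) X * cocycle lam mu Y
      - cocycle lam mu Y * lieSymb (mu - lam) X := by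
  rw [cocycle, lieOpSymb_lie, lieSymb_lie, lieOpSymb_eq, lieOpSymb_eq, hX]
  noncomm_ring

lemma cocycle_C_mul (lam mu : 𝕂) (X : PolyField 𝕂 d) (f : Smooth 𝕂 d) (P : Symb 𝕂 d) :
    cocycle lam mu X (.C f * P) = .C f * cocycle lam mu X P := by
  simp only [cocycle, LinearMap.sub_apply, lieOpSymb_C_mul, lieSymb_C_mul]
  ring

lemma normalOrder_C (f : Smooth 𝕂 d) : normalOrder (.C f : Symb 𝕂 d) = mulOp f := by
  rw [MvPolynomial.C_apply, normalOrder_monomial, dPow_zero, mul_one]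

/-- On multiplication operators the weights `μ` and `λ` combine to `δ = μ - λ`, so the two actions
agree. This starts the recursion. -/
lemma cocycle_C (lam mu : 𝕂) (X : PolyField 𝕂 d) (f : Smooth 𝕂 d) :
    cocycle lam mu X (.C f) = 0 := by
  rw [cocycle, LinearMap.sub_apply, sub_eq_zero]
  refine normalOrder_injective (LinearMap.ext fun g => ?_)
  rw [normalOrder_lieOpSymb, lieSymb_eq, symDer_C, ← map_mul, ← map_add, normalOrder_C,
    normalOrder_C]
  simp only [LinearMap.sub_apply, Module.End.mul_apply, LinearMap.mulLeft_apply, lieDensity_apply,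
    vecOp_mul, sub_smul]
  ring

/-- The cocycle, on a symbol of higher degree. -/
lemma cocycle_mul_X (lam mu : 𝕂) (X : PolyField 𝕂 d) (P Q : Symb 𝕂 d) (j : Fin d)
    (hQ : normalOrder Q = normalOrder P * lieDensity lam ⁅(pderiv j : PolyField 𝕂 d), X⁆) :
    cocycle lam mu X (P * .X j) = cocycle lam mu X P * .X j
      - (Q - P * ∑ i, .C (component ⁅(pderiv j : PolyField 𝕂 d), X⁆ i) * .X i) := by
  have h : lieOpSymb lam mu X (P * .X j) = lieOpSymb lam mu X P * .X j - Q :=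
    normalOrder_injective (by rw [normalOrder_lieOpSymb_mul_X, map_sub, hQ])
  simp only [cocycle, LinearMap.sub_apply, h, lieSymb_eq, Derivation.leibniz, symDer_X,
    component_pderiv_lie, smul_eq_mul]
  ring

lemma mulOp_smul (c : 𝕂) (f : Smooth 𝕂 d) : mulOp (c • f) = c • mulOp f :=
  (LinearMap.mul 𝕂 (Smooth 𝕂 d)).map_smul c f

lemma mulOp_sum {ι : Type*} (s : Finset ι) (f : ι → Smooth 𝕂 d) :
    mulOp (∑ i ∈ s, f i) = ∑ i ∈ s, mulOp (f i) :=
  map_sum (LinearMap.mul 𝕂 (Smooth 𝕂 d)) f s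

lemma normalOrder_mul_mulOp_algebraMap (P : Symb 𝕂 d) (c : 𝕂) :
    normalOrder P * mulOp (algebraMap 𝕂 (Smooth 𝕂 d) c)
      = normalOrder (.C (algebraMap 𝕂 (Smooth 𝕂 d) c) * P) := by
  rw [normalOrder_C_mul]
  refine LinearMap.ext fun f => ?_
  simp only [Module.End.mul_apply, LinearMap.mulLeft_apply, ← Algebra.smul_def, map_smul]

lemma normalOrder_mul_mulOp_linear (P : Symb 𝕂 d) (c : Fin d → 𝕂) :
    normalOrder P * mulOp (∑ j, c j • coord j)
      = normalOrder (.C (∑ j, c j • coord j) * P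
        + ∑ k, .C (algebraMap 𝕂 (Smooth 𝕂 d) (c k)) * pderiv k P) := by
  rw [mulOp_sum, Finset.mul_sum, map_sum, Finset.sum_mul, ← Finset.sum_add_distrib, map_sum]
  refine Finset.sum_congr rfl fun j _ => ?_
  rw [mulOp_smul, mul_smul_comm, normalOrder_mul_coord, map_add, normalOrder_C_mul,
    normalOrder_C_mul, mulOp_smul, smul_add, smul_mul_assoc]
  congr 1

/-- For a multiplier of degree at most 1 the Leibniz expansion stops after first derivatives. -/
lemma normalOrder_mul_polyFun {p : MvPolynomial (Fin d) 𝕂} {n : ℕ} (hn : n ≤ 1)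
    (hp : p.IsHomogeneous n) (P : Symb 𝕂 d) :
    normalOrder P * mulOp (polyFun p)
      = normalOrder (.C (polyFun p) * P + ∑ k, .C (polyFun (pderiv k p)) * pderiv k P) := by
  rcases Nat.le_one_iff_eq_zero_or_eq_one.1 hn with rfl | rfl
  · rw [MvPolynomial.totalDegree_eq_zero_iff_eq_C.1
      (hp.totalDegree_le.antisymm (Nat.zero_le _))]
    simp only [MvPolynomial.pderiv_C, map_zero, zero_mul, Finset.sum_const_zero, add_zero,
      MvPolynomial.aeval_C, normalOrder_mul_mulOp_algebraMap]
  · have hk : ∀ k, polyFun (pderiv k p)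
        = algebraMap 𝕂 (Smooth 𝕂 d) (MvPolynomial.coeff 0 (pderiv k p)) := fun k => by
      have h : (pderiv k p).IsHomogeneous 0 := hp.pderiv
      conv_lhs => rw [MvPolynomial.totalDegree_eq_zero_iff_eq_C.1
        (h.totalDegree_le.antisymm (Nat.zero_le _))]
      exact MvPolynomial.aeval_C _ _
    have h : polyFun p = ∑ j, MvPolynomial.coeff 0 (pderiv j p) • coord j := by
      conv_lhs => rw [eq_sum_coeff_smul_X hp]
      simp only [map_sum, map_smul, MvPolynomial.aeval_X]
    simp only [hk, h]
    exact normalOrder_mul_mulOp_linear P _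

lemma divergence_eq (X : PolyField 𝕂 d) :
    divergence X = polyFun (∑ i, pderiv i (X (.X i))) := by
  simp only [divergence, component_eq, pd_polyFun, map_sum]

lemma exists_divergence_eq {X : PolyField 𝕂 d} {n : ℕ} (hn : n ≤ 1)
    (hX : X ∈ homogeneousFields 𝕂 d n) : ∃ c, divergence X = algebraMap 𝕂 (Smooth 𝕂 d) c := by
  have h : (∑ i, pderiv i (X (.X i))).IsHomogeneous 0 :=
    MvPolynomial.IsHomogeneous.sum _ _ _ fun i _ => by
      have := (hX i).pderiv (i := i)
      rwa [show n - 1 = 0 by omega] at this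
  rw [divergence_eq, MvPolynomial.totalDegree_eq_zero_iff_eq_C.1
    (h.totalDegree_le.antisymm (Nat.zero_le _))]
  exact ⟨_, MvPolynomial.aeval_C _ _⟩

/-- The cocycle of a quadratic field, computed by induction on the degree. -/
lemma cocycle_mul_X' (lam mu : 𝕂) {X : PolyField 𝕂 d} {n : ℕ} (hn : n ≤ 1) (P : Symb 𝕂 d)
    (j : Fin d) (hX : ⁅(pderiv j : PolyField 𝕂 d), X⁆ ∈ homogeneousFields 𝕂 d n) :
    cocycle lam mu X (P * .X j) = cocycle lam mu X P * .X j
      - (∑ i, ∑ k, .C (pd k (component ⁅(pderiv j : PolyField 𝕂 d), X⁆ i)) * .X i * pderiv k P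
        + .C (lam • divergence ⁅(pderiv j : PolyField 𝕂 d), X⁆) * P) := by
  generalize hY : ⁅(pderiv j : PolyField 𝕂 d), X⁆ = Y at hX
  rw [cocycle_mul_X lam mu X P (P * ∑ i, .C (component Y i) * .X i
    + (∑ i, ∑ k, .C (pd k (component Y i)) * .X i * pderiv k P
        + .C (lam • divergence Y) * P)) j ?_, hY, add_sub_cancel_left]
  rw [hY, lieDensity, mul_add, Finset.mul_sum, map_add, map_add, ← add_assoc]
  congr 1
  · rw [Finset.mul_sum, map_sum, map_sum, ← Finset.sum_add_distrib]
    refine Finset.sum_congr rfl fun i _ => ?_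
    rw [← mul_assoc (normalOrder P), component_eq, normalOrder_mul_polyFun hn (hX i),
      ← normalOrder_mul_X, ← map_add, add_mul, Finset.sum_mul]
    have h : ∑ k, .C (pd k (polyFun (Y (.X i)))) * .X i * pderiv k P
        = ∑ k, .C (polyFun (pderiv k (Y (.X i)))) * pderiv k P * .X i :=
      Finset.sum_congr rfl fun k _ => by rw [pd_polyFun, mul_right_comm]
    rw [h, ← mul_assoc, mul_comm P]
  · obtain ⟨c, hc⟩ := exists_divergence_eq hn hX
    have h : lam • divergence Y = algebraMap 𝕂 (Smooth 𝕂 d) (lam * c) := by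
      rw [hc, map_mul, Algebra.smul_def]
    rw [h, normalOrder_mul_mulOp_algebraMap]

/-- For an affine field `[∂ⱼ, X]` is constant, so the correction in `cocycle_mul_X'` vanishes at
every degree. -/
lemma cocycle_eq_zero (lam mu : 𝕂) {X : PolyField 𝕂 d} {n : ℕ} (hn : n ≤ 1)
    (hX : X ∈ homogeneousFields 𝕂 d n) : cocycle lam mu X = 0 := LinearMap.ext fun P => by
  have hY : ∀ j, ⁅(pderiv j : PolyField 𝕂 d), X⁆ ∈ homogeneousFields 𝕂 d 0 := fun j => by
    rcases Nat.le_one_iff_eq_zero_or_eq_one.1 hn with rfl | rfl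
    · rw [lie_eq_zero_of_const (pderiv_mem j) hX]
      exact zero_mem _
    · exact lie_mem_homogeneousFields (pderiv_mem j) hX rfl
  have hpd : ∀ j i k, pd k (component ⁅(pderiv j : PolyField 𝕂 d), X⁆ i) = 0 := fun j i k => by
    rw [component_eq, pd_polyFun, MvPolynomial.totalDegree_eq_zero_iff_eq_C.1
        ((hY j i).totalDegree_le.antisymm (Nat.zero_le _)), MvPolynomial.pderiv_C, map_zero]
  induction P using MvPolynomial.induction_on with
  | C f => exact cocycle_C lam mu X f
  | add p q hp hq => rw [map_add, hp, hq, map_add]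
  | mul_X p j hp =>
    rw [cocycle_mul_X' lam mu (Nat.zero_le _) p j (hY j), hp, divergence]
    simp [hpd]

/-! ### Degrees -/

lemma coeff_coeffDeriv (i : Fin d) (P : Symb 𝕂 d) (α : Fin d →₀ ℕ) :
    MvPolynomial.coeff α (coeffDeriv i P) = pd i (MvPolynomial.coeff α P) := by
  classical
  induction P using MvPolynomial.induction_on' with
  | monomial β b =>
    rw [coeffDeriv_monomial, MvPolynomial.coeff_monomial, MvPolynomial.coeff_monomial]
    split_ifs
    · rfl
    · rw [map_zero]
  | add p q hp hq => rw [map_add, MvPolynomial.coeff_add, hp, hq, MvPolynomial.coeff_add, map_add]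

lemma isHomogeneous_C_mul {P : Symb 𝕂 d} {k : ℕ} (f : Smooth 𝕂 d) (hP : P.IsHomogeneous k) :
    (.C f * P : Symb 𝕂 d).IsHomogeneous k := by
  simpa using (MvPolynomial.isHomogeneous_C (Fin d) f).mul hP

lemma isHomogeneous_X_mul_pderiv {P : Symb 𝕂 d} {k : ℕ} (f : Smooth 𝕂 d) (i j : Fin d)
    (hP : P.IsHomogeneous k) : (.C f * .X i * pderiv j P : Symb 𝕂 d).IsHomogeneous k := by
  rw [mul_assoc]
  refine isHomogeneous_C_mul f ?_
  rcases k with _ | k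
  · rw [MvPolynomial.totalDegree_eq_zero_iff_eq_C.1 (hP.totalDegree_le.antisymm (Nat.zero_le _)),
      MvPolynomial.pderiv_C, mul_zero]
    exact MvPolynomial.isHomogeneous_zero _ _ _
  · rw [add_comm]
    exact (MvPolynomial.isHomogeneous_X _ i).mul hP.pderiv

lemma cocycle_of_isHomogeneous_zero (lam mu : 𝕂) (X : PolyField 𝕂 d) {P : Symb 𝕂 d}
    (hP : P.IsHomogeneous 0) : cocycle lam mu X P = 0 := by
  rw [MvPolynomial.totalDegree_eq_zero_iff_eq_C.1 (hP.totalDegree_le.antisymm (Nat.zero_le _)),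
    cocycle_C]

/-- Euler's identity writes `(k+1)P` as `∑ (∂P/∂ξⱼ) ξⱼ`. The recursion turns each term into a
correction of degree `k` plus `γ(∂P/∂ξⱼ) ξⱼ`, of degree `k` by induction. -/
lemma cocycle_isHomogeneous (lam mu : 𝕂) {X : PolyField 𝕂 d} (hX : X ∈ homogeneousFields 𝕂 d 2)
    {P : Symb 𝕂 d} {k : ℕ} (hP : P.IsHomogeneous (k + 1)) :
    (cocycle lam mu X P).IsHomogeneous k := by
  induction k using Nat.strong_induction_on generalizing P with | _ k ih
  have hsum : ((k + 1 : ℕ) : 𝕂) • cocycle lam mu X P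
      = ∑ j, cocycle lam mu X (pderiv j P * .X j) := by
    rw [← map_smul, ← map_sum, Nat.cast_smul_eq_nsmul, ← hP.sum_X_mul_pderiv]
    simp only [mul_comm]
  have hmem : ∀ {Q : Symb 𝕂 d} {j}, ((cocycle lam mu X Q * .X j : Symb 𝕂 d).IsHomogeneous k) →
      Q.IsHomogeneous k → (cocycle lam mu X (Q * .X j)).IsHomogeneous k := fun {Q j} h hQ => by
    rw [cocycle_mul_X' lam mu le_rfl Q j (lie_mem_homogeneousFields (pderiv_mem j) hX rfl)]
    exact h.sub ((MvPolynomial.IsHomogeneous.sum _ _ _ fun i _ => .sum _ _ _ fun j _ =>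
      isHomogeneous_X_mul_pderiv _ i j hQ).add (isHomogeneous_C_mul _ hQ))
  refine (((MvPolynomial.homogeneousSubmodule (Fin d) (Smooth 𝕂 d) k).restrictScalars
    𝕂).smul_mem_iff (s := ((k + 1 : ℕ) : 𝕂)) (Nat.cast_ne_zero.2 k.succ_ne_zero)).1 ?_
  rw [hsum]
  refine Submodule.sum_mem _ fun j _ => ?_
  have hQ : (pderiv j P).IsHomogeneous k := hP.pderiv
  refine hmem ?_ hQ
  rcases k with _ | k
  · rw [cocycle_of_isHomogeneous_zero lam mu X hQ, zero_mul]
    exact MvPolynomial.isHomogeneous_zero _ _ _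
  · exact (ih k (Nat.lt_succ_self k) hQ).mul (MvPolynomial.isHomogeneous_X _ j)

end IFFTQuant

end

noncomputable section

namespace IFFTQuant

variable {𝕂 : Type*} [RCLike 𝕂] {d : ℕ}

open MvPolynomial (pderiv)
open PolyField Module

variable {g : LieSubalgebra 𝕂 (PolyField 𝕂 d)} [FiniteDimensional 𝕂 g]

/-! ### The Casimir operator of the symbols is linear over the smooth functions -/

/-- The invariant tensor is annihilated by `ad ∂ₖ`, so the polynomial `∑ Φ(bᵢ, b'ᵢ)` has zero
derivatives and is constant. Its constant term can be read in the adapted basis, where the degrees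
of dual elements add up to 2. -/
lemma IsIFFT.sum_eq_zero_of_derivation (hg : IsIFFT g) (hs : ComplexifiedIsSimple g) {ι : Type*}
    [Fintype ι] {b b' : ι → g} (h : IsDualPair (killingForm 𝕂 g) b b')
    (Φ : g →ₗ[𝕂] g →ₗ[𝕂] MvPolynomial (Fin d) 𝕂)
    (hΦ : ∀ k X Y, pderiv k (Φ X Y) = Φ ⁅hg.constElt k, X⁆ Y + Φ X ⁅hg.constElt k, Y⁆)
    (h0 : ∀ m n (X Y : g), (X : PolyField 𝕂 d) ∈ homogeneousFields 𝕂 d m →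
      (Y : PolyField 𝕂 d) ∈ homogeneousFields 𝕂 d n → m + n = 2 → (Φ X Y).coeff 0 = 0) :
    ∑ i, Φ (b i) (b' i) = 0 := by
  rw [eq_C_of_pderiv_eq_zero (p := ∑ i, Φ (b i) (b' i)) fun k => ?_,
    h.sum_eq (hg.isDualPair_adapted hs) Φ, hg.sum_adapted hs fun X Y => Φ X Y]
  · simp only [MvPolynomial.coeff_add, MvPolynomial.coeff_sum]
    rw [Finset.sum_eq_zero fun i _ => h0 0 2 _ _ (hg.constElt_mem i) (hg.quadElt_mem i) rfl,
      Finset.sum_eq_zero fun i _ => h0 2 0 _ _ (hg.quadElt_mem i) (hg.constElt_mem i) rfl,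
      Finset.sum_eq_zero fun i _ => h0 1 1 (ssIncl g (ssBasis g i)) (ssIncl g (hg.ssDual hs i))
        (ssBasis g i).1.2.2 (hg.ssDual hs i).1.2.2 rfl,
      map_smul, MvPolynomial.coeff_smul, h0 1 1 hg.eulerElt hg.eulerElt IFFTQuant.euler_mem IFFTQuant.euler_mem rfl]
    simp
  · rw [map_sum]
    simp only [hΦ, Finset.sum_add_distrib]
    exact h.sum_skew (T := LieAlgebra.ad 𝕂 g (hg.constElt k))
      (fun x y => LieModule.traceForm_apply_lie_apply' 𝕂 g g _ x y) Φ

/-- The component of the elements of `g`, as a linear map. -/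
def coordMap (g : LieSubalgebra 𝕂 (PolyField 𝕂 d)) (i : Fin d) : g →ₗ[𝕂] MvPolynomial (Fin d) 𝕂 where
  toFun X := (X : PolyField 𝕂 d) (.X i)
  map_add' _ _ := rfl
  map_smul' _ _ := rfl

lemma IsIFFT.pderiv_coordMap (hg : IsIFFT g) (k i : Fin d) (X : g) :
    pderiv k (coordMap g i X) = coordMap g i ⁅hg.constElt k, X⁆ :=
  (pderiv_lie_apply k i (X : PolyField 𝕂 d)).symm

variable {ι : Type*} [Fintype ι] {b b' : ι → g}

lemma IsIFFT.sum_component_mul (hg : IsIFFT g) (hs : ComplexifiedIsSimple g)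
    (h : IsDualPair (killingForm 𝕂 g) b b') (r s : Fin d) :
    ∑ j, component (b j : PolyField 𝕂 d) r * component (b' j : PolyField 𝕂 d) s = 0 := by
  have := hg.sum_eq_zero_of_derivation hs h
    ((LinearMap.mul 𝕂 (MvPolynomial (Fin d) 𝕂)).compl₁₂ (coordMap g r) (coordMap g s))
    (fun k X Y => by
      simp only [LinearMap.compl₁₂_apply, LinearMap.mul_apply', MvPolynomial.pderiv_mul,
        hg.pderiv_coordMap])
    (fun m n X Y hX hY hmn => ((hX r).mul (hY s)).coeff_eq_zero (by simp [hmn]))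
  have h2 := congrArg polyFun this
  rw [map_sum, map_zero] at h2
  rw [← h2]
  exact Finset.sum_congr rfl fun j _ => (map_mul polyFun _ _).symm

lemma IsIFFT.sum_component_mul_pd (hg : IsIFFT g) (hs : ComplexifiedIsSimple g)
    (h : IsDualPair (killingForm 𝕂 g) b b') (r s t : Fin d) :
    ∑ j, component (b j : PolyField 𝕂 d) r * pd t (component (b' j : PolyField 𝕂 d) s) = 0 := by
  have := hg.sum_eq_zero_of_derivation hs h
    ((LinearMap.mul 𝕂 (MvPolynomial (Fin d) 𝕂)).compl₁₂ (coordMap g r)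
      ((pderiv t).toLinearMap ∘ₗ coordMap g s))
    (fun k X Y => by
      simp only [LinearMap.compl₁₂_apply, LinearMap.mul_apply', MvPolynomial.pderiv_mul,
        hg.pderiv_coordMap, LinearMap.comp_apply, Derivation.coeFn_coe]
      -- Differentiation in direction `t` commutes with `ad ∂ₖ`.
      have hc : ⁅hg.constElt k, hg.constElt t⁆ = 0 :=
        Subtype.ext (lie_eq_zero_of_const (hg.constElt_mem k) (hg.constElt_mem t))
      rw [_root_.leibniz_lie, hc, _root_.zero_lie, zero_add])
    (fun m n X Y hX hY hmn => ((hX r).mul ((hY s).pderiv (i := t))).coeff_eq_zero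
      (by simp only [map_zero]; omega))
  have h2 := congrArg polyFun this
  rw [map_sum, map_zero] at h2
  rw [← h2]
  refine Finset.sum_congr rfl fun j _ => ?_
  rw [component_eq, component_eq, pd_polyFun, ← map_mul]
  rfl

/-- `L^t` of a field involves only its components and their first derivatives, so the two vanishing
sums above suffice. -/
lemma IsIFFT.sum_C_component_mul_lieSymb (hg : IsIFFT g) (hs : ComplexifiedIsSimple g)
    (h : IsDualPair (killingForm 𝕂 g) b b') (del : 𝕂) (r : Fin d) (P : Symb 𝕂 d) :
    ∑ j, .C (component (b j : PolyField 𝕂 d) r) * lieSymb del (b' j) P = 0 := by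
  have h1 : ∀ s, ∑ j, .C (component (b j : PolyField 𝕂 d) r)
      * (.C (component (b' j : PolyField 𝕂 d) s) * coeffDeriv s P) = 0 := fun s => by
    simp only [← mul_assoc, ← map_mul]
    rw [← Finset.sum_mul, ← map_sum, hg.sum_component_mul hs h, map_zero, zero_mul]
  have h2 : ∀ s t, ∑ j, .C (component (b j : PolyField 𝕂 d) r)
      * (.C (pd t (component (b' j : PolyField 𝕂 d) s)) * .X s * pderiv t P) = 0 := fun s t => by
    simp only [← mul_assoc, ← map_mul]
    rw [← Finset.sum_mul, ← Finset.sum_mul, ← map_sum, hg.sum_component_mul_pd hs h, map_zero,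
      zero_mul, zero_mul]
  have h3 : ∑ j, .C (component (b j : PolyField 𝕂 d) r)
      * (.C (del • divergence (b' j : PolyField 𝕂 d)) * P) = 0 := by
    simp only [← mul_assoc, ← map_mul]
    rw [← Finset.sum_mul, ← map_sum]
    simp only [mul_smul_comm, divergence, Finset.mul_sum]
    rw [← Finset.smul_sum, Finset.sum_comm,
      Finset.sum_eq_zero fun i _ => hg.sum_component_mul_pd hs h r i i, smul_zero, map_zero,
      zero_mul]
  simp only [lieSymb_apply, mul_add, mul_sub, Finset.mul_sum, Finset.sum_add_distrib,
    Finset.sum_sub_distrib]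
  rw [h3, Finset.sum_comm, Finset.sum_eq_zero fun s _ => h1 s, Finset.sum_comm,
    Finset.sum_eq_zero fun s _ => ?_]
  · simp
  · rw [Finset.sum_comm]
    exact Finset.sum_eq_zero fun t _ => h2 s t

lemma IsIFFT.sum_C_vecOp_mul_lieSymb (hg : IsIFFT g) (hs : ComplexifiedIsSimple g)
    (h : IsDualPair (killingForm 𝕂 g) b b') (del : 𝕂) (f : Smooth 𝕂 d) (P : Symb 𝕂 d) :
    ∑ j, .C (vecOp (b j : PolyField 𝕂 d) f) * lieSymb del (b' j) P = 0 := by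
  simp only [vecOp_apply, map_sum, Finset.sum_mul, map_mul]
  rw [Finset.sum_comm]
  refine Finset.sum_eq_zero fun r _ => ?_
  rw [← mul_zero (.C (pd r f) : Symb 𝕂 d), ← hg.sum_C_component_mul_lieSymb hs h del r P,
    Finset.mul_sum]
  exact Finset.sum_congr rfl fun j _ => by ring

lemma IsIFFT.sum_vecOp_vecOp (hg : IsIFFT g) (hs : ComplexifiedIsSimple g)
    (h : IsDualPair (killingForm 𝕂 g) b b') (f : Smooth 𝕂 d) :
    ∑ j, vecOp (b j : PolyField 𝕂 d) (vecOp (b' j : PolyField 𝕂 d) f) = 0 := by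
  have h2 : ∀ j, vecOp (b j : PolyField 𝕂 d) (vecOp (b' j : PolyField 𝕂 d) f)
      = ∑ r, ∑ s, (component (b j : PolyField 𝕂 d) s * component (b' j : PolyField 𝕂 d) r
          * pd s (pd r f)
        + component (b j : PolyField 𝕂 d) s * pd s (component (b' j : PolyField 𝕂 d) r)
          * pd r f) := fun j => by
    rw [vecOp_apply (b' j : PolyField 𝕂 d), map_sum]
    refine Finset.sum_congr rfl fun r _ => ?_
    rw [vecOp_mul, vecOp_apply, vecOp_apply, Finset.mul_sum, Finset.sum_mul,
      ← Finset.sum_add_distrib]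
    exact Finset.sum_congr rfl fun s _ => by ring
  simp only [h2]
  rw [Finset.sum_comm]
  refine Finset.sum_eq_zero fun r _ => ?_
  rw [Finset.sum_comm]
  refine Finset.sum_eq_zero fun s _ => ?_
  rw [Finset.sum_add_distrib, ← Finset.sum_mul, ← Finset.sum_mul, hg.sum_component_mul hs h,
    hg.sum_component_mul_pd hs h, zero_mul, zero_mul, add_zero]

lemma IsIFFT.casimir_lieSymb_eq (hg : IsIFFT g) (del : 𝕂)
    (h : IsDualPair (killingForm 𝕂 g) b b') :
    casimir g (lieSymb del) = ∑ j, lieSymb del (b j) * lieSymb del (b' j) :=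
  have := hg.isKilling
  casimir_eq_sum (lieSymb_add del) (lieSymb_smul del) h

/-- Leibniz produces two cross terms, exchanged by swapping the dual families, and one second-order
term in `f`; all three are killed by the invariance of the Casimir tensor. -/
lemma IsIFFT.casimir_C_mul (hg : IsIFFT g) (hs : ComplexifiedIsSimple g) (del : 𝕂)
    (f : Smooth 𝕂 d) (P : Symb 𝕂 d) :
    casimir g (lieSymb del) (.C f * P) = .C f * casimir g (lieSymb del) P := by
  have h := hg.isDualPair_adapted hs
  rw [hg.casimir_lieSymb_eq del h]
  simp only [LinearMap.sum_apply, Module.End.mul_apply, lieSymb_C_mul, map_add,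
    Finset.sum_add_distrib, ← Finset.mul_sum]
  rw [hg.sum_C_vecOp_mul_lieSymb hs h, hg.sum_C_vecOp_mul_lieSymb hs (h.symm killingForm_comm),
    ← Finset.sum_mul, ← map_sum, hg.sum_vecOp_vecOp hs h]
  simp

end IFFTQuant

end

noncomputable section

namespace IFFTQuant

variable {𝕂 : Type*} [RCLike 𝕂] {d : ℕ}

open MvPolynomial (pderiv)
open PolyField Module

/-! ### Symbols with constant coefficients -/

/-- The inclusion of the symbols with constant coefficients. -/
def constSymb : MvPolynomial (Fin d) 𝕂 →ₐ[𝕂] Symb 𝕂 d :=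
  MvPolynomial.mapAlgHom (Algebra.ofId 𝕂 (Smooth 𝕂 d))

lemma constSymb_apply (T : MvPolynomial (Fin d) 𝕂) :
    constSymb T = MvPolynomial.map (algebraMap 𝕂 (Smooth 𝕂 d)) T := rfl

lemma constSymb_C (c : 𝕂) :
    (constSymb (.C c) : Symb 𝕂 d) = .C (algebraMap 𝕂 (Smooth 𝕂 d) c) :=
  MvPolynomial.map_C _ _

lemma constSymb_X (i : Fin d) : (constSymb (.X i) : Symb 𝕂 d) = .X i := MvPolynomial.map_X _ _

lemma map_evalAt_constSymb (x : Fin d → 𝕂) (T : MvPolynomial (Fin d) 𝕂) :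
    MvPolynomial.map (evalAt x) (constSymb T) = T := by
  rw [constSymb_apply, MvPolynomial.map_map]
  exact MvPolynomial.map_id T

lemma constSymb_injective :
    Function.Injective (constSymb : MvPolynomial (Fin d) 𝕂 → Symb 𝕂 d) := fun S T h => by
  rw [← map_evalAt_constSymb 0 S, h, map_evalAt_constSymb]

lemma constSymb_isHomogeneous {T : MvPolynomial (Fin d) 𝕂} {k : ℕ} (h : T.IsHomogeneous k) :
    (constSymb T : Symb 𝕂 d).IsHomogeneous k := h.map _

lemma pderiv_constSymb (j : Fin d) (T : MvPolynomial (Fin d) 𝕂) :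
    pderiv j (constSymb T : Symb 𝕂 d) = constSymb (pderiv j T) := MvPolynomial.pderiv_map

lemma coeffDeriv_constSymb (j : Fin d) (T : MvPolynomial (Fin d) 𝕂) :
    coeffDeriv j (constSymb T : Symb 𝕂 d) = 0 := MvPolynomial.ext _ _ fun α => by
  rw [coeff_coeffDeriv, constSymb_apply, MvPolynomial.coeff_map, pd_algebraMap,
    MvPolynomial.coeff_zero]

lemma pd_component_of_linear {D : PolyField 𝕂 d} (hD : D ∈ homogeneousFields 𝕂 d 1) (i j : Fin d) :
    pd j (component D i)
      = algebraMap 𝕂 (Smooth 𝕂 d) (MvPolynomial.coeff (Finsupp.single j 1) (D (.X i))) := by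
  have h : (pderiv j (D (.X i))).IsHomogeneous 0 := (hD i).pderiv
  rw [component_eq, pd_polyFun, MvPolynomial.totalDegree_eq_zero_iff_eq_C.1
    (h.totalDegree_le.antisymm (Nat.zero_le _)), MvPolynomial.coeff_pderiv]
  simp

lemma lieSymb_constSymb (del : 𝕂) {D : PolyField 𝕂 d} (hD : D ∈ homogeneousFields 𝕂 d 1)
    (T : MvPolynomial (Fin d) 𝕂) :
    lieSymb del D (constSymb T)
      = constSymb (tensorAction D T) + .C (del • divergence D) * constSymb T := by
  simp only [lieSymb_apply, coeffDeriv_constSymb, mul_zero, Finset.sum_const_zero, zero_sub,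
    tensorAction, map_neg, map_sum, map_mul, constSymb_C, constSymb_X, pd_component_of_linear hD,
    pderiv_constSymb]

lemma constSymb_tensorAction {D : PolyField 𝕂 d} (hD : D ∈ homogeneousFields 𝕂 d 1)
    (T : MvPolynomial (Fin d) 𝕂) :
    constSymb (tensorAction D T) = lieSymb 0 D (constSymb T) := by
  rw [lieSymb_constSymb 0 hD, zero_smul, map_zero, zero_mul, add_zero]

lemma tensorAction_euler {T : MvPolynomial (Fin d) 𝕂} {k : ℕ} (hT : T.IsHomogeneous k) :
    tensorAction euler T = -(k : 𝕂) • T := by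
  have h : ∀ i : Fin d, ∑ j, MvPolynomial.C (MvPolynomial.coeff (Finsupp.single j 1)
      ((euler : PolyField 𝕂 d) (MvPolynomial.X i))) * MvPolynomial.X i * pderiv j T
        = MvPolynomial.X i * pderiv i T := fun i => by
    rw [Finset.sum_eq_single i]
    · simp [euler_X]
    · intro j _ hj
      rw [euler_X, MvPolynomial.coeff_X, if_neg, map_zero, zero_mul, zero_mul]
      exact fun h => hj (Finsupp.single_left_injective one_ne_zero h).symm
    · simp
  rw [tensorAction, Finset.sum_congr rfl fun i _ => h i, hT.sum_X_mul_pderiv, neg_smul,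
    Nat.cast_smul_eq_nsmul]

lemma divergence_euler : divergence (euler : PolyField 𝕂 d) = algebraMap 𝕂 (Smooth 𝕂 d) d := by
  rw [divergence_eq]
  simp [euler_X]

lemma vecOp_algebraMap (X : PolyField 𝕂 d) (c : 𝕂) :
    vecOp X (algebraMap 𝕂 (Smooth 𝕂 d) c) = 0 := by
  simp [vecOp_apply, pd_algebraMap]

lemma lieSymb_euler (del : 𝕂) {T : MvPolynomial (Fin d) 𝕂} {k : ℕ} (hT : T.IsHomogeneous k) :
    lieSymb del euler (constSymb T) = (del * d - k) • constSymb T := by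
  rw [lieSymb_constSymb del IFFTQuant.euler_mem, tensorAction_euler hT, divergence_euler, C_smul,
    smul_mul_assoc, sub_smul, map_smul, neg_smul, mul_smul]
  have : (.C (algebraMap 𝕂 (Smooth 𝕂 d) (d : 𝕂)) : Symb 𝕂 d) * constSymb T
      = (d : 𝕂) • constSymb T := by
    rw [Algebra.smul_def]
    rfl
  rw [this]
  abel

variable {g : LieSubalgebra 𝕂 (PolyField 𝕂 d)}

/-- Linear fields have constant divergence, and a commutator only sees its derivatives. The density
weight thus disappears on `𝔥₀`. -/
lemma divergence_ss (x : semisimplePart g) : divergence (x : linearPart g).1 = 0 := by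
  have h := coe_mem_ssFields x
  generalize (x : linearPart g).1 = Z at h
  induction h using Submodule.span_induction with
  | mem Z hZ =>
    obtain ⟨X, hX, Y, hY, rfl⟩ := hZ
    obtain ⟨c, hc⟩ := exists_divergence_eq le_rfl hX.2
    obtain ⟨e, he⟩ := exists_divergence_eq le_rfl hY.2
    rw [divergence_lie, hc, he, vecOp_algebraMap, vecOp_algebraMap, sub_zero]
  | zero => simpa using divergence_smul (0 : 𝕂) (0 : PolyField 𝕂 d)
  | add X Y _ _ hX hY => rw [divergence_add, hX, hY, add_zero]
  | smul c X _ hX => rw [divergence_smul, hX, smul_zero]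

lemma lieSymb_ss (del : 𝕂) (x : semisimplePart g) (T : MvPolynomial (Fin d) 𝕂) :
    lieSymb del (x : linearPart g).1 (constSymb T) = constSymb (tensorAction (x : linearPart g).1 T) := by
  rw [lieSymb_constSymb del x.1.2.2, divergence_ss, smul_zero, map_zero, zero_mul, add_zero]

/-! ### The representation of `𝔥₀` on symmetric tensors -/

/-- Constant symbols embed the tensors into the `L^0`-module of symbols; the module axioms for
`tensorAction` are pulled back along this injection. -/
lemma eq_tensorAction_of {D : PolyField 𝕂 d} (hD : D ∈ homogeneousFields 𝕂 d 1)
    {S T : MvPolynomial (Fin d) 𝕂} (h : constSymb S = lieSymb 0 D (constSymb T)) :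
    tensorAction D T = S := constSymb_injective (by rw [h, constSymb_tensorAction hD])

/-- The action of `𝔥₀` on a stable subspace of the symmetric tensors. -/
abbrev stableLieRingModule {F : Submodule 𝕂 (MvPolynomial (Fin d) 𝕂)} (hF : IsStable g F) :
    LieRingModule (semisimplePart g) F where
  bracket x T := ⟨tensorAction (x : linearPart g).1 T, hF x T T.2⟩
  add_lie x y T := Subtype.ext <| eq_tensorAction_of (x + y).1.2.2 <| by
    change constSymb (tensorAction (x : linearPart g).1 T + tensorAction (y : linearPart g).1 T)
      = lieSymb 0 ((x : linearPart g).1 + (y : linearPart g).1) _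
    rw [map_add, lieSymb_add, constSymb_tensorAction x.1.2.2, constSymb_tensorAction y.1.2.2]
    rfl
  lie_add x S T := Subtype.ext <| eq_tensorAction_of x.1.2.2 <| by
    change constSymb (tensorAction (x : linearPart g).1 S + tensorAction (x : linearPart g).1 T)
      = lieSymb 0 (x : linearPart g).1 (constSymb (S.1 + T.1))
    rw [map_add, map_add, map_add, constSymb_tensorAction x.1.2.2, constSymb_tensorAction x.1.2.2]
  leibniz_lie x y T := Subtype.ext <| constSymb_injective <| by
    change constSymb (tensorAction (x : linearPart g).1 (tensorAction (y : linearPart g).1 T))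
      = constSymb (tensorAction (⁅x, y⁆ : semisimplePart g).1.1 T
        + tensorAction (y : linearPart g).1 (tensorAction (x : linearPart g).1 T))
    rw [map_add, constSymb_tensorAction x.1.2.2, constSymb_tensorAction y.1.2.2,
      constSymb_tensorAction y.1.2.2, constSymb_tensorAction x.1.2.2,
      constSymb_tensorAction (⁅x, y⁆ : semisimplePart g).1.2.2]
    change _ = lieSymb 0 ⁅(x : linearPart g).1, (y : linearPart g).1⁆ _ + _
    rw [lieSymb_lie, LinearMap.sub_apply, Module.End.mul_apply, Module.End.mul_apply,
      sub_add_cancel]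

lemma stableLieModule {F : Submodule 𝕂 (MvPolynomial (Fin d) 𝕂)} (hF : IsStable g F) :
    letI := stableLieRingModule hF
    LieModule 𝕂 (semisimplePart g) F :=
  letI := stableLieRingModule hF
  { smul_lie := fun c x T => Subtype.ext <| eq_tensorAction_of (c • x).1.2.2 <| by
      change constSymb (c • tensorAction (x : linearPart g).1 T)
        = lieSymb 0 (c • (x : linearPart g).1) _
      rw [map_smul, lieSymb_smul, constSymb_tensorAction x.1.2.2]
      rfl
    lie_smul := fun c x T => Subtype.ext <| eq_tensorAction_of x.1.2.2 <| by
      change constSymb (c • tensorAction (x : linearPart g).1 T)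
        = lieSymb 0 (x : linearPart g).1 (constSymb (c • T.1))
      rw [map_smul, map_smul, map_smul, constSymb_tensorAction x.1.2.2] }

variable [FiniteDimensional 𝕂 g]

lemma commutator_mul_eq {R : Type*} [Ring R] (p q r : R) :
    p * (q * r) - q * r * p = (p * q - q * p) * r + q * (p * r - r * p) := by noncomm_ring

/-- The Casimir operator of `𝔥₀` commutes with `𝔥₀` and has an eigenvalue in `𝕂` by
`exists_hasEigenvalue_casimir`, applied with `G = 𝔤`, whose trace form on `𝔥₀` is `ssForm`. The
eigenspace is stable and nonzero, hence all of `F`. -/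
lemma IsIFFT.exists_tensorCasimir_eq (hg : IsIFFT g) (hs : ComplexifiedIsSimple g)
    {F : Submodule 𝕂 (MvPolynomial (Fin d) 𝕂)} [FiniteDimensional 𝕂 F] (hF : IsStable g F)
    (hF0 : F ≠ ⊥) (hirr : ∀ F' ≤ F, IsStable g F' → F' = ⊥ ∨ F' = F) :
    ∃ z : 𝕂, ∀ T ∈ F, ∑ i, tensorAction (ssBasis g i).1.1
      (tensorAction (hg.ssDual hs i).1.1 T) = z • T := by
  let := stableLieRingModule hF
  have := stableLieModule hF
  let : LieRingModule (semisimplePart g) g := LieRingModule.compLieHom g (ssIncl g)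
  have : LieModule 𝕂 (semisimplePart g) g := LieModule.compLieHom g (ssIncl g)
  have : LieAlgebra.IsSimple (AlgebraicClosure 𝕂) (AlgebraicClosure 𝕂 ⊗[𝕂] semisimplePart g) := hs
  have : Nontrivial F := Submodule.nontrivial_iff_ne_bot.2 hF0
  have : Nonempty (Fin (finrank 𝕂 (semisimplePart g))) := by
    refine ⟨⟨0, Nat.pos_of_ne_zero fun h0 => ssFields_ne_bot hs ?_⟩⟩
    have := finrank_zero_iff.1 h0
    rw [eq_bot_iff]
    intro X hX
    obtain ⟨x, rfl⟩ := exists_coe_eq hX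
    rw [Subsingleton.elim x 0]
    exact zero_mem _
  let c : Module.End 𝕂 F := ∑ i, LieModule.toEnd 𝕂 (semisimplePart g) F (ssBasis g i)
    * LieModule.toEnd 𝕂 (semisimplePart g) F (hg.ssDual hs i)
  have hc : ∀ x, Commute (LieModule.toEnd 𝕂 (semisimplePart g) F x) c := fun x => by
    have h := (hg.isDualPair_ssDual hs).sum_skew (N := Module.End 𝕂 F)
      (T := LieAlgebra.ad 𝕂 (semisimplePart g) x)
      (fun y y' => by
        change killingForm 𝕂 g (ssIncl g ⁅x, y⁆) (ssIncl g y')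
          = -killingForm 𝕂 g (ssIncl g y) (ssIncl g ⁅x, y'⁆)
        rw [LieHom.map_lie, LieHom.map_lie]
        exact LieModule.traceForm_apply_lie_apply' 𝕂 g g _ _ _)
      ((LinearMap.mul 𝕂 (Module.End 𝕂 F)).compl₁₂
        (LieModule.toEnd 𝕂 (semisimplePart g) F : semisimplePart g →ₗ[𝕂] Module.End 𝕂 F)
        (LieModule.toEnd 𝕂 (semisimplePart g) F : semisimplePart g →ₗ[𝕂] Module.End 𝕂 F))
    rw [← Finset.sum_add_distrib] at h
    rw [Commute, SemiconjBy, ← sub_eq_zero, ← h, Finset.mul_sum, Finset.sum_mul]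
    refine (Finset.sum_sub_distrib (G := Module.End 𝕂 F) _ _).symm.trans ?_
    refine Finset.sum_congr rfl fun i _ => ?_
    simp only [LinearMap.compl₁₂_apply, LinearMap.mul_apply', LieHom.coe_toLinearMap,
      LieAlgebra.ad_apply, LieHom.map_lie, Ring.lie_def]
    exact commutator_mul_eq (R := Module.End 𝕂 F) _ _ _
  obtain ⟨z, hz⟩ := LieAlgebra.exists_hasEigenvalue_casimir (G := g) (M := F) (AlgebraicClosure 𝕂) (ssBasis g)
    (hg.ssDual hs) (fun i => hg.ssForm_ssDual hs i) hc
  have hcz : ∀ T : F, (c T : MvPolynomial (Fin d) 𝕂) = ∑ i, tensorAction (ssBasis g i).1.1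
      (tensorAction (hg.ssDual hs i).1.1 T) := fun T => by
    simp only [c, LinearMap.sum_apply, AddSubmonoidClass.coe_finsetSum]
    rfl
  let E := (Module.End.eigenspace c z).map F.subtype
  have hE : E = ⊥ ∨ E = F := by
    refine hirr E ?_ ?_
    · rintro _ ⟨T, -, rfl⟩
      exact T.2
    · rintro x _ ⟨T, hT, rfl⟩
      refine ⟨⁅x, T⁆, ?_, rfl⟩
      have hT' := Module.End.mem_eigenspace_iff.1 hT
      refine Module.End.mem_eigenspace_iff.2 ?_
      have := LinearMap.congr_fun (hc x).eq T
      rw [Module.End.mul_apply, Module.End.mul_apply, hT', map_smul] at this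
      exact this.symm
  refine ⟨z, fun T hT => ?_⟩
  rcases hE with hE | hE
  · exact absurd (Submodule.map_injective_of_injective F.injective_subtype
      (hE.trans (Submodule.map_bot _).symm)) hz
  · rw [← hE] at hT
    obtain ⟨T, hT, rfl⟩ := hT
    refine (hcz T).symm.trans ?_
    rw [Module.End.mem_eigenspace_iff.1 hT]
    rfl

end IFFTQuant

end

noncomputable section

namespace IFFTQuant

variable {𝕂 : Type*} [RCLike 𝕂] {d : ℕ}

open MvPolynomial (pderiv)
open PolyField Module

/-! ### Sections -/

lemma Symb.ext_evalAt {P Q : Symb 𝕂 d}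
    (h : ∀ x, MvPolynomial.map (evalAt x) P = MvPolynomial.map (evalAt x) Q) : P = Q :=
  MvPolynomial.ext _ _ fun α => Smooth.ext' fun x => by
    have := congrArg (MvPolynomial.coeff α) (h x)
    rwa [MvPolynomial.coeff_map, MvPolynomial.coeff_map] at this

lemma C_mul_constSymb_mem_sections {F : Submodule 𝕂 (MvPolynomial (Fin d) 𝕂)} (f : Smooth 𝕂 d)
    {T : MvPolynomial (Fin d) 𝕂} (hT : T ∈ F) : .C f * constSymb T ∈ sections F := fun x => by
  rw [map_mul, MvPolynomial.map_C, map_evalAt_constSymb, ← MvPolynomial.smul_eq_C_mul]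
  exact F.smul_mem _ hT

lemma C_mul_mem_sections {F : Submodule 𝕂 (MvPolynomial (Fin d) 𝕂)} (f : Smooth 𝕂 d)
    {P : Symb 𝕂 d} (hP : P ∈ sections F) : .C f * P ∈ sections F := fun x => by
  rw [map_mul, MvPolynomial.map_C, ← MvPolynomial.smul_eq_C_mul]
  exact F.smul_mem _ (hP x)

/-- A linear projection `π` onto `F` fixes the values of `P`, so `P = ∑ c_α π(ξ^α)`: sections are
combinations of constant tensors with smooth coefficients. -/
lemma sections_induction {F : Submodule 𝕂 (MvPolynomial (Fin d) 𝕂)} {p : Symb 𝕂 d → Prop}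
    (h0 : p 0) (hadd : ∀ P Q, p P → p Q → p (P + Q))
    (h : ∀ f, ∀ T ∈ F, p (.C f * constSymb T)) {P : Symb 𝕂 d} (hP : P ∈ sections F) : p P := by
  obtain ⟨π, hπ⟩ := F.subtype.exists_leftInverse_of_injective F.ker_subtype
  have hπ' : ∀ T ∈ F, (π T : MvPolynomial (Fin d) 𝕂) = T := fun T hT =>
    congrArg Subtype.val (LinearMap.congr_fun hπ ⟨T, hT⟩)
  have hP' : P = ∑ α ∈ P.support,
      .C (P.coeff α) * constSymb (π (MvPolynomial.monomial α 1) : MvPolynomial (Fin d) 𝕂) := by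
    refine Symb.ext_evalAt fun x => ?_
    have hT : MvPolynomial.map (evalAt x) P
        = ∑ α ∈ P.support, evalAt x (P.coeff α) • MvPolynomial.monomial α 1 := by
      conv_lhs => rw [P.as_sum, map_sum]
      refine Finset.sum_congr rfl fun α _ => ?_
      rw [MvPolynomial.map_monomial, MvPolynomial.smul_monomial, smul_eq_mul, mul_one]
    refine (hπ' _ (hP x)).symm.trans ?_
    change (F.subtype ∘ₗ π) _ = _
    rw [hT, map_sum, map_sum]
    refine Finset.sum_congr rfl fun α _ => ?_
    rw [map_smul, map_mul, MvPolynomial.map_C, map_evalAt_constSymb, MvPolynomial.smul_eq_C_mul]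
    rfl
  rw [hP']
  exact Finset.sum_induction _ p hadd h0 fun α _ => h _ _ (π _).2

lemma isHomogeneous_of_mem_sections {F : Submodule 𝕂 (MvPolynomial (Fin d) 𝕂)} {k : ℕ}
    (hF : F ≤ MvPolynomial.homogeneousSubmodule (Fin d) 𝕂 k) {P : Symb 𝕂 d}
    (hP : P ∈ sections F) : P.IsHomogeneous k :=
  sections_induction (p := fun P => P.IsHomogeneous k) (MvPolynomial.isHomogeneous_zero _ _ _)
    (fun _ _ h h' => h.add h')
    (fun f _ hT => isHomogeneous_C_mul f (constSymb_isHomogeneous (hF hT))) hP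

lemma coeffDeriv_mem_sections {F : Submodule 𝕂 (MvPolynomial (Fin d) 𝕂)} (i : Fin d) {P : Symb 𝕂 d}
    (hP : P ∈ sections F) : coeffDeriv i P ∈ sections F := by
  refine sections_induction (p := fun P => coeffDeriv i P ∈ sections F) ?_ (fun P Q h h' => ?_)
    (fun f T hT => ?_) hP
  · rw [map_zero]
    exact zero_mem _
  · rw [map_add]
    exact add_mem h h'
  · rw [coeffDeriv_mul, coeffDeriv_constSymb, mul_zero, zero_add, coeffDeriv_C]
    exact C_mul_constSymb_mem_sections _ hT

lemma mem_iSup_sections {ι : Type*} {I : ι → Submodule 𝕂 (MvPolynomial (Fin d) 𝕂)} {k : ℕ}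
    (hI : ⨆ i, I i = MvPolynomial.homogeneousSubmodule (Fin d) 𝕂 k) {P : Symb 𝕂 d}
    (hP : P.IsHomogeneous k) : P ∈ ⨆ i, sections (I i) := by
  have h : ∀ f, ∀ T ∈ ⨆ i, I i, .C f * constSymb T ∈ ⨆ i, sections (I i) := fun f T hT => by
    induction hT using Submodule.iSup_induction' with
    | mem i T hT => exact Submodule.mem_iSup_of_mem i (C_mul_constSymb_mem_sections f hT)
    | zero => rw [map_zero, mul_zero]; exact zero_mem _
    | add S T _ _ hS hT => rw [map_add, mul_add]; exact add_mem hS hT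
  have hP' : P ∈ sections (⨆ i, I i) := fun x => by
    rw [hI]
    exact hP.map _
  exact sections_induction (zero_mem _) (fun _ _ => add_mem) h hP'

/-- Independence is checked point by point. -/
lemma iSupIndep_sections {ι : Type*} {I : ι → Submodule 𝕂 (MvPolynomial (Fin d) 𝕂)}
    (hI : iSupIndep I) : iSupIndep fun i => sections (I i) := by
  rw [iSupIndep_iff_finsetSum_eq_zero_imp_eq_zero] at hI ⊢
  intro s v hv h0 i hi
  refine Symb.ext_evalAt fun x => ?_
  rw [map_zero]
  exact hI s (fun i => MvPolynomial.map (evalAt x) (v i)) (fun i hi => hv i hi x)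
    (by rw [← map_sum, h0, map_zero]) i hi

/-! ### The eigenvalues of the Casimir operator -/

variable {g : LieSubalgebra 𝕂 (PolyField 𝕂 d)}

lemma TensorDecomposition.I_le (𝓘 : TensorDecomposition g) (k : ℕ) (p : Fin (𝓘.num k)) :
    𝓘.I k p ≤ MvPolynomial.homogeneousSubmodule (Fin d) 𝕂 k :=
  (le_iSup (𝓘.I k) p).trans (𝓘.iSup_eq k).le

variable [FiniteDimensional 𝕂 g]

/-- Computed in the adapted basis. Constant fields kill `T`, so the constant-quadratic terms reduce
to `∑ L^t` of the brackets, a multiple of `L^t_E`. The Euler field acts by `δd - k`. Only the `𝔥₀`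
terms remain. -/
lemma IsIFFT.exists_casimir_constSymb (hg : IsIFFT g) (hs : ComplexifiedIsSimple g) (del : 𝕂)
    (k : ℕ) : ∃ c : 𝕂, ∀ T : MvPolynomial (Fin d) 𝕂, T.IsHomogeneous k →
      casimir g (lieSymb del) (constSymb T) = c • constSymb T
        + constSymb (∑ i, tensorAction (ssBasis g i).1.1
          (tensorAction (hg.ssDual hs i).1.1 T)) := by
  obtain ⟨z, hz⟩ := hg.sum_const_quad hs
  refine ⟨z * (del * d - k) + (killingForm 𝕂 g hg.eulerElt hg.eulerElt)⁻¹
    * ((del * d - k) * (del * d - k)), fun T hT => ?_⟩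
  have hE : lieSymb del (hg.eulerElt : PolyField 𝕂 d) (constSymb T)
      = (del * d - k) • constSymb T := lieSymb_euler del hT
  have h1 : ∑ i, lieSymb del (hg.constElt i : PolyField 𝕂 d)
      (lieSymb del (hg.quadElt i : PolyField 𝕂 d) (constSymb T))
        = z • (del * d - k : 𝕂) • constSymb T := by
    let Λ : g →ₗ[𝕂] Symb 𝕂 d :=
      { toFun := fun X => lieSymb del (X : PolyField 𝕂 d) (constSymb T)
        map_add' := fun X Y => LinearMap.congr_fun (lieSymb_add del X.1 Y.1) _
        map_smul' := fun c X => LinearMap.congr_fun (lieSymb_smul del c X.1) _ }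
    have h2 : Λ (∑ i, ⁅hg.constElt i, hg.quadElt i⁆) = z • (del * d - k : 𝕂) • constSymb T := by
      rw [hz, map_smul]
      exact congrArg _ hE
    rw [← h2, map_sum]
    refine Finset.sum_congr rfl fun i _ => ?_
    change _ = lieSymb del ⁅(hg.constElt i : PolyField 𝕂 d), (hg.quadElt i : PolyField 𝕂 d)⁆ _
    rw [lieSymb_lie, LinearMap.sub_apply, Module.End.mul_apply, Module.End.mul_apply]
    have : lieSymb del (hg.constElt i : PolyField 𝕂 d) (constSymb T) = 0 := by
      change lieSymb del (pderiv i) (constSymb T) = 0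
      rw [lieSymb_pderiv, coeffDeriv_constSymb]
    rw [this, map_zero, sub_zero]
  have h2 : ∑ i, lieSymb del (hg.quadElt i : PolyField 𝕂 d)
      (lieSymb del (hg.constElt i : PolyField 𝕂 d) (constSymb T)) = 0 :=
    Finset.sum_eq_zero fun i _ => by
      change lieSymb del _ (lieSymb del (pderiv i) (constSymb T)) = 0
      rw [lieSymb_pderiv, coeffDeriv_constSymb, map_zero]
  have h3 : lieSymb del (hg.eulerElt : PolyField 𝕂 d) (lieSymb del
      (((killingForm 𝕂 g hg.eulerElt hg.eulerElt)⁻¹ • hg.eulerElt : g) : PolyField 𝕂 d)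
        (constSymb T)) = (killingForm 𝕂 g hg.eulerElt hg.eulerElt)⁻¹ •
          (del * d - k : 𝕂) • (del * d - k : 𝕂) • constSymb T := by
    change lieSymb del _ (lieSymb del (_ • (hg.eulerElt : PolyField 𝕂 d)) _) = _
    rw [lieSymb_smul, LinearMap.smul_apply, map_smul, hE, map_smul, hE]
  have h4 : ∑ i, lieSymb del (ssIncl g (ssBasis g i) : PolyField 𝕂 d)
      (lieSymb del (ssIncl g (hg.ssDual hs i) : PolyField 𝕂 d) (constSymb T))
        = constSymb (∑ i, tensorAction (ssBasis g i).1.1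
          (tensorAction (hg.ssDual hs i).1.1 T)) := by
    rw [map_sum]
    refine Finset.sum_congr rfl fun i _ => ?_
    change lieSymb del (ssBasis g i).1.1 (lieSymb del (hg.ssDual hs i).1.1 _) = _
    rw [lieSymb_ss, lieSymb_ss]
  rw [hg.casimir_lieSymb_eq del (hg.isDualPair_adapted hs)]
  simp only [LinearMap.sum_apply, Module.End.mul_apply]
  rw [hg.sum_adapted hs fun X Y => lieSymb del (X : PolyField 𝕂 d)
    (lieSymb del (Y : PolyField 𝕂 d) (constSymb T)), h1, h2, h3, h4, add_smul, mul_smul, mul_smul,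
    mul_smul]
  abel

lemma IsIFFT.exists_casimir_sections (hg : IsIFFT g) (hs : ComplexifiedIsSimple g)
    (𝓘 : TensorDecomposition g) (del : 𝕂) (k : ℕ) (p : Fin (𝓘.num k)) :
    ∃ α : 𝕂, ∀ P ∈ sections (𝓘.I k p), casimir g (lieSymb del) P = α • P := by
  obtain ⟨c, hc⟩ := hg.exists_casimir_constSymb hs del k
  have hfd : FiniteDimensional 𝕂 (MvPolynomial.homogeneousSubmodule (Fin d) 𝕂 k) :=
    Module.Finite.iff_fg.2 (MvPolynomial.homogeneousSubmodule_fg _ _ k)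
  have : FiniteDimensional 𝕂 (𝓘.I k p) := Submodule.finiteDimensional_of_le (𝓘.I_le k p)
  obtain ⟨z, hz⟩ := hg.exists_tensorCasimir_eq hs (𝓘.stable k p) (𝓘.ne_bot k p)
    (𝓘.irreducible k p)
  refine ⟨c + z, fun P hP => ?_⟩
  refine sections_induction (p := fun P => casimir g (lieSymb del) P = (c + z) • P) ?_
    (fun P Q h h' => ?_) (fun f T hT => ?_) hP
  · rw [map_zero, smul_zero]
  · rw [map_add, h, h', smul_add]
  · rw [hg.casimir_C_mul hs, hc T (𝓘.I_le k p hT), hz T hT, map_smul, ← add_smul, mul_smul_comm]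

end IFFTQuant

end

noncomputable section

namespace IFFTQuant

variable {𝕂 : Type*} [RCLike 𝕂] {d : ℕ}

open MvPolynomial (pderiv)
open PolyField Module

/-! ### Stable spaces of symbols -/

lemma sum_coord_mul_pd {p : MvPolynomial (Fin d) 𝕂} {n : ℕ} (hp : p.IsHomogeneous n) :
    ∑ v, coord v * pd v (polyFun p) = (n : 𝕂) • polyFun p := by
  have h := congrArg polyFun hp.sum_X_mul_pderiv
  rw [map_sum, map_nsmul, ← Nat.cast_smul_eq_nsmul 𝕂] at h
  rw [← h]
  exact Finset.sum_congr rfl fun v _ => by rw [map_mul, MvPolynomial.aeval_X, pd_polyFun]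

/-- By Euler's identity in `x`, the sum over `v` counts the transport term twice (coefficients of
degree 2) and the Jacobian terms once (degree 1), which explains the subtraction. Stability under
quadratic fields thus follows from stability under linear fields, derivatives and functions. -/
lemma lieSymb_of_quadratic (del : 𝕂) {X : PolyField 𝕂 d} (hX : X ∈ homogeneousFields 𝕂 d 2)
    (P : Symb 𝕂 d) :
    lieSymb del X P = ∑ v, .C (coord v) * lieSymb del ⁅(pderiv v : PolyField 𝕂 d), X⁆ P
      - ∑ i, .C (component X i) * coeffDeriv i P := by
  have h1 : ∑ v, ∑ i, .C (coord v) * (.C (pd v (component X i)) * coeffDeriv i P)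
      = ∑ i, .C (component X i) * coeffDeriv i P + ∑ i, .C (component X i) * coeffDeriv i P := by
    rw [Finset.sum_comm, ← Finset.sum_add_distrib]
    refine Finset.sum_congr rfl fun i _ => ?_
    simp only [← mul_assoc, ← map_mul]
    rw [← Finset.sum_mul, ← map_sum, component_eq, sum_coord_mul_pd (hX i), Nat.cast_ofNat,
      two_smul, map_add, add_mul]
  have h2 : ∑ v, ∑ i, ∑ j, .C (coord v) * (.C (pd j (pd v (component X i))) * .X i * pderiv j P)
      = ∑ i, ∑ j, .C (pd j (component X i)) * .X i * pderiv j P := by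
    rw [Finset.sum_comm]
    refine Finset.sum_congr rfl fun i _ => ?_
    rw [Finset.sum_comm]
    refine Finset.sum_congr rfl fun j _ => ?_
    have hc : ∀ v, pd j (pd v (component X i)) = pd v (polyFun (pderiv j (X (.X i)))) := fun v => by
      rw [← pd_polyFun]
      exact LinearMap.congr_fun (pd_comm j v).eq _
    simp only [hc, ← mul_assoc, ← map_mul]
    rw [← Finset.sum_mul, ← Finset.sum_mul, ← map_sum, sum_coord_mul_pd (hX i).pderiv,
      Nat.cast_one, one_smul, ← pd_polyFun, component_eq]
  have h3 : ∑ v, .C (coord v) * (.C (del • divergence ⁅(pderiv v : PolyField 𝕂 d), X⁆) * P)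
      = .C (del • divergence X) * P := by
    simp only [← mul_assoc, ← map_mul, mul_smul_comm]
    rw [← Finset.sum_mul, ← map_sum, ← Finset.smul_sum]
    have h : ∀ v, divergence ⁅(pderiv v : PolyField 𝕂 d), X⁆ = pd v (divergence X) := fun v => by
      rw [divergence_lie, divergence_pderiv, map_zero, sub_zero, vecOp_pderiv]
    simp only [h]
    rw [divergence_eq, sum_coord_mul_pd (n := 1), Nat.cast_one, one_smul]
    exact .sum _ _ _ fun i _ => (hX i).pderiv
  simp only [lieSymb_apply, component_pderiv_lie, mul_add, mul_sub, Finset.mul_sum,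
    Finset.sum_add_distrib, Finset.sum_sub_distrib]
  rw [h1, h2, h3]
  abel

variable {g : LieSubalgebra 𝕂 (PolyField 𝕂 d)}

lemma lieSymb_mem_of_const (del : 𝕂) {F : Submodule 𝕂 (Symb 𝕂 d)}
    (h0 : ∀ i, ∀ P ∈ F, coeffDeriv i P ∈ F) {X : PolyField 𝕂 d}
    (hX : X ∈ homogeneousFields 𝕂 d 0) {P : Symb 𝕂 d} (hP : P ∈ F) : lieSymb del X P ∈ F := by
  rw [eq_sum_smul_pderiv hX]
  generalize (fun i => MvPolynomial.coeff 0 (X (.X i))) = c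
  let Λ : PolyField 𝕂 d →ₗ[𝕂] Symb 𝕂 d :=
    { toFun := fun X => lieSymb del X P
      map_add' := fun X Y => LinearMap.congr_fun (lieSymb_add del X Y) P
      map_smul' := fun c X => LinearMap.congr_fun (lieSymb_smul del c X) P }
  change Λ _ ∈ F
  rw [map_sum]
  refine Submodule.sum_mem _ fun i _ => ?_
  rw [map_smul]
  refine F.smul_mem _ ?_
  change lieSymb del (pderiv i) P ∈ F
  rw [lieSymb_pderiv]
  exact h0 i P hP

lemma IsIFFT.lieSymb_mem_of [FiniteDimensional 𝕂 g] (hg : IsIFFT g) (del : 𝕂) {F : Submodule 𝕂 (Symb 𝕂 d)}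
    (hC : ∀ f, ∀ P ∈ F, .C f * P ∈ F) (h0 : ∀ i, ∀ P ∈ F, coeffDeriv i P ∈ F)
    (h1 : ∀ D ∈ linearPart g, ∀ P ∈ F, lieSymb del D P ∈ F) {X : PolyField 𝕂 d} (hX : X ∈ g)
    {P : Symb 𝕂 d} (hP : P ∈ F) : lieSymb del X P ∈ F := by
  refine hg.induction_on (p := fun X => lieSymb del X P ∈ F)
    (fun X hX => lieSymb_mem_of_const del h0 hX hP) (fun X hX => h1 X hX P hP) (fun X hX => ?_)
    (fun X Y hX hY => ?_) hX
  · rw [lieSymb_of_quadratic del hX.2]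
    refine sub_mem (Submodule.sum_mem _ fun v _ => hC _ _ (h1 _ ⟨?_, ?_⟩ P hP))
      (Submodule.sum_mem _ fun i _ => hC _ _ (h0 i P hP))
    · exact g.lie_mem (hg.pderiv_mem v) hX.1
    · exact lie_mem_homogeneousFields (IFFTQuant.pderiv_mem v) hX.2 rfl
  · rw [lieSymb_add]
    exact add_mem hX hY

lemma IsIFFT.lieSymb_mem_sections_of_linear [FiniteDimensional 𝕂 g] (hg : IsIFFT g)
    (hs : ComplexifiedIsSimple g)
    (𝓘 : TensorDecomposition g) (del : 𝕂) {k : ℕ} {p : Fin (𝓘.num k)} {D : PolyField 𝕂 d}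
    (hD : D ∈ linearPart g) {P : Symb 𝕂 d} (hP : P ∈ sections (𝓘.I k p)) :
    lieSymb del D P ∈ sections (𝓘.I k p) := by
  refine sections_induction (p := fun P => lieSymb del D P ∈ sections (𝓘.I k p)) ?_
    (fun P Q h h' => ?_) (fun f T hT => ?_) hP
  · rw [map_zero]
    exact zero_mem _
  · rw [map_add]
    exact add_mem h h'
  · rw [lieSymb_C_mul]
    refine add_mem (C_mul_mem_sections _ ?_) (C_mul_constSymb_mem_sections _ hT)
    have hsec : ∀ T ∈ 𝓘.I k p, constSymb T ∈ sections (𝓘.I k p) := fun T hT => by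
      simpa using C_mul_constSymb_mem_sections 1 hT
    obtain ⟨c, y, rfl⟩ := hg.mem_ssFields_sup hs hD
    rw [lieSymb_add, lieSymb_smul, LinearMap.add_apply, LinearMap.smul_apply,
      lieSymb_euler del (𝓘.I_le k p hT), lieSymb_ss]
    exact add_mem (Submodule.smul_mem _ _ (Submodule.smul_mem _ _ (hsec T hT)))
      (hsec _ (𝓘.stable k p y T hT))

/-! ### Trees -/

section Tree

variable {lam mu : 𝕂} {E : Submodule 𝕂 (Symb 𝕂 d)} {l : ℕ}

lemma cocycle_mem_tree {X : PolyField 𝕂 d} (hX : X ∈ g.toSubmodule ⊓ homogeneousFields 𝕂 d 2)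
    {P : Symb 𝕂 d} (hP : P ∈ tree g lam mu E l) : cocycle lam mu X P ∈ tree g lam mu E (l + 1) :=
  Submodule.mem_iSup_of_mem X (Submodule.mem_iSup_of_mem hX ⟨P, hP, rfl⟩)

lemma tree_succ_le {S : Submodule 𝕂 (Symb 𝕂 d)}
    (h : ∀ X ∈ g.toSubmodule ⊓ homogeneousFields 𝕂 d 2, ∀ P ∈ tree g lam mu E l,
      cocycle lam mu X P ∈ S) : tree g lam mu E (l + 1) ≤ S :=
  iSup₂_le fun X hX => Submodule.map_le_iff_le_comap.2 (h X hX)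

lemma C_mul_mem_tree (hE : ∀ f, ∀ P ∈ E, .C f * P ∈ E) (f : Smooth 𝕂 d) {P : Symb 𝕂 d}
    (hP : P ∈ tree g lam mu E l) : .C f * P ∈ tree g lam mu E l := by
  induction l generalizing P with
  | zero => exact hE f P hP
  | succ l ih =>
    refine tree_succ_le (S := (tree g lam mu E (l + 1)).comap (LinearMap.mulLeft 𝕂 (.C f)))
      (fun X hX P hP => ?_) hP
    rw [Submodule.mem_comap, LinearMap.mulLeft_apply, ← cocycle_C_mul]
    exact cocycle_mem_tree hX (ih hP)

/-- `γ` vanishes on `∂ᵢ` and on the linear field `[∂ᵢ, X]`, so `γ(X)` commutes with `∂ᵢ`. -/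
lemma coeffDeriv_mem_tree (hE : ∀ i, ∀ P ∈ E, coeffDeriv i P ∈ E) (i : Fin d) {P : Symb 𝕂 d}
    (hP : P ∈ tree g lam mu E l) : coeffDeriv i P ∈ tree g lam mu E l := by
  induction l generalizing P with
  | zero => exact hE i P hP
  | succ l ih =>
    refine tree_succ_le (S := (tree g lam mu E (l + 1)).comap (coeffDeriv i))
      (fun X hX P hP => ?_) hP
    have h1 := cocycle_lie lam mu (pderiv i) X
      (cocycle_eq_zero lam mu (Nat.zero_le _) (IFFTQuant.pderiv_mem i))
    rw [cocycle_eq_zero lam mu le_rfl (lie_mem_homogeneousFields (IFFTQuant.pderiv_mem i) hX.2 rfl)]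
      at h1
    have h2 := sub_eq_zero.1 (LinearMap.congr_fun h1 P).symm
    rw [Module.End.mul_apply, Module.End.mul_apply, lieSymb_pderiv] at h2
    rw [Submodule.mem_comap, h2]
    exact cocycle_mem_tree hX (ih hP)

/-- `L^t_D γ(X) = γ([D, X]) + γ(X) L^t_D`, and `[D, X]` is again in `𝔤₁`. -/
lemma lieSymb_mem_tree_of_linear
    (hE : ∀ D ∈ linearPart g, ∀ P ∈ E, lieSymb (mu - lam) D P ∈ E) {D : PolyField 𝕂 d}
    (hD : D ∈ linearPart g) {P : Symb 𝕂 d} (hP : P ∈ tree g lam mu E l) :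
    lieSymb (mu - lam) D P ∈ tree g lam mu E l := by
  induction l generalizing P with
  | zero => exact hE D hD P hP
  | succ l ih =>
    refine tree_succ_le (S := (tree g lam mu E (l + 1)).comap (lieSymb (mu - lam) D))
      (fun X hX P hP => ?_) hP
    have h1 := LinearMap.congr_fun (cocycle_lie lam mu D X (cocycle_eq_zero lam mu le_rfl hD.2)) P
    rw [LinearMap.sub_apply, Module.End.mul_apply, Module.End.mul_apply, eq_sub_iff_add_eq] at h1
    rw [Submodule.mem_comap, ← h1]
    exact add_mem (cocycle_mem_tree
      ⟨g.lie_mem hD.1 hX.1, lie_mem_homogeneousFields hD.2 hX.2 rfl⟩ hP) (cocycle_mem_tree hX (ih hP))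

/-- Each step lowers the degree by one, and symbols of degree 0 are killed. -/
lemma tree_isHomogeneous {k : ℕ} (hE : ∀ P ∈ E, P.IsHomogeneous k) {P : Symb 𝕂 d}
    (hP : P ∈ tree g lam mu E l) : (∀ n, l + n = k → P.IsHomogeneous n) ∧ (k < l → P = 0) := by
  induction l generalizing P with
  | zero => exact ⟨fun n hn => by rw [← hn, zero_add] at hE; exact hE P hP, by simp⟩
  | succ l ih =>
    constructor
    · intro n hn
      refine tree_succ_le (S := (MvPolynomial.homogeneousSubmodule (Fin d) (Smooth 𝕂 d)
        n).restrictScalars 𝕂) (fun X hX P hP => ?_) hP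
      exact cocycle_isHomogeneous lam mu hX.2 ((ih hP).1 (n + 1) (by omega))
    · intro hk
      refine tree_succ_le (S := ⊥) (fun X hX P hP => ?_) hP
      rw [Submodule.mem_bot]
      rcases Nat.lt_or_ge k l with h | h
      · rw [(ih hP).2 h, map_zero]
      · exact cocycle_of_isHomogeneous_zero lam mu X ((ih hP).1 0 (by omega))

end Tree

end IFFTQuant

end

noncomputable section

namespace IFFTQuant

open Module

/-! ### Surjectivity of shifted algebraic operators -/

lemma aeval_mem {K M : Type*} [Field K] [AddCommGroup M] [Module K M] {f : Module.End K M}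
    {T : Submodule K M} (hT : ∀ x ∈ T, f x ∈ T) (q : Polynomial K) {x : M} (hx : x ∈ T) :
    Polynomial.aeval f q x ∈ T := by
  induction q using Polynomial.induction_on' generalizing x with
  | add p q hp hq => rw [map_add]; exact add_mem (hp hx) (hq hx)
  | monomial n a =>
    rw [Polynomial.aeval_monomial, Module.End.mul_apply, Module.algebraMap_end_apply]
    refine T.smul_mem a ?_
    induction n with
    | zero => exact hx
    | succ n ih => rw [pow_succ', Module.End.mul_apply]; exact hT _ ih

/-- An injective shift of an algebraic operator is surjective. -/
lemma exists_sub_smul_eq {K M : Type*} [Field K] [AddCommGroup M] [Module K M]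
    {f : Module.End K M} {T : Submodule K M} {α : K} (hT : ∀ x ∈ T, f x ∈ T)
    (hinj : ∀ x ∈ T, f x = α • x → x = 0) {q : Polynomial K} (hq0 : q ≠ 0)
    (hq : ∀ x ∈ T, Polynomial.aeval f q x = 0) {u : M} (hu : u ∈ T) :
    ∃ w ∈ T, f w - α • w = u := by
  have hshift : ∀ x, Polynomial.aeval f (Polynomial.X - Polynomial.C α) x = f x - α • x := fun x => by
    rw [map_sub, Polynomial.aeval_X, Polynomial.aeval_C, LinearMap.sub_apply,
      Module.algebraMap_end_apply]
  have hpow : ∀ n, ∀ x ∈ T, Polynomial.aeval f ((Polynomial.X - Polynomial.C α) ^ n) x = 0 →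
      x = 0 := fun n => by
    induction n with
    | zero => intro x _ hx; simpa using hx
    | succ n ih =>
      intro x hx h
      rw [pow_succ', map_mul, Module.End.mul_apply, hshift, sub_eq_zero] at h
      exact ih x hx (hinj _ (aeval_mem hT _ hx) h)
  -- Write `q = (X - α)^m r` with `r(α) ≠ 0`. Injectivity of `f - α` gives `r(f) u = 0`. With `r -
  -- r(α) = (X - α) s` this reads `(f - α) s(f) u = -r(α) u`, which supplies the preimage.
  obtain ⟨r, hr, hnd⟩ := Polynomial.exists_eq_pow_rootMultiplicity_mul_and_not_dvd q hq0 α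
  have hr0 : r.eval α ≠ 0 := fun h => hnd (Polynomial.dvd_iff_isRoot.2 h)
  have hru : Polynomial.aeval f r u = 0 := hpow _ _ (aeval_mem hT r hu) (by
    rw [← Module.End.mul_apply, ← map_mul, ← hr, hq u hu])
  obtain ⟨s, hs⟩ := Polynomial.X_sub_C_dvd_sub_C_eval (p := r) (a := α)
  refine ⟨-(r.eval α)⁻¹ • Polynomial.aeval f s u, T.smul_mem _ (aeval_mem hT s hu), ?_⟩
  rw [← hshift, map_smul, ← Module.End.mul_apply, ← map_mul, ← hs, map_sub, LinearMap.sub_apply,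
    hru, zero_sub, Polynomial.aeval_C, Module.algebraMap_end_apply, neg_smul, smul_neg, neg_neg,
    inv_smul_smul₀ hr0]

variable {𝕂 : Type*} [RCLike 𝕂] {d : ℕ}
variable {g : LieSubalgebra 𝕂 (PolyField 𝕂 d)}

/-- The space `𝒯^l(E_{k,p})`. -/
abbrev TensorDecomposition.treeAt (𝓘 : TensorDecomposition g) (lam mu : 𝕂) (k : ℕ)
    (p : Fin (𝓘.num k)) (l : ℕ) : Submodule 𝕂 (Symb 𝕂 d) :=
  tree g lam mu (sections (𝓘.I k p)) l

/-- The space `⨁_{j ≥ l} 𝒯^j(E_{k,p})`. -/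
abbrev TensorDecomposition.treesFrom (𝓘 : TensorDecomposition g) (lam mu : 𝕂) (k : ℕ)
    (p : Fin (𝓘.num k)) (l : ℕ) : Submodule 𝕂 (Symb 𝕂 d) :=
  ⨆ j, 𝓘.treeAt lam mu k p (j + l)

section TreesFrom

variable {𝓘 : TensorDecomposition g} {lam mu : 𝕂} {k : ℕ} {p : Fin (𝓘.num k)} {l : ℕ}
  {P : Symb 𝕂 d}

lemma treeAt_isHomogeneous {n : ℕ} (hP : P ∈ 𝓘.treeAt lam mu k p l) (hn : l + n = k) :
    P.IsHomogeneous n :=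
  (tree_isHomogeneous (fun _ h => isHomogeneous_of_mem_sections (𝓘.I_le k p) h) hP).1 n hn

lemma treeAt_eq_zero (hP : P ∈ 𝓘.treeAt lam mu k p l) (hl : k < l) : P = 0 :=
  (tree_isHomogeneous (fun _ h => isHomogeneous_of_mem_sections (𝓘.I_le k p) h) hP).2 hl

lemma treeAt_le_treesFrom {j : ℕ} (hlj : l ≤ j) :
    𝓘.treeAt lam mu k p j ≤ 𝓘.treesFrom lam mu k p l := by
  obtain ⟨i, rfl⟩ := Nat.exists_eq_add_of_le' hlj
  exact le_iSup (fun i => 𝓘.treeAt lam mu k p (i + l)) i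

lemma treesFrom_le {S : Submodule 𝕂 (Symb 𝕂 d)}
    (h : ∀ j, l ≤ j → 𝓘.treeAt lam mu k p j ≤ S) : 𝓘.treesFrom lam mu k p l ≤ S :=
  iSup_le fun i => h _ (Nat.le_add_left l i)

lemma exists_eq_add_of_mem_treesFrom (hP : P ∈ 𝓘.treesFrom lam mu k p l) :
    ∃ a ∈ 𝓘.treeAt lam mu k p l, ∃ b ∈ 𝓘.treesFrom lam mu k p (l + 1), a + b = P := by
  have : 𝓘.treesFrom lam mu k p l
      ≤ 𝓘.treeAt lam mu k p l ⊔ 𝓘.treesFrom lam mu k p (l + 1) := treesFrom_le fun j hj => by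
    rcases hj.eq_or_lt with rfl | hj
    · exact le_sup_left
    · exact (treeAt_le_treesFrom hj).trans le_sup_right
  exact Submodule.mem_sup.1 (this hP)

lemma treesFrom_eq_zero (hP : P ∈ 𝓘.treesFrom lam mu k p l) (hl : k < l) : P = 0 :=
  (Submodule.mem_bot 𝕂).1 (treesFrom_le (S := ⊥)
    (fun _ hj _ hQ => treeAt_eq_zero hQ (hl.trans_le hj)) hP)

lemma homogeneousComponent_treesFrom {n : ℕ} (hn : k < l + n)
    (hP : P ∈ 𝓘.treesFrom lam mu k p l) : MvPolynomial.homogeneousComponent n P = 0 := by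
  refine treesFrom_le (S := (LinearMap.ker (MvPolynomial.homogeneousComponent n :
    Symb 𝕂 d →ₗ[Smooth 𝕂 d] Symb 𝕂 d)).restrictScalars 𝕂) (fun j hj Q hQ => ?_) hP
  change MvPolynomial.homogeneousComponent n Q = 0
  rcases Nat.lt_or_ge k j with h | h
  · rw [treeAt_eq_zero hQ h, map_zero]
  · obtain ⟨m, rfl⟩ := Nat.exists_eq_add_of_le h
    rw [MvPolynomial.homogeneousComponent_of_mem (treeAt_isHomogeneous hQ rfl), if_neg (by omega)]

end TreesFrom

variable [FiniteDimensional 𝕂 g]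

namespace IsIFFT

/-- `𝒮^k` is spanned by finitely many spaces on which `C` is a scalar, so the product of the
corresponding linear factors kills it. -/
lemma exists_aeval_casimir (hg : IsIFFT g) (hs : ComplexifiedIsSimple g)
    (𝓘 : TensorDecomposition g) (del : 𝕂) (k : ℕ) :
    ∃ q : Polynomial 𝕂, q ≠ 0 ∧ ∀ P : Symb 𝕂 d, P.IsHomogeneous k →
      Polynomial.aeval (casimir g (lieSymb del)) q P = 0 := by
  choose α hα using hg.exists_casimir_sections hs 𝓘 del k
  refine ⟨∏ p, (Polynomial.X - Polynomial.C (α p)),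
    Finset.prod_ne_zero_iff.2 fun p _ => Polynomial.X_sub_C_ne_zero _, fun P hP => ?_⟩
  have hle : ⨆ p, sections (𝓘.I k p) ≤ LinearMap.ker (Polynomial.aeval (casimir g (lieSymb del))
      (∏ p, (Polynomial.X - Polynomial.C (α p)))) := iSup_le fun p P h => by
    rw [LinearMap.mem_ker, ← Finset.prod_erase_mul _ _ (Finset.mem_univ p), map_mul,
      Module.End.mul_apply, map_sub, Polynomial.aeval_X, Polynomial.aeval_C, LinearMap.sub_apply,
      Module.algebraMap_end_apply, hα p P h, sub_self, map_zero]
  exact hle (mem_iSup_sections (𝓘.iSup_eq k) hP)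

lemma lieOpSymb_casimir (hg : IsIFFT g) (hs : ComplexifiedIsSimple g) (lam mu : 𝕂)
    {X : PolyField 𝕂 d} (hX : X ∈ g) (P : Symb 𝕂 d) :
    casimir g (lieOpSymb lam mu) (lieOpSymb lam mu X P)
      = lieOpSymb lam mu X (casimir g (lieOpSymb lam mu) P) := by
  have := hg.isKilling
  have h := hg.isDualPair_adapted hs
  let ρ : g →ₗ[𝕂] Module.End 𝕂 (Symb 𝕂 d) :=
    { toFun := fun X => lieOpSymb lam mu X
      map_add' := fun X Y => lieOpSymb_add lam mu X.1 Y.1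
      map_smul' := fun c X => lieOpSymb_smul lam mu c X.1 }
  have hρ : ∀ Y : g, ρ ⁅(⟨X, hX⟩ : g), Y⁆ = ρ ⟨X, hX⟩ * ρ Y - ρ Y * ρ ⟨X, hX⟩ := fun Y =>
    lieOpSymb_lie lam mu X Y
  have hskew := h.sum_skew (N := Module.End 𝕂 (Symb 𝕂 d)) (T := LieAlgebra.ad 𝕂 g ⟨X, hX⟩)
    (fun x y => LieModule.traceForm_apply_lie_apply' 𝕂 g g _ x y)
    ((LinearMap.mul 𝕂 (Module.End 𝕂 (Symb 𝕂 d))).compl₁₂ ρ ρ)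
  rw [← Finset.sum_add_distrib] at hskew
  simp only [LinearMap.compl₁₂_apply, LinearMap.mul_apply', LieAlgebra.ad_apply, hρ] at hskew
  rw [← Finset.sum_congr rfl fun i _ => commutator_mul_eq _ _ _, Finset.sum_sub_distrib,
    ← Finset.mul_sum, ← Finset.sum_mul, sub_eq_zero] at hskew
  rw [casimir_eq_sum (lieOpSymb_add lam mu) (lieOpSymb_smul lam mu) h]
  exact (LinearMap.congr_fun hskew P).symm

variable {𝓘 : TensorDecomposition g} {lam mu : 𝕂} {k : ℕ} {p : Fin (𝓘.num k)} {l : ℕ} {P : Symb 𝕂 d}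

lemma lieSymb_mem_treeAt (hg : IsIFFT g) (hs : ComplexifiedIsSimple g) {X : PolyField 𝕂 d}
    (hX : X ∈ g) (hP : P ∈ 𝓘.treeAt lam mu k p l) :
    lieSymb (mu - lam) X P ∈ 𝓘.treeAt lam mu k p l :=
  hg.lieSymb_mem_of (mu - lam)
    (fun f _ h => C_mul_mem_tree (fun f _ h => C_mul_mem_sections f h) f h)
    (fun i _ h => coeffDeriv_mem_tree (fun i _ h => coeffDeriv_mem_sections i h) i h)
    (fun _ hD _ h => lieSymb_mem_tree_of_linear
      (fun _ hD _ h => hg.lieSymb_mem_sections_of_linear hs 𝓘 _ hD h) hD h) hX hP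

lemma cocycle_mem_treeAt (hg : IsIFFT g) {X : PolyField 𝕂 d} (hX : X ∈ g)
    (hP : P ∈ 𝓘.treeAt lam mu k p l) : cocycle lam mu X P ∈ 𝓘.treeAt lam mu k p (l + 1) := by
  refine hg.induction_on (p := fun X => cocycle lam mu X P ∈ 𝓘.treeAt lam mu k p (l + 1))
    (fun X hX => ?_) (fun X hX => ?_) (fun X hX => cocycle_mem_tree hX hP) (fun X Y h h' => ?_) hX
  · rw [cocycle_eq_zero lam mu (Nat.zero_le _) hX]
    exact zero_mem _
  · rw [cocycle_eq_zero lam mu le_rfl hX.2]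
    exact zero_mem _
  · rw [cocycle_add]
    exact add_mem h h'

lemma casimir_mem_treeAt (hg : IsIFFT g) (hs : ComplexifiedIsSimple g)
    (hP : P ∈ 𝓘.treeAt lam mu k p l) :
    casimir g (lieSymb (mu - lam)) P ∈ 𝓘.treeAt lam mu k p l := by
  rw [hg.casimir_lieSymb_eq _ (hg.isDualPair_adapted hs), LinearMap.sum_apply]
  refine Submodule.sum_mem _ fun i _ => ?_
  rw [Module.End.mul_apply]
  exact hg.lieSymb_mem_treeAt hs (hg.adapted i).2
    (hg.lieSymb_mem_treeAt hs (hg.adaptedDual hs i).2 hP)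

/-- With one of the two cocycles zero, the expansion of `(L^t + γ)(L^t + γ)` contains a single `γ`,
so the level rises by exactly one. -/
lemma lieOpSymb_sub_mem_treeAt (hg : IsIFFT g) (hs : ComplexifiedIsSimple g) {X Y : PolyField 𝕂 d}
    (hX : X ∈ g) (hY : Y ∈ g) (h : cocycle lam mu X = 0 ∨ cocycle lam mu Y = 0)
    (hP : P ∈ 𝓘.treeAt lam mu k p l) :
    lieOpSymb lam mu X (lieOpSymb lam mu Y P)
      - lieSymb (mu - lam) X (lieSymb (mu - lam) Y P) ∈ 𝓘.treeAt lam mu k p (l + 1) := by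
  rcases h with h | h
  · have e : lieOpSymb lam mu X (lieOpSymb lam mu Y P)
        - lieSymb (mu - lam) X (lieSymb (mu - lam) Y P)
          = lieSymb (mu - lam) X (cocycle lam mu Y P) := by
      rw [lieOpSymb_eq lam mu X, lieOpSymb_eq lam mu Y, h, add_zero, LinearMap.add_apply, map_add,
        add_sub_cancel_left]
    rw [e]
    exact hg.lieSymb_mem_treeAt hs hX (hg.cocycle_mem_treeAt hY hP)
  · have e : lieOpSymb lam mu X (lieOpSymb lam mu Y P)
        - lieSymb (mu - lam) X (lieSymb (mu - lam) Y P)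
          = cocycle lam mu X (lieSymb (mu - lam) Y P) := by
      rw [lieOpSymb_eq lam mu X, lieOpSymb_eq lam mu Y, h, add_zero, LinearMap.add_apply,
        add_sub_cancel_left]
    rw [e]
    exact hg.cocycle_mem_treeAt hX (hg.lieSymb_mem_treeAt hs hY hP)

lemma cocycle_adapted (hg : IsIFFT g) (hs : ComplexifiedIsSimple g) (lam mu : 𝕂) (j) :
    cocycle lam mu (hg.adapted j : PolyField 𝕂 d) = 0
      ∨ cocycle lam mu (hg.adaptedDual hs j : PolyField 𝕂 d) = 0 := by
  rcases j with i | i | i | i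
  · exact .inl (cocycle_eq_zero lam mu (Nat.zero_le _) (hg.constElt_mem i))
  · exact .inr (cocycle_eq_zero lam mu (Nat.zero_le _) (hg.constElt_mem i))
  · exact .inl (cocycle_eq_zero lam mu le_rfl IFFTQuant.euler_mem)
  · exact .inl (cocycle_eq_zero lam mu le_rfl (ssBasis g i).1.2.2)

/-- In the adapted dual bases no pair consists of two quadratic fields, so no term quadratic in `γ`
occurs in `𝒞 - C`. -/
lemma casimir_sub_mem_treeAt (hg : IsIFFT g) (hs : ComplexifiedIsSimple g)
    (hP : P ∈ 𝓘.treeAt lam mu k p l) :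
    casimir g (lieOpSymb lam mu) P - casimir g (lieSymb (mu - lam)) P
      ∈ 𝓘.treeAt lam mu k p (l + 1) := by
  have := hg.isKilling
  have h := hg.isDualPair_adapted hs
  have e : casimir g (lieOpSymb lam mu) P - casimir g (lieSymb (mu - lam)) P
      = ∑ j, (lieOpSymb lam mu (hg.adapted j) (lieOpSymb lam mu (hg.adaptedDual hs j) P)
        - lieSymb (mu - lam) (hg.adapted j) (lieSymb (mu - lam) (hg.adaptedDual hs j) P)) := by
    rw [casimir_eq_sum (lieOpSymb_add lam mu) (lieOpSymb_smul lam mu) h,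
      hg.casimir_lieSymb_eq _ h, LinearMap.sum_apply, LinearMap.sum_apply,
      Finset.sum_sub_distrib]
    rfl
  rw [e]
  exact Submodule.sum_mem _ fun j _ => hg.lieOpSymb_sub_mem_treeAt hs (hg.adapted j).2
    (hg.adaptedDual hs j).2 (hg.cocycle_adapted hs lam mu j) hP

end IsIFFT

end IFFTQuant

end

noncomputable section

namespace IFFTQuant

open Module

variable {𝕂 : Type*} [RCLike 𝕂] {d : ℕ}
variable {g : LieSubalgebra 𝕂 (PolyField 𝕂 d)} [FiniteDimensional 𝕂 g]

/-! ### Quantization of the sections of an irreducible submodule -/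

namespace IsIFFT

variable {𝓘 : TensorDecomposition g} {lam mu : 𝕂} {k : ℕ} {p : Fin (𝓘.num k)} {l : ℕ}
  {P : Symb 𝕂 d}

lemma casimir_mem_treesFrom (hg : IsIFFT g) (hs : ComplexifiedIsSimple g)
    (hP : P ∈ 𝓘.treesFrom lam mu k p l) :
    casimir g (lieOpSymb lam mu) P ∈ 𝓘.treesFrom lam mu k p l := by
  refine treesFrom_le (S := (𝓘.treesFrom lam mu k p l).comap (casimir g (lieOpSymb lam mu)))
    (fun j hj Q hQ => ?_) hP
  rw [Submodule.mem_comap, ← sub_add_cancel (casimir g (lieOpSymb lam mu) Q)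
    (casimir g (lieSymb (mu - lam)) Q)]
  exact add_mem (treeAt_le_treesFrom (Nat.le_succ_of_le hj) (hg.casimir_sub_mem_treeAt hs hQ))
    (treeAt_le_treesFrom hj (hg.casimir_mem_treeAt hs hQ))

lemma lieOpSymb_mem_treesFrom (hg : IsIFFT g) (hs : ComplexifiedIsSimple g)
    {X : PolyField 𝕂 d} (hX : X ∈ g)
    (hP : P ∈ 𝓘.treesFrom lam mu k p l) : lieOpSymb lam mu X P ∈ 𝓘.treesFrom lam mu k p l := by
  refine treesFrom_le (S := (𝓘.treesFrom lam mu k p l).comap (lieOpSymb lam mu X))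
    (fun j hj Q hQ => ?_) hP
  rw [Submodule.mem_comap, lieOpSymb_eq, LinearMap.add_apply]
  exact add_mem (treeAt_le_treesFrom hj (hg.lieSymb_mem_treeAt hs hX hQ))
    (treeAt_le_treesFrom (Nat.le_succ_of_le hj) (hg.cocycle_mem_treeAt hX hQ))

section Resonance

variable {α : 𝕂}

/-- Invert `C - α` on `𝒯^l`; the error made by using `𝒞` in place of `C` lies in `𝒯^(l+1)` and is
corrected recursively, until the trees vanish beyond level `k`. -/
lemma exists_casimir_sub_smul_eq (hg : IsIFFT g) (hs : ComplexifiedIsSimple g)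
    (hα : ∀ R ∈ 𝓘.treesFrom lam mu k p 1, casimir g (lieSymb (mu - lam)) R = α • R → R = 0)
    (hl : 1 ≤ l) (hP : P ∈ 𝓘.treeAt lam mu k p l) :
    ∃ w ∈ 𝓘.treesFrom lam mu k p 1, casimir g (lieOpSymb lam mu) w - α • w = P := by
  -- `m` bounds the number of levels left.
  obtain ⟨m, hm⟩ : ∃ m, k < l + m := ⟨k + 1, by omega⟩
  induction m generalizing l P with
  | zero => exact ⟨0, zero_mem _, by rw [treeAt_eq_zero hP hm, map_zero, smul_zero, sub_zero]⟩
  | succ m ih =>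
    rcases Nat.lt_or_ge k l with hkl | hkl
    · exact ⟨0, zero_mem _, by rw [treeAt_eq_zero hP hkl, map_zero, smul_zero, sub_zero]⟩
    · obtain ⟨n, hn⟩ := Nat.exists_eq_add_of_le hkl
      obtain ⟨q, hq0, hq⟩ := hg.exists_aeval_casimir hs 𝓘 (mu - lam) n
      obtain ⟨w, hw, hwP⟩ := exists_sub_smul_eq (T := 𝓘.treeAt lam mu k p l) (α := α)
        (fun x hx => hg.casimir_mem_treeAt hs hx)
        (fun x hx h => hα x (treeAt_le_treesFrom hl hx) h) hq0
        (fun x hx => hq x (treeAt_isHomogeneous hx hn.symm)) hP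
      obtain ⟨v, hv, hvw⟩ := ih (Nat.le_succ_of_le hl) (hg.casimir_sub_mem_treeAt hs hw) (by omega)
      refine ⟨w - v, sub_mem (treeAt_le_treesFrom hl hw) hv, ?_⟩
      rw [map_sub, smul_sub, ← hwP]
      rw [sub_eq_iff_eq_add] at hvw
      rw [hvw]
      abel

/-- Different levels have different degrees, so the top-degree part of `(𝒞 - α)P` is `(C - α)a`,
where `a` is the leading term of `P`. Hence `a = 0`, and `P` descends level by level until nothing
is left. -/
lemma eq_zero_of_casimir_eq (hg : IsIFFT g) (hs : ComplexifiedIsSimple g)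
    (hα : ∀ R ∈ 𝓘.treesFrom lam mu k p 1, casimir g (lieSymb (mu - lam)) R = α • R → R = 0)
    (hP : P ∈ 𝓘.treesFrom lam mu k p 1) (h : casimir g (lieOpSymb lam mu) P = α • P) : P = 0 := by
  have step : ∀ l, P ∈ 𝓘.treesFrom lam mu k p (l + 1) := fun l => by
    induction l with
    | zero => exact hP
    | succ l ih =>
      obtain ⟨a, ha, b, hb, rfl⟩ := exists_eq_add_of_mem_treesFrom ih
      suffices a = 0 by rwa [this, zero_add]
      rcases Nat.lt_or_ge k (l + 1) with hkl | hkl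
      · exact treeAt_eq_zero ha hkl
      · obtain ⟨n, hn⟩ := Nat.exists_eq_add_of_le hkl
        refine hα a (treeAt_le_treesFrom (Nat.le_add_left 1 l) ha) (sub_eq_zero.1 ?_)
        have hz : (casimir g (lieSymb (mu - lam)) a - α • a)
            + ((casimir g (lieOpSymb lam mu) a - casimir g (lieSymb (mu - lam)) a)
              + (casimir g (lieOpSymb lam mu) b - α • b)) = 0 := by
          rw [← sub_eq_zero.2 h, map_add, smul_add]
          abel
        have h1 : (casimir g (lieSymb (mu - lam)) a - α • a).IsHomogeneous n :=
          treeAt_isHomogeneous (sub_mem (hg.casimir_mem_treeAt hs ha) (Submodule.smul_mem _ _ ha))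
            hn.symm
        have h2 := congrArg (MvPolynomial.homogeneousComponent n) hz
        rw [map_add, map_zero, MvPolynomial.homogeneousComponent_of_mem h1, if_pos rfl,
          homogeneousComponent_treesFrom (l := l + 2) (by omega) (add_mem
            (treeAt_le_treesFrom le_rfl (hg.casimir_sub_mem_treeAt hs ha))
            (sub_mem (hg.casimir_mem_treesFrom hs hb) (Submodule.smul_mem _ _ hb))),
          add_zero] at h2
        exact h2
  exact treesFrom_eq_zero (step k) (Nat.lt_succ_self k)

/-- `q P` is the unique `α`-eigenvector of `𝒞` with leading term `P`. Quantifying over `P'` in the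
equivariance avoids carrying a proof that `L^t_X P` is a section. -/
lemma exists_quantization_sections (hg : IsIFFT g) (hs : ComplexifiedIsSimple g)
    (hE : ∀ P ∈ sections (𝓘.I k p), casimir g (lieSymb (mu - lam)) P = α • P)
    (hα : ∀ R ∈ 𝓘.treesFrom lam mu k p 1, casimir g (lieSymb (mu - lam)) R = α • R → R = 0) :
    ∃ q : sections (𝓘.I k p) →ₗ[𝕂] Symb 𝕂 d, (∀ P, q P - P ∈ 𝓘.treesFrom lam mu k p 1) ∧
      ∀ X ∈ g, ∀ P P' : sections (𝓘.I k p), (P' : Symb 𝕂 d) = lieSymb (mu - lam) X P →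
        q P' = lieOpSymb lam mu X (q P) := by
  have huniq : ∀ {P R R' : Symb 𝕂 d}, R - P ∈ 𝓘.treesFrom lam mu k p 1 →
      casimir g (lieOpSymb lam mu) R = α • R → R' - P ∈ 𝓘.treesFrom lam mu k p 1 →
      casimir g (lieOpSymb lam mu) R' = α • R' → R = R' := fun h1 h2 h3 h4 => by
    rw [← sub_eq_zero]
    refine hg.eq_zero_of_casimir_eq hs hα ?_ (by rw [map_sub, h2, h4, smul_sub])
    simpa using sub_mem h1 h3
  have hex : ∀ P : sections (𝓘.I k p), ∃ R : Symb 𝕂 d, R - P ∈ 𝓘.treesFrom lam mu k p 1 ∧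
      casimir g (lieOpSymb lam mu) R = α • R := fun P => by
    have hP : (P : Symb 𝕂 d) ∈ 𝓘.treeAt lam mu k p 0 := P.2
    -- Here `(𝒞 - α)w = (𝒞 - C)P = (𝒞 - α)P`, so `P - w` is the required eigenvector.
    obtain ⟨w, hw, h⟩ := hg.exists_casimir_sub_smul_eq hs hα le_rfl
      (hg.casimir_sub_mem_treeAt hs hP)
    rw [hE P P.2] at h
    refine ⟨P - w, ?_, ?_⟩
    · rw [sub_sub_cancel_left]
      exact neg_mem hw
    · rw [map_sub, smul_sub]
      rw [sub_eq_iff_eq_add] at h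
      rw [h]
      abel
  choose q hq1 hq2 using hex
  refine ⟨⟨⟨q, fun P Q => ?_⟩, fun c P => ?_⟩, hq1, fun X hX P P' hPP' => ?_⟩
  · refine huniq (hq1 _) (hq2 _) ?_ (by rw [map_add, hq2, hq2, smul_add])
    have := add_mem (hq1 P) (hq1 Q)
    rwa [← add_sub_add_comm] at this
  · refine huniq (hq1 _) (hq2 _) ?_ (by rw [map_smul, hq2, smul_comm])
    have := Submodule.smul_mem _ c (hq1 P)
    rwa [smul_sub] at this
  -- `𝓛_X (q P)` is again an eigenvector, since `𝒞` commutes with `𝓛_X`; its leading term is `L^t_X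
  -- P`, because `γ(X)P` belongs to the first level.
  · refine huniq (hq1 _) (hq2 _) ?_
      ((hg.lieOpSymb_casimir hs lam mu hX _).trans (by
        change lieOpSymb lam mu X (casimir g (lieOpSymb lam mu) (q P)) = α • lieOpSymb lam mu X (q P)
        rw [hq2, map_smul]))
    have hP : (P : Symb 𝕂 d) ∈ 𝓘.treeAt lam mu k p 0 := P.2
    have h1 := add_mem (hg.lieOpSymb_mem_treesFrom hs hX (hq1 P))
      (treeAt_le_treesFrom le_rfl (hg.cocycle_mem_treeAt hX hP))
    rw [map_sub, lieOpSymb_eq lam mu X, LinearMap.add_apply _ _ (P : Symb 𝕂 d), ← hPP',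
      ← lieOpSymb_eq] at h1
    have h2 : lieOpSymb lam mu X (q P) - P' = lieOpSymb lam mu X (q P)
        - (P' + cocycle lam mu X P) + cocycle lam mu X P := by abel
    change lieOpSymb lam mu X (q P) - P' ∈ _
    rw [h2]
    exact h1

end Resonance

end IsIFFT

end IFFTQuant

end

noncomputable section

namespace IFFTQuant

open Module

variable {𝕂 : Type*} [RCLike 𝕂] {d : ℕ}

/-! ### Maps of symbols which preserve the principal symbol -/

/-- The symbols of degree less than `k`. -/
abbrev lowerSymb (𝕂 : Type*) [RCLike 𝕂] (d k : ℕ) : Submodule (Smooth 𝕂 d) (Symb 𝕂 d) :=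
  ⨆ l : Fin k, MvPolynomial.homogeneousSubmodule (Fin d) (Smooth 𝕂 d) l

lemma mem_lowerSymb {k l : ℕ} (hlk : l < k) {P : Symb 𝕂 d} (hP : P.IsHomogeneous l) :
    P ∈ lowerSymb 𝕂 d k :=
  Submodule.mem_iSup_of_mem (⟨l, hlk⟩ : Fin k) hP

lemma lowerSymb_mono {k l : ℕ} (hlk : l ≤ k) : lowerSymb 𝕂 d l ≤ lowerSymb 𝕂 d k :=
  iSup_le fun i _ hP => mem_lowerSymb (i.2.trans_le hlk) hP

lemma homogeneousComponent_lowerSymb {k : ℕ} {P : Symb 𝕂 d} (hP : P ∈ lowerSymb 𝕂 d k) :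
    MvPolynomial.homogeneousComponent k P = 0 := by
  have h : lowerSymb 𝕂 d k ≤ LinearMap.ker (MvPolynomial.homogeneousComponent k) :=
    iSup_le fun i Q hQ => by
      rw [LinearMap.mem_ker, MvPolynomial.homogeneousComponent_of_mem hQ, if_neg i.2.ne']
  exact h hP

lemma sub_homogeneousComponent_mem {k : ℕ} {P : Symb 𝕂 d} (hP : P.totalDegree ≤ k) :
    P - MvPolynomial.homogeneousComponent k P ∈ lowerSymb 𝕂 d k := by
  have h : ∑ i ∈ Finset.range (k + 1), MvPolynomial.homogeneousComponent i P = P := by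
    conv_rhs => rw [← MvPolynomial.sum_homogeneousComponent P]
    refine (Finset.sum_subset (fun i hi => ?_) fun i _ hi => ?_).symm
    · rw [Finset.mem_range] at hi ⊢
      omega
    · rw [Finset.mem_range] at hi
      exact MvPolynomial.homogeneousComponent_eq_zero _ _ (by omega)
  rw [Finset.sum_range_succ] at h
  rw [sub_eq_iff_eq_add.2 h.symm]
  exact Submodule.sum_mem _ fun i hi => mem_lowerSymb (Finset.mem_range.1 hi)
    (MvPolynomial.homogeneousComponent_isHomogeneous _ _)

lemma mem_lowerSymb_succ {k : ℕ} {P : Symb 𝕂 d} (hP : P ∈ lowerSymb 𝕂 d (k + 1)) :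
    P.totalDegree ≤ k := by
  have h : lowerSymb 𝕂 d (k + 1) ≤ MvPolynomial.restrictTotalDegree (Fin d) (Smooth 𝕂 d) k :=
    iSup_le fun i Q hQ => (MvPolynomial.mem_restrictTotalDegree _ _ _).2
      ((MvPolynomial.IsHomogeneous.totalDegree_le hQ).trans (Nat.le_of_lt_succ i.2))
  exact (MvPolynomial.mem_restrictTotalDegree _ _ _).1 (h hP)

lemma lowerSymb_zero {P : Symb 𝕂 d} (hP : P ∈ lowerSymb 𝕂 d 0) : P = 0 := by
  rwa [lowerSymb, iSup_of_empty, Submodule.mem_bot] at hP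

lemma mem_lowerSymb_of_totalDegree_le {P : Symb 𝕂 d} {k : ℕ} (hP : P.totalDegree ≤ k) :
    P ∈ lowerSymb 𝕂 d (k + 1) := by
  have h1 := lowerSymb_mono (Nat.le_succ k) (sub_homogeneousComponent_mem hP)
  have h2 := mem_lowerSymb (Nat.lt_succ_self k)
    (MvPolynomial.homogeneousComponent_isHomogeneous k P)
  have h := add_mem h1 h2
  rwa [sub_add_cancel] at h

section Unipotent

variable {f : Module.End 𝕂 (Symb 𝕂 d)}

lemma map_mem_lowerSymb
    (hf : ∀ k, ∀ P : Symb 𝕂 d, P.IsHomogeneous k → f P - P ∈ lowerSymb 𝕂 d k) {k : ℕ}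
    {P : Symb 𝕂 d} (hP : P ∈ lowerSymb 𝕂 d k) : f P ∈ lowerSymb 𝕂 d k := by
  induction hP using Submodule.iSup_induction' with
  | mem i P hP =>
    rw [← sub_add_cancel (f P) P]
    exact add_mem (lowerSymb_mono i.2.le (hf i P hP)) (mem_lowerSymb i.2 hP)
  | zero => rw [map_zero]; exact zero_mem _
  | add P Q _ _ hP hQ => rw [map_add]; exact add_mem hP hQ

/-- If `f P = 0`, the top component of `P` is, up to sign, a sum of terms of lower degree, hence
zero. -/
lemma eq_zero_of_unipotent
    (hf : ∀ k, ∀ P : Symb 𝕂 d, P.IsHomogeneous k → f P - P ∈ lowerSymb 𝕂 d k) {P : Symb 𝕂 d}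
    (hP : f P = 0) : P = 0 := by
  have h : ∀ k, P ∈ lowerSymb 𝕂 d k → P = 0 := fun k => by
    induction k with
    | zero => exact lowerSymb_zero
    | succ k ih =>
      intro hPk
      have h1 := sub_homogeneousComponent_mem (mem_lowerSymb_succ hPk)
      have hs := MvPolynomial.homogeneousComponent_isHomogeneous k P
      have h2 := neg_mem (add_mem (map_mem_lowerSymb hf h1) (hf k _ hs))
      have h3 : -(f (P - MvPolynomial.homogeneousComponent k P)
          + (f (MvPolynomial.homogeneousComponent k P) - MvPolynomial.homogeneousComponent k P))
            = MvPolynomial.homogeneousComponent k P := by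
        rw [map_sub, hP]
        abel
      rw [h3] at h2
      have h4 := homogeneousComponent_lowerSymb h2
      rw [MvPolynomial.homogeneousComponent_of_mem hs, if_pos rfl] at h4
      rw [h4, sub_zero] at h1
      exact ih h1
  exact h _ (mem_lowerSymb_of_totalDegree_le le_rfl)

/-- Subtracting `f` of the top component leaves a symbol of lower degree, handled by induction;
keeping track of the degree of the preimage also controls the inverse. -/
lemma exists_of_unipotent
    (hf : ∀ k, ∀ P : Symb 𝕂 d, P.IsHomogeneous k → f P - P ∈ lowerSymb 𝕂 d k) (k : ℕ) :
    ∀ u ∈ lowerSymb 𝕂 d k, ∃ v ∈ lowerSymb 𝕂 d k, f v = u := by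
  induction k with
  | zero => exact fun u hu => ⟨0, zero_mem _, by rw [map_zero, lowerSymb_zero hu]⟩
  | succ k ih =>
    intro u hu
    have h1 := sub_homogeneousComponent_mem (mem_lowerSymb_succ hu)
    have hs := MvPolynomial.homogeneousComponent_isHomogeneous k u
    obtain ⟨v, hv, hvu⟩ := ih _ (sub_mem h1 (hf k _ hs))
    refine ⟨v + MvPolynomial.homogeneousComponent k u,
      add_mem (lowerSymb_mono (Nat.le_succ k) hv) (mem_lowerSymb (Nat.lt_succ_self k) hs), ?_⟩
    rw [map_add, hvu]
    abel

/-- This is the principal symbol condition, phrased for the inverse of `f`. -/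
lemma sub_mem_of_unipotent
    (hf : ∀ k, ∀ P : Symb 𝕂 d, P.IsHomogeneous k → f P - P ∈ lowerSymb 𝕂 d k) {k : ℕ}
    {v : Symb 𝕂 d} (hv : (f v).totalDegree ≤ k) :
    v - MvPolynomial.homogeneousComponent k (f v) ∈ lowerSymb 𝕂 d k := by
  have h1 := sub_homogeneousComponent_mem hv
  have hs := MvPolynomial.homogeneousComponent_isHomogeneous k (f v)
  obtain ⟨w, hw, hwv⟩ := exists_of_unipotent hf k _ (sub_mem h1 (hf k _ hs))
  have h2 : v - (w + MvPolynomial.homogeneousComponent k (f v)) = 0 :=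
    eq_zero_of_unipotent hf (by rw [map_sub, map_add, hwv]; abel)
  rw [sub_eq_of_eq_add (sub_eq_zero.1 h2)]
  exact hw

end Unipotent

/-! ### The decomposition of the space of symbols -/

variable {g : LieSubalgebra 𝕂 (PolyField 𝕂 d)}

namespace TensorDecomposition

/-- The space of sections of an irreducible summand. -/
abbrev summand (𝓘 : TensorDecomposition g) (i : Σ k, Fin (𝓘.num k)) : Submodule 𝕂 (Symb 𝕂 d) :=
  sections (𝓘.I i.1 i.2)

/-- The component of degree `k` discards the summands with another degree and reduces to
independence within `⋁^k`. -/
lemma iSupIndep_I (𝓘 : TensorDecomposition g) :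
    iSupIndep fun i : Σ k, Fin (𝓘.num k) => 𝓘.I i.1 i.2 := by
  rintro ⟨k, p⟩
  rw [Submodule.disjoint_def]
  intro T hT hT'
  have hle : ⨆ (j : Σ k, Fin (𝓘.num k)) (_ : j ≠ ⟨k, p⟩), 𝓘.I j.1 j.2
      ≤ (⨆ (q) (_ : q ≠ p), 𝓘.I k q).comap (MvPolynomial.homogeneousComponent k) := by
    refine iSup₂_le fun ⟨l, q⟩ hne S hS => ?_
    rw [Submodule.mem_comap, MvPolynomial.homogeneousComponent_of_mem (𝓘.I_le l q hS)]
    split_ifs with h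
    · subst h
      exact Submodule.mem_iSup_of_mem q (Submodule.mem_iSup_of_mem (fun h => hne (by rw [h])) hS)
    · exact zero_mem _
  have h := hle hT'
  rw [Submodule.mem_comap, MvPolynomial.homogeneousComponent_of_mem (𝓘.I_le k p hT),
    if_pos rfl] at h
  exact (Submodule.disjoint_def.1 (𝓘.independent k p)) T hT h

lemma mem_iSup_summand (𝓘 : TensorDecomposition g) (P : Symb 𝕂 d) : P ∈ ⨆ i, 𝓘.summand i := by
  rw [← MvPolynomial.sum_homogeneousComponent P]
  refine Submodule.sum_mem _ fun k _ => ?_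
  have h : ⨆ p, sections (𝓘.I k p) ≤ ⨆ i, 𝓘.summand i :=
    iSup_le fun p => le_iSup 𝓘.summand ⟨k, p⟩
  exact h (mem_iSup_sections (𝓘.iSup_eq k) (MvPolynomial.homogeneousComponent_isHomogeneous _ _))

lemma exists_glue (𝓘 : TensorDecomposition g) (q : ∀ i, 𝓘.summand i →ₗ[𝕂] Symb 𝕂 d) :
    ∃ f : Module.End 𝕂 (Symb 𝕂 d), ∀ i (P : 𝓘.summand i), f P = q i P := by
  classical
  have h : DirectSum.IsInternal 𝓘.summand :=
    DirectSum.isInternal_submodule_of_iSupIndep_of_iSup_eq_top (iSupIndep_sections 𝓘.iSupIndep_I)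
      (eq_top_iff.2 fun P _ => 𝓘.mem_iSup_summand P)
  let e := LinearEquiv.ofBijective (DirectSum.coeLinearMap 𝓘.summand) h
  refine ⟨DirectSum.toModule 𝕂 _ _ q ∘ₗ e.symm.toLinearMap, fun i P => ?_⟩
  have he : e.symm P = DirectSum.lof 𝕂 _ (fun i => 𝓘.summand i) i P := by
    rw [LinearEquiv.symm_apply_eq]
    exact (DirectSum.coeLinearMap_lof _ _ _).symm
  change DirectSum.toModule 𝕂 _ _ q (e.symm P) = _
  rw [he, DirectSum.toModule_lof]

lemma treesFrom_le_lowerSymb (𝓘 : TensorDecomposition g) (lam mu : 𝕂) (k : ℕ)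
    (p : Fin (𝓘.num k)) : 𝓘.treesFrom lam mu k p 1 ≤ (lowerSymb 𝕂 d k).restrictScalars 𝕂 :=
  treesFrom_le fun j hj P hP => by
    rcases Nat.lt_or_ge k j with h | h
    · rw [treeAt_eq_zero hP h]
      exact zero_mem _
    · obtain ⟨n, rfl⟩ := Nat.exists_eq_add_of_le h
      exact mem_lowerSymb (by omega) (treeAt_isHomogeneous hP rfl)

end TensorDecomposition

end IFFTQuant

/-! ### Gluing the quantizations of the summands -/

theorem mainTheorem2 {𝕂 : Type*} [RCLike 𝕂] {d : ℕ}
    (g : LieSubalgebra 𝕂 (IFFTQuant.PolyField 𝕂 d)) [FiniteDimensional 𝕂 g]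
    (hg : IFFTQuant.IsIFFT g) (hs : IFFTQuant.ComplexifiedIsSimple g)
    (𝓘 : IFFTQuant.TensorDecomposition g) (lam mu : ℝ)
    (hcrit : ¬ IFFTQuant.IsCritical g 𝓘 (lam : 𝕂) (mu : 𝕂)) :
    ∃ Q : IFFTQuant.Symb 𝕂 d ≃ₗ[𝕂] IFFTQuant.DiffOp 𝕂 d,
      IFFTQuant.IsEquivariantQuantization g (lam : 𝕂) (mu : 𝕂) Q := by
  open IFFTQuant in
  choose α hα using fun i : Σ k, Fin (𝓘.num k) =>
    hg.exists_casimir_sections hs 𝓘 ((mu : 𝕂) - lam) i.1 i.2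
  -- Non-criticality, applied to the eigenvalue of `C` on each summand, is exactly injectivity of `C
  -- - α` on the trees of positive level.
  have hnc : ∀ i : Σ k, Fin (𝓘.num k), ∀ R ∈ 𝓘.treesFrom (lam : 𝕂) mu i.1 i.2 1,
      casimir g (lieSymb ((mu : 𝕂) - lam)) R = α i • R → R = 0 := fun i R hR h => by
    by_contra hR0
    exact hcrit ⟨i.1, i.2, α i, hα i, R, hR, hR0, h⟩
  choose q hq1 hq2 using fun i => hg.exists_quantization_sections hs (hα i) (hnc i)
  obtain ⟨f, hf⟩ := 𝓘.exists_glue q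
  have hfE : ∀ X ∈ g, ∀ P, f (lieSymb ((mu : 𝕂) - lam) X P) = lieOpSymb (lam : 𝕂) mu X (f P) :=
    fun X hX P => by
      have hP := 𝓘.mem_iSup_summand P
      induction hP using Submodule.iSup_induction' with
      | mem i P hP =>
        -- Level 0 of the tree is the summand itself, so its stability is the case `l = 0`.
        have hXP : lieSymb ((mu : 𝕂) - lam) X P ∈ 𝓘.summand i :=
          hg.lieSymb_mem_treeAt (l := 0) hs hX hP
        rw [hf i ⟨P, hP⟩, hf i ⟨_, hXP⟩]
        exact hq2 i X hX _ _ rfl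
      | zero => simp only [map_zero]
      | add P Q _ _ hP hQ => simp only [map_add, hP, hQ]
  have hfU : ∀ k, ∀ P : Symb 𝕂 d, P.IsHomogeneous k → f P - P ∈ lowerSymb 𝕂 d k :=
    fun k P hP => by
      have hP' := mem_iSup_sections (𝓘.iSup_eq k) hP
      clear hP
      induction hP' using Submodule.iSup_induction' with
      | mem p P hP =>
        rw [hf ⟨k, p⟩ ⟨P, hP⟩]
        exact 𝓘.treesFrom_le_lowerSymb (lam : 𝕂) mu k p (hq1 ⟨k, p⟩ ⟨P, hP⟩)
      | zero => simp only [map_zero, sub_zero]; exact zero_mem _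
      | add P Q _ _ hP hQ => rw [map_add, add_sub_add_comm]; exact add_mem hP hQ
  have hbij : Function.Bijective f := by
    refine ⟨(injective_iff_map_eq_zero f).2 fun P hP => eq_zero_of_unipotent hfU hP, fun u => ?_⟩
    obtain ⟨v, -, hv⟩ := exists_of_unipotent hfU _ u (mem_lowerSymb_of_totalDegree_le le_rfl)
    exact ⟨v, hv⟩
  let e := LinearEquiv.ofBijective f hbij
  refine ⟨e.trans totalSymbol.symm, ⟨fun X hX P => ?_, fun k D hD => ?_⟩⟩
  · change totalSymbol.symm (f (lieSymb ((mu : 𝕂) - lam) X P))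
      = lieOp (lam : 𝕂) mu X (totalSymbol.symm (f P))
    rw [hfE X hX, LinearEquiv.symm_apply_eq]
    rfl
  · change e.symm (totalSymbol D) - MvPolynomial.homogeneousComponent k (totalSymbol D) ∈ _
    have hfe : f (e.symm (totalSymbol D)) = totalSymbol D := e.apply_symm_apply _
    rw [← hfe]
    -- Only the argument of the homogeneous component should be written as `f` of the preimage, so
    -- the rewriting is undone in the first term.
    conv in e.symm (f _) => rw [hfe]
    exact sub_mem_of_unipotent hfU (by rw [hfe]; exact hD)

end
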